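/- Let $K$ be a field of characteristic zero, $n\geq 1$, $P_n=K[x_1,\dots,x_n]$, $\partial_i=\partial/\partial x_i$, and $H_i=\partial_ix_i\in \mathrm{End}_K(P_n)$, an invertible linear map. The Jacobian algebra $\mathbb{A}_n$ is the subalgebra of $\mathrm{End}_K(P_n)$ generated by the Weyl algebra $K\langle x_1,\dots,x_n,\partial_1,\dots,\partial_n\rangle$ and $H_1^{-1},\dots,H_n^{-1}$. Put $y_i=H_i^{-1}\partial_i$ and $E_{kl}(i)=x_i^ky_i^l-x_i^{k+1}y_i^{l+1}$ for $k,l\geq 0$; let $\mathfrak{p}_i$ be the ideal of $\mathbb{A}_n$ generated by all $E_{kl}(i)$, and let $\mathfrak{a}_n=\mathfrak{p}_1+\cdots+\mathfrak{p}_n$. Put $\mathcal{A}_n=\mathbb{A}_n/\mathfrak{a}_n$, let $\mathcal{A}_1(i)$ be the subalgebra of $\mathcal{A}_n$ generated by the images of $x_i,\partial_i,H_i^{-1}$ (it is isomorphic to $\mathcal{A}_1$ via $x_i\mapsto x$, $H_i\mapsto H$, and $x_i$ is invertible in it), and let $\mathcal{G}_n=\mathrm{Aut}_{K\text{-alg}}(\mathcal{A}_n)$,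 $\mathcal{G}_1(i)=\mathrm{Aut}_{K\text{-alg}}(\mathcal{A}_1(i))$. The symmetric group $S_n$ acts faithfully on $\mathcal{A}_n$ by $x_i\mapsto x_{s(i)}$, $H_i\mapsto H_{s(i)}$, and every tuple $(\tau_i)\in\prod_{i=1}^n\mathcal{G}_1(i)$ extends to exactly one automorphism of $\mathcal{A}_n$ whose restriction to each $\mathcal{A}_1(i)$ is $\tau_i$; so $S_n$ and $\prod_i\mathcal{G}_1(i)$ are regarded as subgroups of $\mathcal{G}_n$. As usual $\mathrm{Out}=\mathrm{Aut}/\mathrm{Inn}$, and $A\ltimes B$ denotes a semidirect product with normal factor $B$. Then: 1. $\mathcal{G}_n=S_n\ltimes\prod_{i=1}^n\mathcal{G}_1(i)$. 2. The centre of $\mathcal{G}_n$ is $\{e,\sigma_{(-1,\dots,-1)}\}$, where $\sigma_{(-1,\dots,-1)}: x_i\mapsto -x_i$, $H_i\mapsto H_i$ for all $i$. 3. $\mathrm{Inn}(\mathcal{A}_n)=\prod_{i=1}^n\mathrm{Inn}(\mathcal{A}_1(i))$. 4. $\mathrm{Out}(\mathcal{A}_n)\simeq S_n\ltimes\prod_{i=1}^n\mathrm{Out}(\mathcal{A}_1(i))$,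 the isomorphism being induced by the equalities in 1 and 3. 5. $[\mathrm{Inn}(\mathcal{A}_n),\mathrm{Inn}(\mathcal{A}_n)]=\prod_{i=1}^n[\mathrm{Inn}(\mathcal{A}_1(i)),\mathrm{Inn}(\mathcal{A}_1(i))]$, and $[\mathrm{Inn}(\mathcal{A}_1(i)),\mathrm{Inn}(\mathcal{A}_1(i))]$ is the group of all automorphisms $x_i\mapsto ux_i$, $H_i\mapsto H_i$ of $\mathcal{A}_1(i)$, where $u$ runs through the finite products $\prod_{j\in\mathbb{Z}}\left(\frac{(H_i+j)(H_i+j+2)}{(H_i+j+1)^2}\right)^{m_j}$, $m_j\in\mathbb{Z}$. 6. $[\mathcal{G}_n,\mathcal{G}_n]=[S_n,S_n]\ltimes\left([S_n,\prod_{i=1}^n\mathcal{G}_1(i)]\cdot\prod_{i=1}^n[\mathcal{G}_1(i),\mathcal{G}_1(i)]\right)$, and $\mathcal{G}_n/[\mathcal{G}_n,\mathcal{G}_n]\simeq S_n/[S_n,S_n]\times\mathcal{G}_1/[\mathcal{G}_1,\mathcal{G}_1]$. If, in addition, $K$ is algebraically closed, then $\mathcal{G}_n/[\mathcal{G}_n,\mathcal{G}_n]$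 is isomorphic to $\mathbb{Z}_2^3$ if $n=1$ and to $\mathbb{Z}_2^4$ if $n>1$. 7. Write $x=x_1$, $H=H_1$ in $\mathcal{A}_1$, and let $\mathcal{L}_1^*$ be the group of units of the subalgebra $K[H,(H+j)^{-1}]_{j\in\mathbb{Z}}$; then $K^*\times\mathbb{Z}^{(\mathbb{Z})}\simeq\mathcal{L}_1^*$ via $(\lambda,(m_j))\mapsto\lambda\prod_j(H+j)^{m_j}$. There are automorphisms $\zeta:x\mapsto x^{-1},H\mapsto -H$ of order two, $s_j:x\mapsto x,H\mapsto H-j$ $(j\in\mathbb{Z})$ and $\sigma_u:x\mapsto ux,H\mapsto H$ $(u\in\mathcal{L}_1^*)$ of $\mathcal{A}_1$, the maps $j\mapsto s_j$ and $u\mapsto\sigma_u$ are injective group homomorphisms, and $$\mathcal{G}_1=\langle\zeta\rangle\ltimes\{s_j\mid j\in\mathbb{Z}\}\ltimes\{\sigma_u\mid u\in\mathcal{L}_1^*\}\simeq\mathbb{Z}_2\ltimes\mathbb{Z}\ltimes(K^*\times\mathbb{Z}^{(\mathbb{Z})}).$$ Moreover $[\mathcal{G}_1,\mathcal{G}_1]=\{s_{2j}\mid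 j\in\mathbb{Z}\}\ltimes\{\sigma_u\mid u\in K^{*2}\mathcal{L}_1^0\langle -H^2\rangle\}$, where $\mathcal{L}_1^0$ is the group of the finite products $\prod_j\left(\frac{H+j}{H+j+1}\right)^{m_j}$, and $\mathcal{G}_1/[\mathcal{G}_1,\mathcal{G}_1]\simeq\mathbb{Z}_2\times\mathbb{Z}_2\times(K^*\times\langle H\rangle)/(K^{*2}\langle -H^2\rangle)$, where $\langle H\rangle\simeq\mathbb{Z}$. -/

import Mathlib

/-! ### Inner and outer automorphisms, internal semidirect products -/

section Groups

/-- The group `Inn(R)` of the inner automorphisms `a ↦ u a u⁻¹`, `u ∈ Rˣ`, of a `K`-algebra `R`. -/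
def innAut (K R : Type*) [CommSemiring K] [Ring R] [Algebra K R] : Subgroup (R ≃ₐ[K] R) where
  carrier := {σ | ∃ u : Rˣ, ∀ a, σ a = u * a * (u⁻¹ : Rˣ)}
  one_mem' := ⟨1, fun a => by simp⟩
  mul_mem' := by
    rintro σ τ ⟨u, hu⟩ ⟨v, hv⟩
    exact ⟨u * v, fun a => by simp [AlgEquiv.mul_apply, hu, hv, mul_assoc]⟩
  inv_mem' := by
    rintro σ ⟨u, hu⟩
    refine ⟨u⁻¹, fun a => ?_⟩
    apply σ.injective
    have h : σ (σ⁻¹ a) = a := σ.apply_symm_apply a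
    rw [h, hu]
    simp [mul_assoc]

instance innAut_normal (K R : Type*) [CommSemiring K] [Ring R] [Algebra K R] :
    (innAut K R).Normal where
  conj_mem := by
    rintro σ ⟨u, hu⟩ g
    refine ⟨Units.map (g : R →* R) u, fun a => ?_⟩
    simp [AlgEquiv.mul_apply, hu, ← map_inv]

/-- The group `Out(R) = Aut(R) / Inn(R)`. -/
abbrev OutAut (K R : Type*) [CommSemiring K] [Ring R] [Algebra K R] : Type _ :=
  (R ≃ₐ[K] R) ⧸ innAut K R

/-- `C = A ⋉ B` for subgroups of one group: `C` is generated by `A` and `B`, the subgroup `B` is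
normalized by `A`, and `A ∩ B = {1}`. -/
structure IsInternalSemidirect {G : Type*} [Group G] (C A B : Subgroup G) : Prop where
  sup_eq : A ⊔ B = C
  disjoint : Disjoint A B
  conj_mem : ∀ a ∈ A, ∀ b ∈ B, a * b * a⁻¹ ∈ B

end Groups

/-! ### Groups of units attached to an element `H` of an algebra -/

section UnitGroups

/-- The subalgebra `K[H, (H + j)⁻¹]_{j ∈ ℤ}`. -/
def calL (K : Type*) {R : Type*} [Field K] [Ring R] [Algebra K R] (H : R) : Subalgebra K R :=
  Algebra.adjoin K ({H} ∪ {a | ∃ j : ℤ, a * (H + (j : R)) = 1 ∧ (H + (j : R)) * a = 1})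

/-- The group of units of `K[H, (H + j)⁻¹]_{j ∈ ℤ}`. -/
def calLUnits (K : Type*) {R : Type*} [Field K] [Ring R] [Algebra K R] (H : R) : Subgroup Rˣ :=
  (calL K H).toSubmonoid.units

/-- The group of all products `∏ ((H + j) / (H + j + 1)) ^ n_j`. -/
def calL0 {R : Type*} [Ring R] (H : R) : Subgroup Rˣ :=
  Subgroup.closure {u | ∃ j : ℤ, (u : R) * (H + (j : R) + 1) = H + (j : R)}

/-- The group of all products `∏ ((H + j) (H + j + 2) / (H + j + 1) ^ 2) ^ n_j`. -/
def calL00 {R : Type*} [Ring R] (H : R) : Subgroup Rˣ :=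
  Subgroup.closure
    {u | ∃ j : ℤ, (u : R) * (H + (j : R) + 1) ^ 2 = (H + (j : R)) * (H + (j : R) + 2)}

/-- The nonzero scalars of `K`, as units of `R`. -/
def scalarUnit (K R : Type*) [Field K] [Ring R] [Algebra K R] : Kˣ →* Rˣ :=
  Units.map (algebraMap K R : K →* R)

/-- The group `K*² · calL0 · ⟨-H²⟩`. -/
def calLComm (K : Type*) {R : Type*} [Field K] [Ring R] [Algebra K R] (H : R) : Subgroup Rˣ :=
  ((scalarUnit K R).comp (powMonoidHom 2)).range ⊔ calL0 H ⊔
    Subgroup.closure {u | (u : R) = -H ^ 2}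

/-- The automorphisms `σ_u : x ↦ u x, H ↦ H` of `R` with `u` in a given group `U` of units. -/
def sigmaAut (K : Type*) {R : Type*} [Field K] [Ring R] [Algebra K R] (x H : R)
    (U : Subgroup Rˣ) : Set (R ≃ₐ[K] R) :=
  {σ | ∃ u ∈ U, σ x = u * x ∧ σ H = H}

end UnitGroups

/-! ### The Jacobian algebra and its factor algebra -/

namespace Jacobian

open MvPolynomial

noncomputable section

variable (K : Type*) [Field K] (n : ℕ)

/-- The algebra of all `K`-linear maps of the polynomial algebra `K[x_1, …, x_n]`. -/
abbrev EndP : Type _ := Module.End K (MvPolynomial (Fin n) K)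

variable {n}

/-- Multiplication by `x_i`. -/
def opX (i : Fin n) : EndP K n := LinearMap.mulLeft K (X i)

/-- The partial derivative with respect to `x_i`. -/
def opD (i : Fin n) : EndP K n := (pderiv (R := K) i).toLinearMap

/-- `H_i = ∂_i x_i`. -/
def opH (i : Fin n) : EndP K n := opD K i * opX K i

/-- The operator `x^α ↦ (α_i + 1)⁻¹ x^α`, which is the inverse of `H_i` in characteristic zero
(see `opH_mul_opHinv` and `opHinv_mul_opH`). -/
def opHinv (i : Fin n) : EndP K n :=
  (basisMonomials (Fin n) K).constr K fun α => ((α i : K) + 1)⁻¹ • monomial α (1 : K)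

theorem opX_monomial (i : Fin n) (α : Fin n →₀ ℕ) :
    opX K i (monomial α 1) = monomial (α + Finsupp.single i 1) 1 := by
  simp [opX, X, monomial_mul, add_comm]

theorem opH_monomial (i : Fin n) (α : Fin n →₀ ℕ) :
    opH K i (monomial α 1) = ((α i : K) + 1) • monomial α 1 := by
  rw [opH, Module.End.mul_apply, opX_monomial]
  simp [opD, pderiv_monomial, smul_monomial]

theorem opHinv_monomial (i : Fin n) (α : Fin n →₀ ℕ) :
    opHinv K i (monomial α 1) = ((α i : K) + 1)⁻¹ • monomial α 1 := by
  have h := (basisMonomials (Fin n) K).constr_basis K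
    (fun α => ((α i : K) + 1)⁻¹ • monomial α (1 : K)) α
  rwa [coe_basisMonomials] at h

theorem opHinv_mul_opH [CharZero K] (i : Fin n) : opHinv K i * opH K i = 1 := by
  refine (basisMonomials (Fin n) K).ext fun α => ?_
  have h : (α i : K) + 1 ≠ 0 := Nat.cast_add_one_ne_zero (α i)
  simp only [coe_basisMonomials, Module.End.mul_apply, opH_monomial, map_smul, opHinv_monomial,
    smul_smul, mul_inv_cancel₀ h, one_smul, Module.End.one_apply]

theorem opH_mul_opHinv [CharZero K] (i : Fin n) : opH K i * opHinv K i = 1 := by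
  refine (basisMonomials (Fin n) K).ext fun α => ?_
  have h : (α i : K) + 1 ≠ 0 := Nat.cast_add_one_ne_zero (α i)
  simp only [coe_basisMonomials, Module.End.mul_apply, opH_monomial, map_smul, opHinv_monomial,
    smul_smul, inv_mul_cancel₀ h, one_smul, Module.End.one_apply]

/-- `y_i = H_i⁻¹ ∂_i`. -/
def opY (i : Fin n) : EndP K n := opHinv K i * opD K i

theorem opY_mul_opX [CharZero K] (i : Fin n) : opY K i * opX K i = 1 := by
  rw [opY, mul_assoc]
  exact opHinv_mul_opH K i

variable (n) in
/-- The Weyl algebra, as an algebra of operators on `K[x_1, …, x_n]`. -/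
def weyl : Subalgebra K (EndP K n) :=
  Algebra.adjoin K (Set.range (opX K) ∪ Set.range (opD K))

variable (n) in
/-- The Jacobian algebra: generated by the Weyl algebra and `H_1⁻¹, …, H_n⁻¹`. -/
def jac : Subalgebra K (EndP K n) :=
  Algebra.adjoin K ((weyl K n : Set (EndP K n)) ∪ Set.range (opHinv K))

variable (n) in
/-- The Jacobian algebra as a type. -/
def Jac : Type _ := jac K n

instance : Ring (Jac K n) := inferInstanceAs (Ring (jac K n))

instance : Algebra K (Jac K n) := inferInstanceAs (Algebra K (jac K n))

/-- `x_i` as an element of the Jacobian algebra. -/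
def jX (i : Fin n) : Jac K n :=
  ⟨opX K i, Algebra.subset_adjoin (.inl (Algebra.subset_adjoin (.inl ⟨i, rfl⟩)))⟩

/-- `∂_i` as an element of the Jacobian algebra. -/
def jD (i : Fin n) : Jac K n :=
  ⟨opD K i, Algebra.subset_adjoin (.inl (Algebra.subset_adjoin (.inr ⟨i, rfl⟩)))⟩

/-- `H_i⁻¹` as an element of the Jacobian algebra. -/
def jHinv (i : Fin n) : Jac K n :=
  ⟨opHinv K i, Algebra.subset_adjoin (.inr ⟨i, rfl⟩)⟩

/-- The matrix units `E_kl(i) = x_i^k y_i^l - x_i^(k+1) y_i^(l+1)`, where `y_i = H_i⁻¹ ∂_i`. -/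
def jE (i : Fin n) (k l : ℕ) : Jac K n :=
  jX K i ^ k * (jHinv K i * jD K i) ^ l - jX K i ^ (k + 1) * (jHinv K i * jD K i) ^ (l + 1)

/-- The two-sided ideal `𝔭_i`, generated by the matrix units `E_kl(i)`, `k, l ∈ ℕ`. -/
def idealP (i : Fin n) : TwoSidedIdeal (Jac K n) :=
  TwoSidedIdeal.span (Set.range fun p : ℕ × ℕ => jE K i p.1 p.2)

variable (n) in
/-- The ideal `𝔞_n = 𝔭_1 + ⋯ + 𝔭_n`. -/
def idealA : TwoSidedIdeal (Jac K n) := ⨆ i : Fin n, idealP K i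

variable (n) in
/-- The algebra `𝒜_n`, the factor algebra of the Jacobian algebra by `𝔞_n`. -/
def CA : Type _ := Jac K n ⧸ (idealA K n).asIdeal

instance : Ring (CA K n) := inferInstanceAs (Ring (Jac K n ⧸ (idealA K n).asIdeal))

instance : Algebra K (CA K n) := inferInstanceAs (Algebra K (Jac K n ⧸ (idealA K n).asIdeal))

variable (n) in
/-- The canonical map from the Jacobian algebra onto `𝒜_n`. -/
def toCA : Jac K n →ₐ[K] CA K n := Ideal.Quotient.mkₐ K (idealA K n).asIdeal

/-- `x_i ∈ 𝒜_n`. -/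
def cX (i : Fin n) : CA K n := toCA K n (jX K i)

/-- `H_i = ∂_i x_i ∈ 𝒜_n`. -/
def cH (i : Fin n) : CA K n := toCA K n (jD K i * jX K i)

/-- The subalgebra `𝒜_1(i)` of `𝒜_n`, generated by the images of `x_i`, `∂_i` and `H_i⁻¹`. -/
def fac (i : Fin n) : Subalgebra K (CA K n) :=
  Algebra.adjoin K {toCA K n (jX K i), toCA K n (jD K i), toCA K n (jHinv K i)}

/-- `x_i` as an element of `𝒜_1(i)`. -/
def facX (i : Fin n) : fac K i := ⟨cX K i, Algebra.subset_adjoin (by simp [cX])⟩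

/-- `H_i` as an element of `𝒜_1(i)`. -/
def facH (i : Fin n) : fac K i :=
  ⟨cH K i, by
    rw [cH, map_mul]
    exact mul_mem (Algebra.subset_adjoin (by simp)) (Algebra.subset_adjoin (by simp))⟩

/-- In `𝒜_n` the element `x_i` is invertible, with inverse the image of `y_i`. -/
def cXUnit [CharZero K] (i : Fin n) : (CA K n)ˣ where
  val := cX K i
  inv := toCA K n (jHinv K i * jD K i)
  val_inv := by
    have h : jE K i 0 0 ∈ (idealA K n).asIdeal := by
      rw [TwoSidedIdeal.mem_asIdeal]
      exact (le_iSup (fun i : Fin n => idealP K i) i) (TwoSidedIdeal.subset_span ⟨(0, 0), rfl⟩)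
    have h' : toCA K n (jE K i 0 0) = 0 := Ideal.Quotient.eq_zero_iff_mem.mpr h
    rw [jE, map_sub, sub_eq_zero] at h'
    simpa [cX] using h'.symm
  inv_val := by
    rw [cX, ← map_mul]
    have h : jHinv K i * jD K i * jX K i = 1 := Subtype.ext (opY_mul_opX K i)
    rw [h, map_one]

end

end Jacobian

open Jacobian

/-! Everything rests on a normal form. Let $L$ be the commutative algebra generated by the $H_i$ and
the $(H_i+j)^{-1}$, realized as a localization of a polynomial ring. Each element of $\mathcal{A}_n$
is uniquely a finite sum $\sum_\alpha l_\alpha x^\alpha$ with $l_\alpha\in L$,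
$\alpha\in\mathbb{Z}^n$, and $x^\alpha l = \tau_\alpha(l)x^\alpha$, where $\tau_\alpha$ is the shift
$H_i\mapsto H_i-\alpha_i$. Thus $\mathcal{A}_n$ is a skew Laurent ring over $L$. Uniqueness
(`cSys_injective`) comes from the action on polynomials: operators in $\mathfrak{a}_n$ kill all
monomials with large exponents, whereas a nonzero sum does not. The same holds for each
$\mathcal{A}_1(i)$. `ShiftSystem` records the relations and `IsBasis` the normal form, so that the
later arguments treat $\mathcal{A}_n$ and $\mathcal{A}_1(i)$ uniformly.

Since $\mathbb{Z}^n$ has the two-unique-sums property and $L$ is a domain, units are homogeneous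
(`exists_unit`); by unique factorization the units of $L$ are scalars times products of powers of
the $H_i+j$. This makes automorphisms rigid. The elements $\sigma(H_i)$ and $\sigma(H_i)+1$ are both
units, hence of degree zero, and every unit shift changes $\sigma(H_i)$ by an integer; a unit of $L$
with this property is constant or linear in one variable. Applying this to $\sigma^{-1}$ as well
gives $\sigma(H_i)=\pm(H_{\pi(i)}+m_i)$ with $\pi$ a permutation. The commutation relations then
force $\sigma(x_i)=u_i\,x_{\pi(i)}^{\pm1}$ with $u_i$ involving only $H_{\pi(i)}$
(`exists_map_form`). So automorphisms permute the subalgebras $\mathcal{A}_1(i)$, which gives the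
semidirect decomposition (`isInternalSemidirect_top`).

The other statements follow. Units of $\mathcal{A}_n$ are products of units of the commuting
factors, which gives $\mathrm{Inn}$ and $\mathrm{Out}$. A central automorphism multiplies every unit
by a scalar; commuting with transpositions and with $x_i\mapsto x_i^{-1}$ leaves one common sign. In
one variable, $\mathcal{G}_1$ is generated by $\zeta$, $s_j$, $\sigma_u$ with explicit conjugation
rules; its abelianization is detected by the parity of $\zeta$, the parity of $j$, and the leading
coefficient and degree of $u$ modulo $K^{*2}\langle -H^2\rangle$. The abelianization of
$\mathcal{G}_n$ is that of a wreath product with $S_n$. -/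

set_option linter.unusedSectionVars false

/-! ### Internal semidirect products: factorization, lifting, commutators -/

namespace IsInternalSemidirect

open scoped commutatorElement

variable {G : Type*} [Group G] {C A B : Subgroup G}

theorem left_le (h : IsInternalSemidirect C A B) : A ≤ C := h.sup_eq ▸ le_sup_left

theorem right_le (h : IsInternalSemidirect C A B) : B ≤ C := h.sup_eq ▸ le_sup_right

theorem exists_mul (h : IsInternalSemidirect C A B) {g : G} (hg : g ∈ C) :
    ∃ a ∈ A, ∃ b ∈ B, g = a * b := by
  have hconj : ∀ a ∈ A, ∀ b ∈ B, a⁻¹ * b * a ∈ B := fun a ha b hb => by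
    simpa using h.conj_mem a⁻¹ (inv_mem ha) b hb
  let P : Subgroup G :=
    { carrier := {g | ∃ a ∈ A, ∃ b ∈ B, g = a * b}
      one_mem' := ⟨1, one_mem _, 1, one_mem _, by simp⟩
      mul_mem' := by
        rintro _ _ ⟨a, ha, b, hb, rfl⟩ ⟨a', ha', b', hb', rfl⟩
        exact ⟨a * a', mul_mem ha ha', a'⁻¹ * b * a' * b', mul_mem (hconj a' ha' b hb) hb',
          by group⟩
      inv_mem' := by
        rintro _ ⟨a, ha, b, hb, rfl⟩
        exact ⟨a⁻¹, inv_mem ha, a * b⁻¹ * a⁻¹, h.conj_mem a ha _ (inv_mem hb), by group⟩ }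
  have hA : A ≤ P := fun a ha => ⟨a, ha, 1, one_mem _, by simp⟩
  have hB : B ≤ P := fun b hb => ⟨1, one_mem _, b, hb, by simp⟩
  have hC : C ≤ P := h.sup_eq ▸ sup_le hA hB
  exact hC hg

theorem mul_inj (h : IsInternalSemidirect C A B) {a a' b b' : G} (ha : a ∈ A) (ha' : a' ∈ A)
    (hb : b ∈ B) (hb' : b' ∈ B) (e : a * b = a' * b') : a = a' ∧ b = b' := by
  have e' : a'⁻¹ * a = b' * b⁻¹ := by
    rw [eq_mul_inv_iff_mul_eq, mul_assoc, e]; group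
  have h1 : a'⁻¹ * a = 1 :=
    (Subgroup.disjoint_def.1 h.disjoint) (mul_mem (inv_mem ha') ha)
      (e' ▸ mul_mem hb' (inv_mem hb))
  have h2 : a = a' := (inv_mul_eq_one.1 h1).symm
  subst h2
  exact ⟨rfl, mul_left_cancel e⟩

/-- Homomorphisms from the factors of a semidirect product to a commutative group, the second one
being invariant under conjugation, extend to the product. -/
theorem exists_lift (h : IsInternalSemidirect C A B) {T : Type*} [CommGroup T]
    (fA : A →* T) (fB : B →* T)
    (hf : ∀ (a : A) (b b' : B), (a : G) * b * (a : G)⁻¹ = b' → fB b' = fB b) :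
    ∃ f : C →* T, (∀ a : A, f ⟨a, h.left_le a.2⟩ = fA a) ∧
      ∀ b : B, f ⟨b, h.right_le b.2⟩ = fB b := by
  have hex : ∀ g : C, ∃ p : A × B, (g : G) = p.1 * p.2 := fun g => by
    obtain ⟨a, ha, b, hb, e⟩ := h.exists_mul g.2
    exact ⟨(⟨a, ha⟩, ⟨b, hb⟩), e⟩
  choose p hp using hex
  have key : ∀ (g : C) (a : A) (b : B), (g : G) = a * b → fA (p g).1 * fB (p g).2 = fA a * fB b := by
    intro g a b e
    obtain ⟨h1, h2⟩ := h.mul_inj (p g).1.2 a.2 (p g).2.2 b.2 ((hp g).symm.trans e)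
    rw [Subtype.ext h1, Subtype.ext h2]
  refine ⟨MonoidHom.mk' (fun g => fA (p g).1 * fB (p g).2) fun g g' => ?_, fun a => ?_, fun b => ?_⟩
  · have hm : ((p g').1 : G)⁻¹ * (p g).2 * (p g').1 ∈ B := by
      simpa using h.conj_mem _ (inv_mem (p g').1.2) _ (p g).2.2
    rw [key (g * g') ((p g).1 * (p g').1) (⟨_, hm⟩ * (p g').2)]
    · rw [map_mul, map_mul, ← hf (p g').1 ⟨_, hm⟩ (p g).2 (by simp [mul_assoc]), mul_mul_mul_comm]
    · simp only [Subgroup.coe_mul]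
      rw [hp g, hp g']; group
  · simpa using key ⟨a, h.left_le a.2⟩ a 1 (by simp)
  · simpa using key ⟨b, h.right_le b.2⟩ 1 b (by simp)

theorem normal_right (h : IsInternalSemidirect ⊤ A B) : B.Normal where
  conj_mem b hb g := by
    obtain ⟨a, ha, c, hc, rfl⟩ := h.exists_mul (Subgroup.mem_top g)
    have := h.conj_mem a ha _ (mul_mem (mul_mem hc hb) (inv_mem hc))
    simpa [mul_assoc] using this

theorem normal_commutator_right (h : IsInternalSemidirect ⊤ A B) : (⁅B, B⁆).Normal := by
  have := h.normal_right
  infer_instance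

/-- Normality of `⁅B, B⁆` turns the subgroup generated by the two commutator groups into their set
of products, which is the form used in the statement on $[\mathcal{G}_n,\mathcal{G}_n]$. -/
theorem mem_sup_commutator (h : IsInternalSemidirect ⊤ A B) (g : G) :
    g ∈ ⁅A, B⁆ ⊔ ⁅B, B⁆ ↔ ∃ a ∈ ⁅A, B⁆, ∃ b ∈ ⁅B, B⁆, g = a * b := by
  have := h.normal_commutator_right
  rw [← SetLike.mem_coe, Subgroup.mul_normal, Set.mem_mul]
  simp [eq_comm]

/-- Expanding $[ac,b]=a[c,b]a^{-1}\,[a,b]$ gives the nontrivial inclusion. The point is that the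
right side is visibly normal. -/
theorem sup_commutator_eq (h : IsInternalSemidirect ⊤ A B) : ⁅A, B⁆ ⊔ ⁅B, B⁆ = ⁅(⊤ : Subgroup G), B⁆ := by
  have hB := h.normal_right
  have hBB := h.normal_commutator_right
  apply le_antisymm
  · exact sup_le (Subgroup.commutator_mono le_top le_rfl) (Subgroup.commutator_mono le_top le_rfl)
  · rw [Subgroup.commutator_le]
    intro g _ b hb
    obtain ⟨a, ha, c, hc, rfl⟩ := h.exists_mul (Subgroup.mem_top g)
    have e : ⁅a * c, b⁆ = a * ⁅c, b⁆ * a⁻¹ * ⁅a, b⁆ := by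
      simp only [commutatorElement_def]; group
    rw [e]
    exact mul_mem ((le_sup_right : ⁅B, B⁆ ≤ _)
        (hBB.conj_mem _ (Subgroup.commutator_mem_commutator hc hb) a))
      ((le_sup_left : ⁅A, B⁆ ≤ _) (Subgroup.commutator_mem_commutator ha hb))

theorem commutator_right_le (h : IsInternalSemidirect ⊤ A B) : ⁅A, B⁆ ⊔ ⁅B, B⁆ ≤ B := by
  have hB := h.normal_right
  rw [h.sup_commutator_eq]
  exact Subgroup.commutator_le_right _ _

/-- The commutator subgroup of a semidirect product. -/
theorem commutator (h : IsInternalSemidirect ⊤ A B) :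
    IsInternalSemidirect (_root_.commutator G) ⁅A, A⁆ (⁅A, B⁆ ⊔ ⁅B, B⁆) := by
  have hB := h.normal_right
  have hN : (⁅A, B⁆ ⊔ ⁅B, B⁆).Normal := by rw [h.sup_commutator_eq]; infer_instance
  refine ⟨le_antisymm ?_ ?_, ?_, fun a _ b hb => hN.conj_mem b hb a⟩
  · rw [_root_.commutator_def]
    exact sup_le (Subgroup.commutator_mono le_top le_top) (sup_le
      (Subgroup.commutator_mono le_top le_top) (Subgroup.commutator_mono le_top le_top))
  · rw [_root_.commutator_def, Subgroup.commutator_le]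
    intro g _ g' _
    obtain ⟨a, ha, b, hb, rfl⟩ := h.exists_mul (Subgroup.mem_top g)
    obtain ⟨a', ha', b', hb', rfl⟩ := h.exists_mul (Subgroup.mem_top g')
    -- Apart from $[a,a']$, every factor is conjugate to an element of the normal subgroup `⁅A, B⁆ ⊔
    -- ⁅B, B⁆`.
    have e : ⁅a * b, a' * b'⁆ = a * ⁅b, a' * b'⁆ * a⁻¹ * (⁅a, a'⁆ * (a' * ⁅a, b'⁆ * a'⁻¹)) := by
      simp only [commutatorElement_def]; group
    have h1 : ⁅b, a' * b'⁆ ∈ ⁅A, B⁆ ⊔ ⁅B, B⁆ := by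
      rw [h.sup_commutator_eq, Subgroup.commutator_comm]
      exact Subgroup.commutator_mem_commutator hb (Subgroup.mem_top _)
    have h2 : ⁅a, b'⁆ ∈ ⁅A, B⁆ ⊔ ⁅B, B⁆ :=
      (le_sup_left : ⁅A, B⁆ ≤ _) (Subgroup.commutator_mem_commutator ha hb')
    rw [e]
    refine mul_mem ((le_sup_right : _ ≤ ⁅A, A⁆ ⊔ (⁅A, B⁆ ⊔ ⁅B, B⁆)) (hN.conj_mem _ h1 a)) (mul_mem ?_
      ((le_sup_right : _ ≤ ⁅A, A⁆ ⊔ (⁅A, B⁆ ⊔ ⁅B, B⁆)) (hN.conj_mem _ h2 a')))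
    exact (le_sup_left : ⁅A, A⁆ ≤ _) (Subgroup.commutator_mem_commutator ha ha')
  · exact h.disjoint.mono (Subgroup.commutator_le_self _) h.commutator_right_le

end IsInternalSemidirect

/-! ### The localization of a polynomial algebra at the elements `X i + j` -/

section LinLoc

open MvPolynomial

noncomputable section

/-- The multiplicative monoid generated by the polynomials `X i + j`, `j ∈ ℤ`. -/
def linMonoid (K ι : Type*) [Field K] : Submonoid (MvPolynomial ι K) :=
  Submonoid.closure (Set.range fun p : ι × ℤ => X p.1 + C (p.2 : K))

/-- The algebra `K[H_i, (H_i + j)⁻¹]`, as a localization of a polynomial algebra. -/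
def LinLoc (K ι : Type*) [Field K] : Type _ := Localization (linMonoid K ι)

namespace LinLoc

variable (K ι : Type*) [Field K]

instance : CommRing (LinLoc K ι) := inferInstanceAs (CommRing (Localization (linMonoid K ι)))

instance : Algebra K (LinLoc K ι) := inferInstanceAs (Algebra K (Localization (linMonoid K ι)))

instance : Algebra (MvPolynomial ι K) (LinLoc K ι) :=
  inferInstanceAs (Algebra (MvPolynomial ι K) (Localization (linMonoid K ι)))

instance : IsScalarTower K (MvPolynomial ι K) (LinLoc K ι) :=
  inferInstanceAs (IsScalarTower K (MvPolynomial ι K) (Localization (linMonoid K ι)))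

instance : IsLocalization (linMonoid K ι) (LinLoc K ι) :=
  inferInstanceAs (IsLocalization (linMonoid K ι) (Localization (linMonoid K ι)))

variable {ι}

theorem linear_mem (i : ι) (j : ℤ) : (X i + C (j : K) : MvPolynomial ι K) ∈ linMonoid K ι :=
  Submonoid.subset_closure ⟨(i, j), rfl⟩

/-- The translation of the $i$-th variable by $c$ is an automorphism that carries the prime $X_i$ to
$X_i+c$. -/
theorem linear_prime (i : ι) (c : K) : Prime (X i + C c : MvPolynomial ι K) := by
  classical
  let e : MvPolynomial ι K ≃ₐ[K] MvPolynomial ι K :=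
    AlgEquiv.ofAlgHom (aeval fun k => X k + C (if k = i then c else 0))
      (aeval fun k => X k - C (if k = i then c else 0))
      (by ext k; simp) (by ext k; simp)
  have h : X i + C c = e (X i) := by simp [e]
  rw [h]
  exact (MulEquiv.prime_iff e.toMulEquiv).2 X_prime

theorem linMonoid_le : linMonoid K ι ≤ nonZeroDivisors (MvPolynomial ι K) := by
  rw [linMonoid, Submonoid.closure_le]
  rintro _ ⟨p, rfl⟩
  exact mem_nonZeroDivisors_of_ne_zero (linear_prime K p.1 _).ne_zero

instance : IsDomain (LinLoc K ι) := IsLocalization.isDomain_of_le_nonZeroDivisors (M := linMonoid K ι) _ (linMonoid_le K)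

/-- The polynomials inside the localization. -/
def ofPoly : MvPolynomial ι K →ₐ[K] LinLoc K ι := IsScalarTower.toAlgHom K _ _

theorem ofPoly_injective : Function.Injective (ofPoly K : MvPolynomial ι K → LinLoc K ι) :=
  IsLocalization.injective (LinLoc K ι) (linMonoid_le K)

theorem isUnit_ofPoly {d : MvPolynomial ι K} (hd : d ∈ linMonoid K ι) : IsUnit (ofPoly K d) :=
  IsLocalization.map_units (LinLoc K ι) (⟨d, hd⟩ : linMonoid K ι)

/-- The generators. -/
def gen (i : ι) : LinLoc K ι := ofPoly K (X i)

theorem isUnit_gen_add (i : ι) (j : ℤ) : IsUnit (gen K i + (j : LinLoc K ι)) := by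
  have := isUnit_ofPoly K (linear_mem K i j)
  simpa [gen] using this

/-- The units `H_i + j`. -/
def linUnit (i : ι) (j : ℤ) : (LinLoc K ι)ˣ := (isUnit_gen_add K i j).unit

@[simp]
theorem linUnit_val (i : ι) (j : ℤ) : (linUnit K i j : LinLoc K ι) = gen K i + j := rfl

variable {K}

theorem exists_mul_eq (l : LinLoc K ι) :
    ∃ p : MvPolynomial ι K, ∃ d ∈ linMonoid K ι, l * ofPoly K d = ofPoly K p := by
  obtain ⟨⟨p, d⟩, h⟩ := IsLocalization.surj (linMonoid K ι) l
  exact ⟨p, d, d.2, h⟩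

theorem subalgebra_eq_top (S : Subalgebra K (LinLoc K ι)) (h1 : ∀ i, gen K i ∈ S)
    (h2 : ∀ i j, ((linUnit K i j)⁻¹ : (LinLoc K ι)ˣ).1 ∈ S) : S = ⊤ := by
  have hp : ∀ p : MvPolynomial ι K, ofPoly K p ∈ S := by
    intro p
    induction p using MvPolynomial.induction_on with
    | C a =>
      have : ofPoly K (C a : MvPolynomial ι K) = algebraMap K (LinLoc K ι) a :=
        (ofPoly K).commutes a
      rw [this]; exact S.algebraMap_mem a
    | add p q hp hq => rw [map_add]; exact add_mem hp hq
    | mul_X p i hp => rw [map_mul]; exact mul_mem hp (h1 i)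
  have hd : ∀ d ∈ linMonoid K ι, ∃ s ∈ S, ofPoly K d * s = 1 := by
    intro d hd
    induction hd using Submonoid.closure_induction with
    | mem d hd =>
      obtain ⟨⟨i, j⟩, rfl⟩ := hd
      refine ⟨_, h2 i j, ?_⟩
      have : ofPoly K (X i + C (j : K) : MvPolynomial ι K) = linUnit K i j := by simp [gen]
      simp only [this, Units.mul_inv]
    | one => exact ⟨1, one_mem _, by simp⟩
    | mul a b _ _ ha hb =>
      obtain ⟨s, hs, e⟩ := ha
      obtain ⟨t, ht, f⟩ := hb
      exact ⟨s * t, mul_mem hs ht, by rw [map_mul, mul_mul_mul_comm, e, f, one_mul]⟩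
  refine eq_top_iff.2 fun l _ => ?_
  obtain ⟨p, d, hd', h⟩ := exists_mul_eq l
  obtain ⟨s, hs, e⟩ := hd d hd'
  have : l = ofPoly K p * s := by rw [← h, mul_assoc, e, mul_one]
  rw [this]
  exact mul_mem (hp p) hs

/-- The target may be noncommutative. The equalizer is a subalgebra that contains the generators,
and it contains the $(H_i+j)^{-1}$ because homomorphisms preserve inverses of units. -/
theorem algHom_ext {A : Type*} [Ring A] [Algebra K A] {f g : LinLoc K ι →ₐ[K] A}
    (h : ∀ i, f (gen K i) = g (gen K i)) : f = g := by
  have hS := subalgebra_eq_top (AlgHom.equalizer f g) h fun i j => by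
    have e : Units.map (f : LinLoc K ι →* A) (linUnit K i j) =
        Units.map (g : LinLoc K ι →* A) (linUnit K i j) := by
      ext; simp [h]
    have := congrArg (fun u : Aˣ => (u⁻¹).1) e
    simpa using this
  ext l
  have : l ∈ AlgHom.equalizer f g := hS ▸ Algebra.mem_top
  exact this

/-- The universal property of the localization. -/
def lift {A : Type*} [CommRing A] [Algebra K A] (h : ι → A)
    (hu : ∀ i (j : ℤ), IsUnit (h i + (j : A))) : LinLoc K ι →ₐ[K] A :=
  IsLocalization.liftAlgHom (M := linMonoid K ι) (f := aeval h) <| by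
    rintro ⟨d, hd⟩
    change IsUnit (aeval h d)
    induction hd using Submonoid.closure_induction with
    | mem d hd =>
      obtain ⟨⟨i, j⟩, rfl⟩ := hd
      simpa using hu i j
    | one => simp
    | mul a b _ _ ha hb => rw [map_mul]; exact ha.mul hb

theorem lift_ofPoly {A : Type*} [CommRing A] [Algebra K A] (h : ι → A)
    (hu : ∀ i (j : ℤ), IsUnit (h i + (j : A))) (p : MvPolynomial ι K) :
    lift (K := K) h hu (ofPoly K p) = aeval h p :=
  IsLocalization.lift_eq _ _

@[simp]
theorem lift_gen {A : Type*} [CommRing A] [Algebra K A] (h : ι → A)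
    (hu : ∀ i (j : ℤ), IsUnit (h i + (j : A))) (i : ι) : lift (K := K) h hu (gen K i) = h i := by
  rw [gen, lift_ofPoly, aeval_X]

variable (K) in
/-- The shift `H_i ↦ H_i - α_i`. -/
def shift (α : ι → ℤ) : LinLoc K ι →ₐ[K] LinLoc K ι :=
  lift (fun i => gen K i - (α i : LinLoc K ι)) fun i j => by
    have := isUnit_gen_add K i (j - α i)
    convert this using 1
    push_cast; ring

@[simp]
theorem shift_gen (α : ι → ℤ) (i : ι) : shift K α (gen K i) = gen K i - (α i : LinLoc K ι) :=
  lift_gen _ _ _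

theorem shift_shift (α β : ι → ℤ) (l : LinLoc K ι) :
    shift K α (shift K β l) = shift K (α + β) l := by
  have : (shift K α).comp (shift K β) = shift K (α + β) := algHom_ext fun i => by
    simp [sub_sub]
  exact DFunLike.congr_fun this l

@[simp]
theorem shift_zero (l : LinLoc K ι) : shift K 0 l = l := by
  have : shift K (0 : ι → ℤ) = AlgHom.id K _ := algHom_ext fun i => by simp
  exact DFunLike.congr_fun this l

theorem shift_injective (α : ι → ℤ) : Function.Injective (shift K α) :=
  Function.LeftInverse.injective (g := shift K (-α)) fun l => by
    rw [shift_shift]; simp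

/-- Units of the localization are fractions of elements of the monoid `linMonoid`, up to a
scalar. -/
theorem exists_factor {a b d : MvPolynomial ι K} (hd : d ∈ linMonoid K ι) (h : a * b = d) :
    ∃ c : Kˣ, ∃ d' ∈ linMonoid K ι, a = C (c : K) * d' := by
  induction hd using Submonoid.closure_induction_left generalizing a b with
  | one =>
    have : IsUnit a := IsUnit.of_mul_eq_one _ h
    obtain ⟨c, hc, rfl⟩ := (MvPolynomial.isUnit_iff_eq_C_of_isReduced).1 this
    exact ⟨hc.unit, 1, one_mem _, by simp⟩
  | mul_left p hp d _ ih =>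
    obtain ⟨⟨i, j⟩, rfl⟩ := hp
    have hpr := linear_prime K i (j : K)
    -- The prime linear factor goes either to `a`, where it is recorded, or to `b`, where it is
    -- dropped; then it is cancelled.
    rcases hpr.dvd_or_dvd (h ▸ dvd_mul_right _ _ : (X i + C (j : K)) ∣ a * b) with ⟨a', rfl⟩ | ⟨b', rfl⟩
    · obtain ⟨c, d', hd', e⟩ := ih (a := a') (b := b) (mul_left_cancel₀ hpr.ne_zero (by rw [← h]; ring))
      exact ⟨c, (X i + C (j : K)) * d', mul_mem (linear_mem K i j) hd', by rw [e]; ring⟩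
    · exact ih (a := a) (b := b') (mul_left_cancel₀ hpr.ne_zero (by rw [← h]; ring))

/-- The products of integer powers of the units `H_i + j`. -/
def linProd : Multiplicative (ι × ℤ →₀ ℤ) →* (LinLoc K ι)ˣ :=
  AddMonoidHom.toMultiplicativeLeft
    (Finsupp.liftAddHom fun p : ι × ℤ => (zmultiplesHom (Additive (LinLoc K ι)ˣ)) (Additive.ofMul (linUnit K p.1 p.2)))

@[simp]
theorem linProd_single (i : ι) (j k : ℤ) :
    linProd (Multiplicative.ofAdd (Finsupp.single (i, j) k)) = linUnit K i j ^ k := by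
  simp [linProd]

/-- Write $u=p/d$ and $u^{-1}=p'/d'$. Then $pp'=dd'$ is a product of linear factors, so $p$ is
itself a scalar times such a product, by unique factorization. -/
theorem exists_linProd (u : (LinLoc K ι)ˣ) :
    ∃ (c : Kˣ) (m : ι × ℤ →₀ ℤ), u = scalarUnit K _ c * linProd (Multiplicative.ofAdd m) := by
  have hmon : ∀ d ∈ linMonoid K ι, ∃ m : ι × ℤ →₀ ℤ,
      ofPoly K d = (linProd (Multiplicative.ofAdd m) : (LinLoc K ι)ˣ) := by
    intro d hd
    induction hd using Submonoid.closure_induction with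
    | mem d hd =>
      obtain ⟨⟨i, j⟩, rfl⟩ := hd
      exact ⟨Finsupp.single (i, j) 1, by simp [gen]⟩
    | one => exact ⟨0, by simp⟩
    | mul a b _ _ ha hb =>
      obtain ⟨m, hm⟩ := ha
      obtain ⟨m', hm'⟩ := hb
      exact ⟨m + m', by rw [ofAdd_add, map_mul, map_mul, hm, hm', Units.val_mul]⟩
  obtain ⟨p, d, hd, h⟩ := exists_mul_eq (u : LinLoc K ι)
  obtain ⟨p', d', hd', h'⟩ := exists_mul_eq ((u⁻¹ : (LinLoc K ι)ˣ) : LinLoc K ι)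
  have hpp : p * p' = d * d' := by
    apply ofPoly_injective K
    rw [map_mul, map_mul, ← h, ← h', mul_mul_mul_comm, Units.mul_inv, one_mul]
  obtain ⟨c, e, he, rfl⟩ := exists_factor (mul_mem hd hd') hpp
  obtain ⟨m, hm⟩ := hmon d hd
  obtain ⟨m', hm'⟩ := hmon e he
  refine ⟨c, m' - m, ?_⟩
  rw [ofAdd_sub, map_div, ← mul_div_assoc, eq_div_iff_mul_eq']
  ext
  have hC : ofPoly K (C (c : K) : MvPolynomial ι K) = (scalarUnit K (LinLoc K ι) c : LinLoc K ι) :=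
    (ofPoly K).commutes (c : K)
  rw [Units.val_mul, Units.val_mul, ← hm, ← hm', ← hC, ← map_mul, ← h]

end LinLoc

end

end LinLoc

/-! ### Uniqueness of the factorization of units; units with integer differences -/

section LinLoc

open MvPolynomial

noncomputable section

namespace LinLoc

variable {K ι : Type*} [Field K]

/-- The product of the positive powers of the `X i + j` that occur in `linProd m`. -/
def numer (m : ι × ℤ →₀ ℤ) : MvPolynomial ι K :=
  m.prod fun p e => (X p.1 + C (p.2 : K)) ^ e.toNat

theorem linProd_eq_prod (m : ι × ℤ →₀ ℤ) :
    (linProd (Multiplicative.ofAdd m) : (LinLoc K ι)ˣ) =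
      m.prod fun p e => linUnit K p.1 p.2 ^ e := by
  induction m using Finsupp.induction with
  | zero => simp
  | single_add a b f ha hb ih =>
    classical
    rw [Finsupp.prod_add_index (by simp) (by intros; rw [zpow_add]), ofAdd_add, map_mul, ih,
      Finsupp.prod_single_index (by simp)]
    obtain ⟨i, j⟩ := a
    rw [linProd_single]

/-- Splitting exponents into positive and negative parts, `numer m` is the numerator and `numer
(-m)` the denominator of the fraction `linProd m`. -/
theorem linProd_mul_numer (m : ι × ℤ →₀ ℤ) :
    (linProd (Multiplicative.ofAdd m) : (LinLoc K ι)ˣ) * ofPoly K (numer (-m)) =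
      ofPoly K (numer m) := by
  rw [linProd_eq_prod, numer, numer, Finsupp.prod, Finsupp.prod, Finsupp.prod,
    Finsupp.support_neg, map_prod, map_prod, Units.coe_prod, ← Finset.prod_mul_distrib]
  refine Finset.prod_congr rfl fun p _ => ?_
  have h : ofPoly K (X p.1 + C (p.2 : K) : MvPolynomial ι K) = linUnit K p.1 p.2 := by
    simp [gen]
  rw [map_pow, map_pow, h, ← Units.val_pow_eq_pow_val, ← Units.val_pow_eq_pow_val,
    ← Units.val_mul, ← zpow_natCast, ← zpow_natCast, ← zpow_add]
  congr 2
  simp only [Finsupp.coe_neg, Pi.neg_apply]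
  omega

variable [DecidableEq ι]

/-- Specialization of all the variables but one at `1 / 2`. -/
def spec (k : ι) : MvPolynomial ι K →ₐ[K] Polynomial K :=
  aeval fun i => if i = k then Polynomial.X else Polynomial.C (1 / 2)

theorem spec_linear (k i : ι) (j : ℤ) : spec k (X i + C (j : K)) =
    if i = k then Polynomial.X + Polynomial.C (j : K) else Polynomial.C (1 / 2 + (j : K)) := by
  have : spec k (C (j : K) : MvPolynomial ι K) = Polynomial.C (j : K) := (spec k).commutes _
  rw [map_add, this, spec, aeval_X]
  split_ifs <;> simp

theorem spec_numer (k : ι) (m : ι × ℤ →₀ ℤ) :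
    spec k (numer m : MvPolynomial ι K) = ∏ p ∈ m.support,
      (if p.1 = k then Polynomial.X + Polynomial.C (p.2 : K)
        else Polynomial.C (1 / 2 + (p.2 : K))) ^ (m p).toNat := by
  rw [numer, Finsupp.prod, map_prod]
  exact Finset.prod_congr rfl fun p _ => by rw [map_pow, spec_linear]

variable [CharZero K]

/-- The reason for specializing at $1/2$: in characteristic zero it is not an integer, so no factor
$X_i+j$ is killed. -/
theorem half_add_intCast_ne_zero (j : ℤ) : (1 / 2 + (j : K)) ≠ 0 := by
  intro h
  have h2 : (1 + 2 * (j : K)) = 0 := by linear_combination 2 * h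
  have h3 : ((1 + 2 * j : ℤ) : K) = 0 := by push_cast; exact h2
  have := Int.cast_eq_zero.1 h3
  omega

/-- After specialization only the factor $X_k+j$ can vanish at $-j$. Together with the next lemma,
vanishing at $-j$ detects the positivity of the exponent of $H_k+j$. -/
theorem eval_spec_numer_ne_zero (k : ι) (j : ℤ) {m : ι × ℤ →₀ ℤ} (h : m (k, j) ≤ 0) :
    (spec k (numer m : MvPolynomial ι K)).eval (-(j : K)) ≠ 0 := by
  rw [spec_numer, Polynomial.eval_prod, Finset.prod_ne_zero_iff]
  rintro ⟨i, j'⟩ _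
  rw [Polynomial.eval_pow]
  by_cases hi : i = k
  · subst hi
    by_cases hj : j' = j
    · subst hj
      simp [Int.toNat_of_nonpos h]
    · refine pow_ne_zero _ ?_
      simp only [if_true, Polynomial.eval_add, Polynomial.eval_X, Polynomial.eval_C]
      intro h0
      apply hj
      have : (j' : K) = j := by linear_combination h0
      exact_mod_cast this
  · refine pow_ne_zero _ ?_
    simp only [hi, if_false, Polynomial.eval_C]
    exact half_add_intCast_ne_zero j'

theorem eval_spec_numer_eq_zero (k : ι) (j : ℤ) {m : ι × ℤ →₀ ℤ} (h : 0 < m (k, j)) :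
    (spec k (numer m : MvPolynomial ι K)).eval (-(j : K)) = 0 := by
  rw [spec_numer, Polynomial.eval_prod]
  refine Finset.prod_eq_zero (i := (k, j)) (Finsupp.mem_support_iff.2 h.ne') ?_
  have : (m (k, j)).toNat ≠ 0 := by omega
  simp [this]

theorem natDegree_spec_numer (k : ι) (m : ι × ℤ →₀ ℤ) :
    (spec k (numer m : MvPolynomial ι K)).natDegree =
      ∑ p ∈ m.support, if p.1 = k then (m p).toNat else 0 := by
  rw [spec_numer, Polynomial.natDegree_prod]
  · refine Finset.sum_congr rfl fun p _ => ?_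
    split_ifs
    · rw [Polynomial.natDegree_pow, Polynomial.natDegree_X_add_C, mul_one]
    · simp
  · rintro p _
    refine pow_ne_zero _ ?_
    split_ifs
    · exact Polynomial.X_add_C_ne_zero _
    · rw [Ne, Polynomial.C_eq_zero]
      exact half_add_intCast_ne_zero _

/-- Clearing denominators gives `C c * numer m = numer (-m)`. If $m(k,j)\neq0$, exactly one side
vanishes at $-j$ after specialization. -/
theorem exp_eq_zero_of_linProd_eq {c : Kˣ} {m : ι × ℤ →₀ ℤ}
    (h : scalarUnit K (LinLoc K ι) c * linProd (Multiplicative.ofAdd m) = 1) : m = 0 := by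
  have e : C (c : K) * numer m = (numer (-m) : MvPolynomial ι K) := by
    apply ofPoly_injective K
    have hC : ofPoly K (C (c : K) : MvPolynomial ι K) = (scalarUnit K (LinLoc K ι) c : LinLoc K ι) :=
      (ofPoly K).commutes (c : K)
    rw [map_mul, ← linProd_mul_numer, ← mul_assoc, hC, ← Units.val_mul, h, Units.val_one, one_mul]
  ext ⟨k, j⟩
  have e' := congrArg (fun p => (spec k p).eval (-(j : K))) e
  have hc : (spec k (C (c : K) : MvPolynomial ι K)).eval (-(j : K)) = c := by
    have : spec k (C (c : K) : MvPolynomial ι K) = Polynomial.C (c : K) := (spec k).commutes _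
    rw [this, Polynomial.eval_C]
  simp only [map_mul, Polynomial.eval_mul, hc] at e'
  rcases lt_trichotomy (m (k, j)) 0 with h0 | h0 | h0
  · exfalso
    rw [eval_spec_numer_eq_zero (m := -m) k j (by simpa using h0)] at e'
    exact mul_ne_zero c.ne_zero (eval_spec_numer_ne_zero k j h0.le) e'
  · exact h0
  · exfalso
    rw [eval_spec_numer_eq_zero k j h0, mul_zero] at e'
    exact eval_spec_numer_ne_zero (m := -m) k j (by simpa using h0.le) e'.symm

theorem scalarUnit_injective (R : Type*) [Ring R] [Algebra K R] [Nontrivial R] :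
    Function.Injective (scalarUnit K R) :=
  Units.map_injective (algebraMap K R).injective

theorem linProd_inj {c c' : Kˣ} {m m' : ι × ℤ →₀ ℤ}
    (h : scalarUnit K (LinLoc K ι) c * linProd (Multiplicative.ofAdd m) =
      scalarUnit K (LinLoc K ι) c' * linProd (Multiplicative.ofAdd m')) : c = c' ∧ m = m' := by
  have hm : m - m' = 0 := by
    apply exp_eq_zero_of_linProd_eq (c := c / c') (K := K)
    rw [ofAdd_sub, map_div, map_div, div_mul_div_comm, h, div_self']
  rw [sub_eq_zero] at hm
  subst hm
  exact ⟨scalarUnit_injective _ (mul_right_cancel h), rfl⟩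

/-- The action of a shift on the exponents of `linProd`. -/
def shiftExp (α : ι → ℤ) (m : ι × ℤ →₀ ℤ) : ι × ℤ →₀ ℤ :=
  Finsupp.equivMapDomain
    { toFun := fun p => (p.1, p.2 - α p.1), invFun := fun p => (p.1, p.2 + α p.1),
      left_inv := fun p => by simp, right_inv := fun p => by simp } m

@[simp]
theorem shiftExp_apply (α : ι → ℤ) (m : ι × ℤ →₀ ℤ) (p : ι × ℤ) :
    shiftExp α m p = m (p.1, p.2 + α p.1) := rfl

theorem map_shift_linProd (α : ι → ℤ) (m : ι × ℤ →₀ ℤ) :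
    Units.map (shift K α : LinLoc K ι →* LinLoc K ι) (linProd (Multiplicative.ofAdd m)) =
      linProd (Multiplicative.ofAdd (shiftExp α m)) := by
  induction m using Finsupp.induction_linear with
  | zero =>
    have : shiftExp α (0 : ι × ℤ →₀ ℤ) = 0 := by ext; simp
    simp [this]
  | add m m' h h' =>
    have : shiftExp α (m + m') = shiftExp α m + shiftExp α m' := by ext; simp
    rw [this, ofAdd_add, ofAdd_add, map_mul, map_mul, map_mul, h, h']
  | single p k =>
    obtain ⟨i, j⟩ := p
    have : shiftExp α (Finsupp.single (i, j) k) = Finsupp.single (i, j - α i) k :=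
      Finsupp.equivMapDomain_single _ _ _
    rw [this, linProd_single, linProd_single, map_zpow]
    congr 1
    ext
    simp only [Units.coe_map, linUnit_val, MonoidHom.coe_coe, map_add, shift_gen, map_intCast]
    push_cast; ring

theorem map_shift_scalarUnit (α : ι → ℤ) (c : Kˣ) :
    Units.map (shift K α : LinLoc K ι →* LinLoc K ι) (scalarUnit K _ c) = scalarUnit K _ c := by
  ext
  exact (shift K α).commutes (c : K)

theorem shift_eq_self {α : ι → ℤ} {c : Kˣ} {m : ι × ℤ →₀ ℤ}
    (h : ∀ i, α i ≠ 0 → ∀ j, m (i, j) = 0) :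
    shift K α ((scalarUnit K _ c * linProd (Multiplicative.ofAdd m) : (LinLoc K ι)ˣ) : LinLoc K ι) =
      (scalarUnit K _ c * linProd (Multiplicative.ofAdd m) : (LinLoc K ι)ˣ) := by
  have hm : shiftExp α m = m := by
    ext ⟨i, j⟩
    by_cases hi : α i = 0
    · simp [hi]
    · simp [h i hi]
  have : Units.map (shift K α : LinLoc K ι →* LinLoc K ι)
      (scalarUnit K _ c * linProd (Multiplicative.ofAdd m)) =
      scalarUnit K _ c * linProd (Multiplicative.ofAdd m) := by
    rw [map_mul, map_shift_scalarUnit, map_shift_linProd, hm]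
  exact congrArg Units.val this

/-- Evaluation at the point with one coordinate `t + 1 / 2` and the others `1 / 2`. -/
def evalHalf (k : ι) (t : ℤ) : LinLoc K ι →ₐ[K] K :=
  lift (fun i => 1 / 2 + ((Pi.single k t : ι → ℤ) i : K)) fun i j => by
    rw [isUnit_iff_ne_zero, add_assoc, ← Int.cast_add]
    exact half_add_intCast_ne_zero _

theorem evalHalf_ofPoly (k : ι) (t : ℤ) (p : MvPolynomial ι K) :
    evalHalf k t (ofPoly K p) = (spec k p).eval (1 / 2 + (t : K)) := by
  rw [evalHalf, lift_ofPoly]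
  have : aeval (fun i => 1 / 2 + ((Pi.single k t : ι → ℤ) i : K)) =
      (Polynomial.aeval (1 / 2 + (t : K))).comp (spec k : MvPolynomial ι K →ₐ[K] _) := by
    ext i
    simp only [aeval_X, AlgHom.comp_apply, spec]
    by_cases h : i = k
    · subst h; simp
    · simp [h]
  rw [this, AlgHom.comp_apply, Polynomial.coe_aeval_eq_eval]

theorem evalHalf_shift (k : ι) (t : ℤ) (l : LinLoc K ι) :
    evalHalf k t (shift K (Pi.single k 1) l) = evalHalf k (t - 1) l := by
  have : (evalHalf k t).comp (shift K (Pi.single k 1)) = evalHalf k (t - 1) :=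
    algHom_ext fun i => by
      by_cases h : i = k
      · subst h; simp [evalHalf]; ring
      · simp [evalHalf, h]
  exact DFunLike.congr_fun this l

/-- Constant differences make $u$ affine along the points $1/2+t$, $t\in\mathbb{Z}$. There are
infinitely many of them, so the specialization of $u$ in the direction $k$ is a polynomial of degree
at most one: it has no poles and at most one simple zero among the integers. -/
theorem exp_of_shift_eq_sub {k : ι} {b : K} {c : Kˣ} {m : ι × ℤ →₀ ℤ} {u : LinLoc K ι}
    (hu : u = (scalarUnit K _ c * linProd (Multiplicative.ofAdd m) : (LinLoc K ι)ˣ))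
    (h : shift K (Pi.single k 1) u = u - algebraMap K _ b) :
    (∀ j, m (k, j) = 0) ∨ ∃ j, ∀ j', m (k, j') = if j' = j then 1 else 0 := by
  have hg : ∀ t : ℤ, evalHalf k t u = evalHalf k 0 u + b * t := by
    have h1 : ∀ t : ℤ, evalHalf k (t - 1) u = evalHalf k t u - b := fun t => by
      rw [← evalHalf_shift, h, map_sub, AlgHom.commutes]; rfl
    intro t
    induction t using Int.induction_on with
    | zero => simp
    | succ i ih =>
      have := h1 (i + 1)
      rw [add_sub_cancel_right] at this
      rw [ih] at this
      push_cast at this ⊢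
      linear_combination -this
    | pred i ih =>
      rw [h1, ih]; push_cast; ring
  have hnum : u * ofPoly K (numer (-m)) = ofPoly K (C (c : K) * numer m) := by
    have hC : ofPoly K (C (c : K) : MvPolynomial ι K) = (scalarUnit K (LinLoc K ι) c : LinLoc K ι) :=
      (ofPoly K).commutes (c : K)
    rw [hu, map_mul, ← linProd_mul_numer m, hC, Units.val_mul, mul_assoc]
  -- The constant term is chosen so that the affine polynomial takes the value of $u$ at $1/2$; with
  -- slope $b$ it then agrees with $u$ at every $1/2+t$.
  have hpoly : (Polynomial.C b * Polynomial.X + Polynomial.C (evalHalf k 0 u - b * (1 / 2))) *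
      spec k (numer (-m)) = Polynomial.C (c : K) * spec k (numer m) := by
    have hinf : (Set.range fun t : ℤ => (1 / 2 + (t : K))).Infinite :=
      Set.infinite_range_of_injective fun a b hab => by simpa using hab
    refine Polynomial.eq_of_infinite_eval_eq _ _ (hinf.mono ?_)
    rintro _ ⟨t, rfl⟩
    have := congrArg (evalHalf k t) hnum
    rw [map_mul, evalHalf_ofPoly, evalHalf_ofPoly, map_mul, hg] at this
    have hc : spec k (C (c : K) : MvPolynomial ι K) = Polynomial.C (c : K) := (spec k).commutes _
    rw [hc] at this
    simp only [Set.mem_ofPred_eq, Polynomial.eval_mul, Polynomial.eval_add, Polynomial.eval_C,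
      Polynomial.eval_X] at this ⊢
    rw [← this]; ring
  -- A negative exponent would give the denominator, and so the left side, a zero at $-j$ that the
  -- numerator does not have.
  have hpos : ∀ j, 0 ≤ m (k, j) := by
    intro j
    by_contra! hj
    have := congrArg (Polynomial.eval (-(j : K))) hpoly
    rw [Polynomial.eval_mul, eval_spec_numer_eq_zero (m := -m) k j (by simpa using hj), mul_zero,
      Polynomial.eval_mul, Polynomial.eval_C] at this
    exact mul_ne_zero c.ne_zero (eval_spec_numer_ne_zero k j hj.le) this.symm
  have hdeg : (spec k (numer m : MvPolynomial ι K)).natDegree ≤ 1 := by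
    have h0 : (spec k (numer (-m) : MvPolynomial ι K)).natDegree = 0 := by
      rw [natDegree_spec_numer]
      refine Finset.sum_eq_zero ?_
      rintro ⟨i, j⟩ _
      split_ifs with hi
      · change i = k at hi
        subst hi
        simpa using hpos j
      · rfl
    rw [← Polynomial.natDegree_C_mul (a := (c : K)) c.ne_zero, ← hpoly]
    refine Polynomial.natDegree_mul_le.trans ?_
    rw [h0, add_zero]
    exact Polynomial.natDegree_linear_le
  rw [natDegree_spec_numer] at hdeg
  by_cases hz : ∀ j, m (k, j) = 0
  · exact Or.inl hz
  right
  push Not at hz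
  obtain ⟨j, hj⟩ := hz
  -- The exponents in the direction $k$ are nonnegative with sum at most one, and the one at $j$ is
  -- nonzero.
  have hle : ∀ j', j' ≠ j → m (k, j') = 0 ∧ m (k, j) = 1 := by
    intro j' hj'
    by_contra! hne
    have hs : (m (k, j)).toNat + (m (k, j')).toNat ≤ 1 := by
      by_cases hj0 : m (k, j') = 0
      · refine le_trans ?_ ((Finset.single_le_sum (f := fun p => if p.1 = k then (m p).toNat else 0)
          (fun _ _ => Nat.zero_le _) (Finsupp.mem_support_iff.2 hj)).trans hdeg)
        simp [hj0]
      · refine le_trans ?_ ((Finset.sum_le_sum_of_subset (f := fun p => if p.1 = k then (m p).toNat else 0)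
          (s := {(k, j), (k, j')}) ?_).trans hdeg)
        · rw [Finset.sum_pair (by simpa using hj'.symm)]
          simp
        · intro p hp
          simp only [Finset.mem_insert, Finset.mem_singleton] at hp
          rcases hp with rfl | rfl
          · exact Finsupp.mem_support_iff.2 hj
          · exact Finsupp.mem_support_iff.2 hj0
    have h1 := hpos j
    have h2 := hpos j'
    by_cases hj0 : m (k, j') = 0
    · have := hne hj0
      omega
    · omega
  refine ⟨j, fun j' => ?_⟩
  split_ifs with h'
  · subst h'
    -- Any index different from `j'` would do; only the value at `j'` is needed.
    exact (hle (j' + 1) (by simp)).2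
  · exact (hle j' h').1

/-- A unit on which all the unit shifts act by adding integers is a scalar or a multiple of
some `H_k + j`. -/
theorem linear_of_shift_eq_sub (u : (LinLoc K ι)ˣ) (b : ι → ℤ)
    (h : ∀ k, shift K (Pi.single k 1) (u : LinLoc K ι) = u - (b k : LinLoc K ι)) :
    (∃ c : K, (u : LinLoc K ι) = algebraMap K _ c) ∨
      ∃ (k : ι) (j : ℤ), (u : LinLoc K ι) = (b k : LinLoc K ι) * (gen K k + (j : LinLoc K ι)) := by
  obtain ⟨c, m, hu⟩ := exists_linProd u
  have key := fun k => exp_of_shift_eq_sub (k := k) (b := (b k : K)) (congrArg Units.val hu)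
    (by simpa using h k)
  by_cases hz : ∀ k j, m (k, j) = 0
  · left
    have : m = 0 := by ext ⟨k, j⟩; exact hz k j
    subst this
    exact ⟨c, by rw [hu]; simp; rfl⟩
  right
  push Not at hz
  obtain ⟨k, j₀, hk⟩ := hz
  rcases key k with h0 | ⟨j, hj⟩
  · exact absurd (h0 j₀) hk
  refine ⟨k, j, ?_⟩
  -- With the single factor $H_k+j$ removed, the cofactor no longer involves $H_k$ and is fixed by
  -- the shift in that direction.
  set m' := m - Finsupp.single (k, j) 1
  set w : (LinLoc K ι)ˣ := scalarUnit K _ c * linProd (Multiplicative.ofAdd m')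
  have huw : u = linUnit K k j * w := by
    rw [hu, ← zpow_one (linUnit K k j), ← linProd_single, mul_left_comm, ← map_mul, ← ofAdd_add]
    simp [m']
  have hw : shift K (Pi.single k 1) (w : LinLoc K ι) = w := by
    refine shift_eq_self fun i hi j' => ?_
    have : i = k := by
      by_contra hne
      simp [hne] at hi
    subst this
    simp only [m', Finsupp.coe_sub, Pi.sub_apply, hj, Finsupp.single_apply, Prod.mk.injEq, true_and]
    by_cases hjj : j' = j
    · simp [hjj]
    · simp [hjj, Ne.symm hjj]
  have e := h k
  rw [huw, Units.val_mul, map_mul, hw, linUnit_val] at e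
  simp only [map_add, shift_gen, Pi.single_eq_same, map_intCast] at e
  -- The shift lowers $(H_k+j)w$ by exactly $w$, and by hypothesis it lowers it by $b_k$.
  have hwb : (w : LinLoc K ι) = (b k : LinLoc K ι) := by
    push_cast at e
    linear_combination -e
  rw [huw, Units.val_mul, hwb, linUnit_val, mul_comm]

end LinLoc

end

end LinLoc

/-- The inner automorphism `a ↦ u a u⁻¹`. -/
def innerHom (K R : Type*) [CommSemiring K] [Ring R] [Algebra K R] : Rˣ →* (R ≃ₐ[K] R) where
  toFun u :=
    { toFun := fun a => u * a * (u⁻¹ : Rˣ)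
      invFun := fun a => (u⁻¹ : Rˣ) * a * u
      left_inv := fun a => by simp [mul_assoc]
      right_inv := fun a => by simp [mul_assoc]
      map_mul' := fun a b => by simp [mul_assoc]
      map_add' := fun a b => by simp [mul_add, add_mul]
      commutes' := fun c => by
        rw [← Algebra.commutes, mul_assoc, Units.mul_inv, mul_one] }
  map_one' := by ext; simp
  map_mul' u v := by ext; simp [mul_assoc]

@[simp]
theorem innerHom_apply {K R : Type*} [CommSemiring K] [Ring R] [Algebra K R] (u : Rˣ) (a : R) :
    innerHom K R u a = u * a * (u⁻¹ : Rˣ) := rfl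

theorem innAut_eq_range (K R : Type*) [CommSemiring K] [Ring R] [Algebra K R] :
    innAut K R = (innerHom K R).range := by
  ext σ
  constructor
  · rintro ⟨u, hu⟩
    exact ⟨u, by ext a; simp [hu]⟩
  · rintro ⟨u, rfl⟩
    exact ⟨u, fun a => rfl⟩

/-! ### Systems of generators of shift type -/

/-- Elements of a `K`-algebra that satisfy the relations between the generators `x_i`, `H_i` of
the algebra `𝒜_n`. -/
structure ShiftSystem (R ι : Type*) [Ring R] [DecidableEq ι] where
  X : ι → Rˣ
  H : ι → R
  U : ι → ℤ → Rˣ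
  U_val : ∀ i j, (U i j : R) = H i + (j : R)
  comm_X : ∀ i j, Commute (X i) (X j)
  comm_H : ∀ i j, Commute (H i) (H j)
  X_mul_H : ∀ i j, (X i : R) * H j = (H j - if i = j then 1 else 0) * X i

namespace ShiftSystem

noncomputable section

open LinLoc

variable {K R ι : Type*} [Field K] [Ring R] [Algebra K R] [DecidableEq ι] (S : ShiftSystem R ι)

theorem comm_H_U (i j : ι) (k : ℤ) : Commute (S.H i) (S.U j k) := by
  rw [S.U_val]
  exact (S.comm_H i j).add_right (Int.cast_commute k (S.H i)).symm

theorem comm_U_U (i j : ι) (k l : ℤ) : Commute (S.U i k : R) (S.U j l) := by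
  rw [S.U_val i k]
  exact (S.comm_H_U i j l).add_left (Int.cast_commute k _)

/-- The commutative subalgebra generated by the `H_i` and the `(H_i + j)⁻¹`. -/
def base (K : Type*) [Field K] [Algebra K R] : Subalgebra K R :=
  Algebra.adjoin K (Set.range S.H ∪ Set.range fun p : ι × ℤ => ((S.U p.1 p.2)⁻¹ : Rˣ).1)

instance base_comm : IsMulCommutative (S.base K) := by
  refine Algebra.isMulCommutative_adjoin K ?_
  rintro _ (⟨i, rfl⟩ | ⟨p, rfl⟩) _ (⟨j, rfl⟩ | ⟨q, rfl⟩)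
  · exact S.comm_H i j
  · exact (S.comm_H_U i q.1 q.2).units_inv_right
  · exact (S.comm_H_U j p.1 p.2).units_inv_right.symm
  · exact ((S.comm_U_U p.1 q.1 p.2 q.2).units_inv_right).units_inv_left

open scoped IsMulCommutative in
/-- The canonical map from the localized polynomial algebra. -/
def theta : LinLoc K ι →ₐ[K] R :=
  (S.base K).val.comp <| LinLoc.lift (K := K)
    (fun i => (⟨S.H i, Algebra.subset_adjoin (.inl ⟨i, rfl⟩)⟩ : S.base K)) fun i j => by
      refine IsUnit.of_mul_eq_one ⟨((S.U i j)⁻¹ : Rˣ).1, Algebra.subset_adjoin (.inr ⟨(i, j), rfl⟩)⟩ ?_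
      apply Subtype.ext
      simp [← S.U_val]

@[simp]
theorem theta_gen (i : ι) : S.theta (gen K i) = S.H i := by
  simp [theta]

/-- The canonical map on units. -/
def thetaU : (LinLoc K ι)ˣ →* Rˣ := Units.map ((S.theta (K := K) : LinLoc K ι →ₐ[K] R) : LinLoc K ι →* R)

@[simp]
theorem thetaU_val (l : (LinLoc K ι)ˣ) : (S.thetaU l : R) = S.theta (l : LinLoc K ι) := rfl

@[simp]
theorem thetaU_inv_val (l : (LinLoc K ι)ˣ) :
    ((S.thetaU l)⁻¹ : Rˣ).1 = S.theta ((l⁻¹ : (LinLoc K ι)ˣ) : LinLoc K ι) := rfl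

theorem thetaU_linUnit (i : ι) (j : ℤ) :
    S.thetaU (linUnit K i j) = S.U i j := by
  ext
  simp [S.U_val]

theorem thetaU_scalarUnit (c : Kˣ) :
    S.thetaU (scalarUnit K (LinLoc K ι) c) = scalarUnit K R c := by
  ext
  exact S.theta.commutes (c : K)

theorem theta_range : (S.theta : LinLoc K ι →ₐ[K] R).range = S.base K := by
  apply le_antisymm
  · rintro _ ⟨l, rfl⟩
    exact Subtype.property _
  · refine Algebra.adjoin_le ?_
    rintro _ (⟨i, rfl⟩ | ⟨p, rfl⟩)
    · exact ⟨gen K i, S.theta_gen i⟩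
    · refine ⟨((linUnit K p.1 p.2)⁻¹ : (LinLoc K ι)ˣ).1, ?_⟩
      have := congrArg (fun u : Rˣ => (u⁻¹).1) (S.thetaU_linUnit (K := K) p.1 p.2)
      simpa using this

variable [Fintype ι]

theorem pairwise_commute_zpowersHom : Pairwise fun i j => ∀ x y : Multiplicative ℤ,
    Commute (zpowersHom Rˣ (S.X i) x) (zpowersHom Rˣ (S.X j) y) :=
  fun i j _ x y => (S.comm_X i j).zpow_zpow x.toAdd y.toAdd

/-- The monomials in the `x_i`, with integer exponents. -/
def xpow (α : ι → ℤ) : Rˣ :=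
  MonoidHom.noncommPiCoprod (fun i => zpowersHom Rˣ (S.X i))
    S.pairwise_commute_zpowersHom fun i => Multiplicative.ofAdd (α i)

theorem xpow_add (α β : ι → ℤ) : S.xpow (α + β) = S.xpow α * S.xpow β := by
  rw [xpow, xpow, xpow, ← map_mul]; rfl

@[simp]
theorem xpow_zero : S.xpow 0 = 1 := by
  have := S.xpow_add 0 0
  rw [add_zero] at this
  exact left_eq_mul.1 this

theorem xpow_neg (α : ι → ℤ) : S.xpow (-α) = (S.xpow α)⁻¹ := by
  rw [eq_inv_iff_mul_eq_one, ← xpow_add, neg_add_cancel, xpow_zero]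

theorem xpow_single (i : ι) (k : ℤ) : S.xpow (Pi.single i k) = S.X i ^ k := by
  have : (fun j => Multiplicative.ofAdd ((Pi.single i k : ι → ℤ) j)) =
      Pi.mulSingle (M := fun _ => Multiplicative ℤ) i (Multiplicative.ofAdd k) := by
    ext j
    by_cases h : j = i
    · subst h; simp
    · simp [h]
  rw [xpow, this, MonoidHom.noncommPiCoprod_mulSingle]
  simp

/-- The property cuts out a subgroup of $\mathbb{Z}^\iota$, and the unit vectors generate that
group. -/
theorem intVec_induction {P : (ι → ℤ) → Prop} (h0 : P 0) (hadd : ∀ α β, P α → P β → P (α + β))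
    (hneg : ∀ α, P α → P (-α)) (hs : ∀ i, P (Pi.single i 1)) (α : ι → ℤ) : P α := by
  let A : AddSubgroup (ι → ℤ) :=
    { carrier := {α | P α}, zero_mem' := h0, add_mem' := fun h h' => hadd _ _ h h',
      neg_mem' := fun h => hneg _ h }
  change α ∈ A
  rw [← Finset.univ_sum_single α]
  refine sum_mem fun i _ => ?_
  have : (Pi.single i (α i) : ι → ℤ) = α i • (Pi.single i 1 : ι → ℤ) := by
    ext j
    by_cases h : j = i
    · subst h; simp
    · simp [h]
  rw [this]
  exact zsmul_mem (show Pi.single i 1 ∈ A from hs i) _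

theorem innerHom_xpow_H (α : ι → ℤ) (j : ι) :
    innerHom K R (S.xpow α) (S.H j) = S.H j - (α j : R) := by
  refine intVec_induction (P := fun α => ∀ j, innerHom K R (S.xpow α) (S.H j) = S.H j - (α j : R))
    ?_ ?_ ?_ ?_ α j
  · intro j; simp
  · intro α β h h' j
    rw [xpow_add, map_mul, AlgEquiv.mul_apply, h', map_sub, map_intCast, h]
    simp [sub_sub]
  · intro α h j
    have : innerHom K R (S.xpow (-α)) (innerHom K R (S.xpow α) (S.H j)) = S.H j := by
      rw [← AlgEquiv.mul_apply, ← map_mul, ← xpow_add]; simp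
    rw [h, map_sub, map_intCast, sub_eq_iff_eq_add] at this
    rw [this]; simp
  · intro i j
    rw [xpow_single, zpow_one, innerHom_apply, X_mul_H, mul_assoc, Units.mul_inv, mul_one]
    by_cases h : i = j
    · subst h; simp
    · simp [h, Ne.symm h]

/-- Conjugation by $x^\alpha$ and the shift by $\alpha$ are algebra maps on $L$ that agree on the
generators $H_i$. This is the rule for moving monomials past coefficients. -/
theorem xpow_mul_theta (α : ι → ℤ) (l : LinLoc K ι) :
    (S.xpow α : R) * S.theta l = S.theta (shift K α l) * S.xpow α := by
  have : ((innerHom K R (S.xpow α)) : R →ₐ[K] R).comp S.theta = S.theta.comp (shift K α) :=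
    LinLoc.algHom_ext fun i => by
      have := S.innerHom_xpow_H (K := K) α i
      simp only [AlgHom.comp_apply, theta_gen, shift_gen, map_sub, map_intCast]
      exact this
  have h := DFunLike.congr_fun this l
  simp only [AlgHom.comp_apply] at h
  rw [← h]
  simp [mul_assoc]

/-- The map sending a family of coefficients `l_α` to `∑ l_α x^α`. -/
def phi (K : Type*) [Field K] [Algebra K R] : ((ι → ℤ) →₀ LinLoc K ι) →ₗ[K] R :=
  Finsupp.lsum K fun α => (LinearMap.mulRight K (S.xpow α : R)) ∘ₗ S.theta.toLinearMap

@[simp]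
theorem phi_single (α : ι → ℤ) (l : LinLoc K ι) :
    S.phi K (Finsupp.single α l) = S.theta l * S.xpow α := by
  simp [phi]

theorem phi_single_mul (α β : ι → ℤ) (l l' : LinLoc K ι) :
    S.phi K (Finsupp.single α l) * S.phi K (Finsupp.single β l') =
      S.phi K (Finsupp.single (α + β) (l * shift K α l')) := by
  simp only [phi_single, xpow_add, map_mul, Units.val_mul]
  rw [mul_assoc, ← mul_assoc (S.xpow α : R), xpow_mul_theta]
  simp only [mul_assoc]

/-- The product of families of coefficients that corresponds to the product of the algebra. -/
def conv (f g : (ι → ℤ) →₀ LinLoc K ι) : (ι → ℤ) →₀ LinLoc K ι :=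
  ∑ α ∈ f.support, ∑ β ∈ g.support, Finsupp.single (α + β) (f α * shift K α (g β))

theorem phi_mul (f g : (ι → ℤ) →₀ LinLoc K ι) :
    S.phi K f * S.phi K g = S.phi K (conv f g) := by
  conv_lhs => rw [← Finsupp.sum_single f, ← Finsupp.sum_single g]
  rw [Finsupp.sum, Finsupp.sum, map_sum, map_sum, Finset.sum_mul_sum, conv, map_sum]
  refine Finset.sum_congr rfl fun α _ => ?_
  rw [map_sum]
  exact Finset.sum_congr rfl fun β _ => S.phi_single_mul _ _ _ _

/-- Every element of the algebra has a unique expression `∑ l_α x^α`. -/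
def IsBasis (K : Type*) [Field K] [Algebra K R] : Prop := Function.Bijective (S.phi K)

/-- The sums $\sum l_\alpha x^\alpha$ are closed under multiplication by `phi_mul`, so they form a
subalgebra; the hypothesis says that the generators and their inverses generate. -/
theorem phi_surjective (h : ∀ A : Subalgebra K R, (∀ i, (S.X i : R) ∈ A) →
    (∀ i, ((S.X i)⁻¹ : Rˣ).1 ∈ A) → (∀ i, S.H i ∈ A) → (∀ i j, ((S.U i j)⁻¹ : Rˣ).1 ∈ A) → A = ⊤) :
    Function.Surjective (S.phi K) := by
  have hθ : ∀ l : LinLoc K ι, S.theta l ∈ LinearMap.range (S.phi K) := fun l =>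
    ⟨Finsupp.single 0 l, by simp⟩
  have hx : ∀ α, (S.xpow α : R) ∈ LinearMap.range (S.phi K) := fun α =>
    ⟨Finsupp.single α 1, by simp⟩
  let A : Subalgebra K R :=
    { carrier := LinearMap.range (S.phi K)
      mul_mem' := by
        rintro _ _ ⟨f, rfl⟩ ⟨g, rfl⟩
        exact ⟨_, (S.phi_mul f g).symm⟩
      add_mem' := fun ha hb => add_mem ha hb
      algebraMap_mem' := fun c => ⟨Finsupp.single 0 (algebraMap K _ c), by simp⟩ }
  have hA : A = ⊤ := by
    refine h A (fun i => ?_) (fun i => ?_) (fun i => ?_) fun i j => ?_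
    · have := hx (Pi.single i 1)
      rwa [xpow_single, zpow_one] at this
    · have := hx (Pi.single i (-1))
      rwa [xpow_single, zpow_neg_one] at this
    · have := hθ (gen K i)
      rwa [theta_gen] at this
    · have := hθ ((linUnit K i j)⁻¹ : (LinLoc K ι)ˣ).1
      have e := congrArg (fun u : Rˣ => (u⁻¹).1) (S.thetaU_linUnit (K := K) i j)
      rw [thetaU_inv_val] at e
      rwa [e] at this
  intro a
  have : a ∈ A := hA ▸ Algebra.mem_top
  exact this

variable {S}

namespace IsBasis

section Hom

variable {R' : Type*} [Ring R'] [Algebra K R']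

theorem hom_ext (h : S.IsBasis K) {f g : R →ₐ[K] R'} (hX : ∀ i, f (S.X i) = g (S.X i))
    (hH : ∀ i, f (S.H i) = g (S.H i)) : f = g := by
  have hθ : f.comp S.theta = g.comp S.theta := LinLoc.algHom_ext fun i => by simp [hH]
  have hx : ∀ α, Units.map (f : R →* R') (S.xpow α) = Units.map (g : R →* R') (S.xpow α) := by
    refine intVec_induction ?_ ?_ ?_ ?_
    · simp
    · intro α β h h'; rw [xpow_add, map_mul, map_mul, h, h']
    · intro α h; rw [xpow_neg, map_inv, map_inv, h]
    · intro i; rw [xpow_single, zpow_one]; ext; exact hX i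
  ext a
  obtain ⟨c, rfl⟩ := h.2 a
  induction c using Finsupp.induction_linear with
  | zero => simp
  | add c c' h h' => rw [map_add, map_add, map_add, h, h']
  | single α l =>
    rw [phi_single, map_mul, map_mul]
    have h1 := DFunLike.congr_fun hθ l
    have h2 := congrArg Units.val (hx α)
    simp only [AlgHom.comp_apply, Units.coe_map, MonoidHom.coe_coe] at h1 h2
    rw [h1, h2]

theorem equiv_ext (h : S.IsBasis K) {f g : R ≃ₐ[K] R'} (hX : ∀ i, f (S.X i) = g (S.X i))
    (hH : ∀ i, f (S.H i) = g (S.H i)) : f = g := by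
  have : (f : R →ₐ[K] R') = g := h.hom_ext hX hH
  ext a
  exact DFunLike.congr_fun this a

/-- The map $\sum l_\alpha x^\alpha\mapsto\sum l_\alpha x'^\alpha$ is well defined by the normal
form, and it is multiplicative because `conv` describes the product of coefficient families in both
algebras. -/
theorem exists_hom (h : S.IsBasis K) (T : ShiftSystem R' ι) :
    ∃ f : R →ₐ[K] R', (∀ i, f (S.X i) = T.X i) ∧ ∀ i, f (S.H i) = T.H i := by
  let e := LinearEquiv.ofBijective (S.phi K) h
  have he : ∀ c, e.symm (S.phi K c) = c := fun c => e.symm_apply_apply c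
  let f : R →ₐ[K] R' := AlgHom.ofLinearMap ((T.phi K) ∘ₗ e.symm.toLinearMap)
    (by
      have : (1 : R) = S.phi K (Finsupp.single 0 1) := by simp
      rw [this, LinearMap.comp_apply, LinearEquiv.coe_coe, he]
      simp)
    (by
      intro a b
      obtain ⟨c, rfl⟩ := h.2 a
      obtain ⟨d, rfl⟩ := h.2 b
      rw [phi_mul]
      simp only [LinearMap.comp_apply, LinearEquiv.coe_coe, he]
      rw [phi_mul])
  have hf : ∀ c, f (S.phi K c) = T.phi K c := fun c => congrArg (T.phi K) (he c)
  refine ⟨f, fun i => ?_, fun i => ?_⟩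
  · have := hf (Finsupp.single (Pi.single i 1) 1)
    simpa [xpow_single] using this
  · have := hf (Finsupp.single 0 (gen K i))
    simpa using this

/-- The homomorphism given by the universal property. -/
def lift (h : S.IsBasis K) (T : ShiftSystem R' ι) : R →ₐ[K] R' := (h.exists_hom T).choose

@[simp]
theorem lift_X (h : S.IsBasis K) (T : ShiftSystem R' ι) (i : ι) : h.lift T (S.X i) = T.X i :=
  (h.exists_hom T).choose_spec.1 i

@[simp]
theorem lift_H (h : S.IsBasis K) (T : ShiftSystem R' ι) (i : ι) : h.lift T (S.H i) = T.H i :=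
  (h.exists_hom T).choose_spec.2 i

theorem exists_equiv (h : S.IsBasis K) {T : ShiftSystem R' ι} (h' : T.IsBasis K) :
    ∃ f : R ≃ₐ[K] R', (∀ i, f (S.X i) = T.X i) ∧ ∀ i, f (S.H i) = T.H i :=
  ⟨AlgEquiv.ofAlgHom (h.lift T) (h'.lift S)
      (h'.hom_ext (fun i => by simp) fun i => by simp)
      (h.hom_ext (fun i => by simp) fun i => by simp),
    fun i => h.lift_X T i, fun i => h.lift_H T i⟩

end Hom

theorem theta_injective (h : S.IsBasis K) : Function.Injective (S.theta : LinLoc K ι →ₐ[K] R) := by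
  intro l l' e
  have : S.phi K (Finsupp.single 0 l) = S.phi K (Finsupp.single 0 l') := by simp [e]
  exact Finsupp.single_injective _ (h.1 this)

theorem theta_mul_xpow_inj (h : S.IsBasis K) {α β : ι → ℤ} {l l' : LinLoc K ι} (hl : l ≠ 0)
    (e : S.theta l * S.xpow α = S.theta l' * S.xpow β) : α = β ∧ l = l' := by
  rw [← phi_single, ← phi_single] at e
  have := h.1 e
  rw [Finsupp.single_eq_single_iff] at this
  rcases this with h | h
  · exact h
  · exact absurd h.1 hl

theorem conv_apply_of_uniqueAdd {f g : (ι → ℤ) →₀ LinLoc K ι} {α β : ι → ℤ} (hα : α ∈ f.support)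
    (hβ : β ∈ g.support) (hu : UniqueAdd f.support g.support α β) :
    conv f g (α + β) = f α * shift K α (g β) := by
  rw [conv, Finsupp.finsetSum_apply, Finset.sum_eq_single_of_mem α hα]
  · rw [Finsupp.finsetSum_apply, Finset.sum_eq_single_of_mem β hβ]
    · simp
    · intro b hb hne
      rw [Finsupp.single_apply, if_neg]
      intro e
      exact hne (hu hα hb e).2
  · intro a ha hne
    rw [Finsupp.finsetSum_apply]
    refine Finset.sum_eq_zero fun b hb => ?_
    rw [Finsupp.single_apply, if_neg]
    intro e
    exact hne (hu ha hb e).1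

/-- Units are homogeneous. -/
theorem exists_unit (h : S.IsBasis K) (w : Rˣ) : ∃ (l : (LinLoc K ι)ˣ) (α : ι → ℤ),
    w = S.thetaU l * S.xpow α := by
  obtain ⟨f, hf⟩ := h.2 (w : R)
  obtain ⟨g, hg⟩ := h.2 ((w⁻¹ : Rˣ) : R)
  have h1 : S.phi K (Finsupp.single 0 1) = 1 := by simp
  have hc : conv f g = Finsupp.single 0 1 := by
    apply h.1
    rw [← phi_mul, hf, hg, h1, Units.mul_inv]
  have hne : (Finsupp.single 0 1 : (ι → ℤ) →₀ LinLoc K ι) ≠ 0 := by simp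
  have hf0 : f.support.Nonempty := by
    rw [Finsupp.support_nonempty_iff]
    rintro rfl
    exact hne (hc ▸ by simp [conv])
  have hg0 : g.support.Nonempty := by
    rw [Finsupp.support_nonempty_iff]
    rintro rfl
    exact hne (hc ▸ by simp [conv])
  -- A sum attained only once has as coefficient a product of nonzero elements of a domain, whereas
  -- the product $1$ is concentrated in degree zero.
  have hzero : ∀ α ∈ f.support, ∀ β ∈ g.support, UniqueAdd f.support g.support α β → α + β = 0 := by
    intro α hα β hβ hu
    by_contra hne
    have e := conv_apply_of_uniqueAdd hα hβ hu
    rw [hc, Finsupp.single_apply, if_neg (Ne.symm hne)] at e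
    rcases mul_eq_zero.1 e.symm with e | e
    · exact Finsupp.mem_support_iff.1 hα e
    · exact Finsupp.mem_support_iff.1 hβ ((map_eq_zero_iff _ (shift_injective α)).1 e)
  -- Otherwise two different pairs would have uniquely attained sums. Both sums are zero, which
  -- contradicts uniqueness.
  have hcard : ¬ 1 < f.support.card * g.support.card := by
    intro hlt
    obtain ⟨p, hp, q, hq, hpq, hu, hu'⟩ := TwoUniqueSums.uniqueAdd_of_one_lt_card hlt
    rw [Finset.mem_product] at hp hq
    have e := hu hq.1 hq.2 ((hzero _ hq.1 _ hq.2 hu').trans (hzero _ hp.1 _ hp.2 hu).symm)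
    exact hpq (Prod.ext e.1.symm e.2.symm)
  have hf1 : f.support.card = 1 ∧ g.support.card = 1 := by
    have a1 := hf0.card_pos
    have a2 := hg0.card_pos
    constructor <;> nlinarith
  obtain ⟨α, l, hl, rfl⟩ := Finsupp.card_support_eq_one'.1 hf1.1
  obtain ⟨β, l', hl', rfl⟩ := Finsupp.card_support_eq_one'.1 hf1.2
  have e : S.phi K (Finsupp.single (α + β) (l * shift K α l')) = S.phi K (Finsupp.single 0 1) := by
    rw [← phi_single_mul, hf, hg, Units.mul_inv, h1]
  have e' := h.1 e
  rw [Finsupp.single_eq_single_iff] at e'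
  rcases e' with e' | e'
  · refine ⟨(IsUnit.of_mul_eq_one _ e'.2).unit, α, ?_⟩
    ext
    simp [← hf]
  · exact absurd e'.2 one_ne_zero

end IsBasis

end

end ShiftSystem

/-! ### Systems given by units; reduction to polynomial coefficients -/

namespace ShiftSystem

section Constructions

open LinLoc

variable {R ι : Type*} [Ring R] [DecidableEq ι]

theorem conj_zpow {x h : Rˣ} (hxh : (x : R) * h = (h - 1) * x) (k : ℤ) :
    ((x ^ k * h * (x ^ k)⁻¹ : Rˣ) : R) = h - (k : R) := by
  have h1 : innerHom ℤ R x h = h - 1 := by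
    rw [innerHom_apply, hxh, mul_assoc, Units.mul_inv, mul_one]
  have h2 : ∀ k : ℤ, innerHom ℤ R (x ^ k) h = h - (k : R) := by
    intro k
    induction k using Int.induction_on with
    | zero => simp
    | succ i ih =>
      rw [zpow_add_one, map_mul, AlgEquiv.mul_apply, h1, map_sub, ih, map_one]
      push_cast; abel
    | pred i ih =>
      have : innerHom ℤ R x⁻¹ (h : R) = h + 1 := by
        have e : innerHom ℤ R x⁻¹ (innerHom ℤ R x (h : R)) = h := by
          rw [← AlgEquiv.mul_apply, ← map_mul]; simp
        rw [h1, map_sub, map_one] at e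
        rw [sub_eq_iff_eq_add.1 e]
      rw [zpow_sub_one, map_mul, AlgEquiv.mul_apply, this, map_add, ih, map_one]
      push_cast; abel
  have := h2 k
  rwa [innerHom_apply, ← Units.val_mul, ← Units.val_mul] at this

/-- A system is determined by the units `x_i` and `H_i`. -/
def ofUnits (X H : ι → Rˣ) (hX : ∀ i j, Commute (X i) (X j)) (hH : ∀ i j, Commute (H i) (H j))
    (hXH : ∀ i j, (X i : R) * H j = (H j - if i = j then 1 else 0) * X i) : ShiftSystem R ι where
  X := X
  H i := H i
  -- Conjugation by $x_i^{-j}$ adds $j$ to $H_i$, so the invertibility of $H_i$ alone makes every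
  -- $H_i+j$ invertible.
  U i j := X i ^ (-j) * H i * (X i ^ (-j))⁻¹
  U_val i j := by
    rw [conj_zpow (by simpa using hXH i i)]
    push_cast; abel
  comm_X := hX
  comm_H i j := by
    have := congrArg Units.val (hH i j).eq
    rwa [Units.val_mul, Units.val_mul] at this
  X_mul_H := hXH

variable [Fintype ι] {K : Type*} [Field K] [Algebra K R]

/-- It is enough to check linear independence of monomials over polynomials. -/
theorem phi_injective (S : ShiftSystem R ι)
    (h : ∀ f : (ι → ℤ) →₀ MvPolynomial ι K,
      S.phi K (f.mapRange (ofPoly K) (map_zero _)) = 0 → f = 0) :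
    Function.Injective (S.phi K) := by
  classical
  rw [injective_iff_map_eq_zero]
  intro f hf
  -- A common denominator of all coefficients. It multiplies on the left, where it acts on each
  -- coefficient separately.
  obtain ⟨⟨d, hd⟩, hb⟩ := IsLocalization.exist_integer_multiples (linMonoid K ι) f.support f
  choose! p hp using hb
  have hp' : ∀ α ∈ f.support, ofPoly K (p α) = ofPoly K d * f α := fun α hα => by
    have := hp α hα
    rw [Algebra.smul_def] at this
    exact this
  -- Outside the support `p` is arbitrary, hence the explicit zero.
  let g : (ι → ℤ) →₀ MvPolynomial ι K := Finsupp.onFinset f.support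
    (fun α => if α ∈ f.support then p α else 0) (fun α hα => by by_contra h; simp [h] at hα)
  have hg : ∀ α, ofPoly K (g α) = ofPoly K d * f α := by
    intro α
    by_cases hα : α ∈ f.support
    · simp only [g, Finsupp.onFinset_apply, hα, if_true, hp' α hα]
    · simp only [g, Finsupp.onFinset_apply, hα, if_false, map_zero, Finsupp.notMem_support_iff.1 hα,
        mul_zero]
  have e : S.phi K (g.mapRange (ofPoly K) (map_zero _)) = S.theta (ofPoly K d) * S.phi K f := by
    have h1 : g.mapRange (ofPoly K) (map_zero _) =
        f.sum fun α l => Finsupp.single α (ofPoly K d * l) := by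
      ext α
      rw [Finsupp.mapRange_apply, hg, Finsupp.sum_apply]
      simp only [Finsupp.single_apply]
      rw [Finsupp.sum_ite_eq']
      split_ifs with hα
      · rfl
      · rw [Finsupp.notMem_support_iff.1 hα, mul_zero]
    rw [h1, Finsupp.sum, map_sum]
    conv_rhs => rw [← Finsupp.sum_single f, Finsupp.sum, map_sum, Finset.mul_sum]
    exact Finset.sum_congr rfl fun α _ => by
      rw [phi_single, phi_single, map_mul, mul_assoc]
  rw [hf, mul_zero] at e
  have hg0 := h g e
  ext α
  have := hg α
  rw [hg0, Finsupp.zero_apply, map_zero] at this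
  exact ((isUnit_ofPoly K hd).mul_right_eq_zero.1 this.symm)

end Constructions

end ShiftSystem

/-! ### The normal form in $\mathcal{A}_n$ and in $\mathcal{A}_1(i)$ -/

namespace Jacobian

open MvPolynomial LinLoc

noncomputable section

variable {K : Type*} [Field K] {n : ℕ}

variable (K n) in
/-- The inclusion of the Jacobian algebra in the algebra of operators. -/
def jval : Jac K n →ₐ[K] EndP K n := (jac K n).val

theorem jval_injective : Function.Injective (jval K n) := Subtype.val_injective

@[simp] theorem jval_jX (i : Fin n) : jval K n (jX K i) = opX K i := rfl

@[simp] theorem jval_jD (i : Fin n) : jval K n (jD K i) = opD K i := rfl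

@[simp] theorem jval_jHinv (i : Fin n) : jval K n (jHinv K i) = opHinv K i := rfl

theorem jac_subalgebra_eq_top (A : Subalgebra K (Jac K n)) (hX : ∀ i, jX K i ∈ A)
    (hD : ∀ i, jD K i ∈ A) (hH : ∀ i, jHinv K i ∈ A) : A = ⊤ := by
  have hw : weyl K n ≤ A.map (jval K n) := by
    refine Algebra.adjoin_le ?_
    rintro _ (⟨i, rfl⟩ | ⟨i, rfl⟩)
    · exact ⟨jX K i, hX i, rfl⟩
    · exact ⟨jD K i, hD i, rfl⟩
  have hj : jac K n ≤ A.map (jval K n) := by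
    refine Algebra.adjoin_le ?_
    rintro _ (h | ⟨i, rfl⟩)
    · exact hw h
    · exact ⟨jHinv K i, hH i, rfl⟩
  refine eq_top_iff.2 fun a _ => ?_
  obtain ⟨b, hb, e⟩ := hj a.2
  rwa [← jval_injective e]

theorem endP_ext {a b : EndP K n} (h : ∀ β, a (monomial β 1) = b (monomial β 1)) : a = b :=
  (basisMonomials (Fin n) K).ext fun β => by simpa using h β

theorem opX_comm (i j : Fin n) : opX K i * opX K j = opX K j * opX K i :=
  endP_ext fun β => by
    simp only [Module.End.mul_apply, opX_monomial]
    rw [add_assoc, add_assoc, add_comm (Finsupp.single j 1)]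

theorem opH_comm (i j : Fin n) : opH K i * opH K j = opH K j * opH K i :=
  endP_ext fun β => by
    simp only [Module.End.mul_apply, opH_monomial, map_smul, smul_smul, mul_comm]

theorem opX_mul_opH (i j : Fin n) :
    opX K i * opH K j = (opH K j - if i = j then 1 else 0) * opX K i :=
  endP_ext fun β => by
    simp only [Module.End.mul_apply, opH_monomial, map_smul, opX_monomial, LinearMap.sub_apply]
    by_cases h : i = j
    · subst h
      simp only [if_true, Module.End.one_apply, Finsupp.add_apply, Finsupp.single_eq_same]
      push_cast
      rw [add_smul (_ + 1) (1 : K), one_smul, add_sub_cancel_right]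
    · simp [h]

/-- The span of the monomials all of whose exponents are at least `N`. -/
def tailSpan (K : Type*) [Field K] (n N : ℕ) : Submodule K (MvPolynomial (Fin n) K) :=
  Submodule.span K {p | ∃ β : Fin n →₀ ℕ, (∀ i, N ≤ β i) ∧ p = monomial β 1}

theorem monomial_mem_tailSpan {N : ℕ} {β : Fin n →₀ ℕ} (h : ∀ i, N ≤ β i) :
    monomial β (1 : K) ∈ tailSpan K n N := Submodule.subset_span ⟨β, h, rfl⟩

theorem tailSpan_le {N : ℕ} {W : Submodule K (MvPolynomial (Fin n) K)}
    (h : ∀ β : Fin n →₀ ℕ, (∀ i, N ≤ β i) → monomial β (1 : K) ∈ W) : tailSpan K n N ≤ W := by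
  refine Submodule.span_le.2 ?_
  rintro _ ⟨β, hβ, rfl⟩
  exact h β hβ

theorem tailSpan_antitone {N M : ℕ} (h : N ≤ M) : tailSpan K n M ≤ tailSpan K n N :=
  tailSpan_le fun _ hβ => monomial_mem_tailSpan fun i => h.trans (hβ i)

/-- The operators of the Jacobian algebra lower the exponents of monomials by a bounded amount. -/
theorem exists_tailSpan_le_comap (a : Jac K n) :
    ∃ M, ∀ N, tailSpan K n (N + M) ≤ (tailSpan K n N).comap (jval K n a) := by
  let A : Subalgebra K (Jac K n) :=
    { carrier := {a | ∃ M, ∀ N, tailSpan K n (N + M) ≤ (tailSpan K n N).comap (jval K n a)}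
      mul_mem' := by
        rintro a b ⟨M, hM⟩ ⟨M', hM'⟩
        refine ⟨M + M', fun N p hp => ?_⟩
        rw [← add_assoc] at hp
        exact hM N (hM' (N + M) hp)
      add_mem' := by
        rintro a b ⟨M, hM⟩ ⟨M', hM'⟩
        refine ⟨M + M', fun N p hp => ?_⟩
        rw [Submodule.mem_comap, map_add, LinearMap.add_apply]
        exact add_mem (hM N (tailSpan_antitone (by omega) hp))
          (hM' N (tailSpan_antitone (by omega) hp))
      algebraMap_mem' := fun c => ⟨0, fun N p hp => by
        rw [Submodule.mem_comap, AlgHom.commutes, Module.algebraMap_end_apply]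
        exact Submodule.smul_mem _ _ hp⟩ }
  have hA : A = ⊤ := by
    -- Among the generators only $\partial_i$ lowers an exponent, and by one.
    refine jac_subalgebra_eq_top A (fun i => ⟨0, fun N => ?_⟩) (fun i => ⟨1, fun N => ?_⟩)
      fun i => ⟨0, fun N => ?_⟩
    · refine tailSpan_le fun β hβ => ?_
      rw [Submodule.mem_comap, jval_jX, opX_monomial]
      exact monomial_mem_tailSpan fun j => (hβ j).trans (by simp)
    · refine tailSpan_le fun β hβ => ?_
      rw [Submodule.mem_comap, jval_jD]
      have : opD K i (monomial β 1) = (β i : K) • monomial (β - Finsupp.single i 1) 1 := by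
        simp [opD, pderiv_monomial, smul_monomial]
      rw [this]
      refine Submodule.smul_mem _ _ (monomial_mem_tailSpan fun j => ?_)
      have h1 := hβ j
      have h2 : Finsupp.single i 1 j ≤ 1 := by
        rw [Finsupp.single_apply]; split_ifs <;> omega
      rw [Finsupp.tsub_apply]
      omega
    · refine tailSpan_le fun β hβ => ?_
      rw [Submodule.mem_comap, jval_jHinv, opHinv_monomial]
      exact Submodule.smul_mem _ _ (monomial_mem_tailSpan hβ)
  have : a ∈ A := hA ▸ Algebra.mem_top
  exact this

variable (K n) in
/-- The ideal of the operators that vanish on all monomials with large exponents. -/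
def vanishIdeal : TwoSidedIdeal (Jac K n) :=
  TwoSidedIdeal.mk' {a | ∃ N, tailSpan K n N ≤ LinearMap.ker (jval K n a)}
    ⟨0, fun p _ => by simp⟩
    (by
      rintro a b ⟨N, hN⟩ ⟨M, hM⟩
      refine ⟨N + M, fun p hp => ?_⟩
      have h1 := hN (tailSpan_antitone (by omega) hp)
      have h2 := hM (tailSpan_antitone (by omega) hp)
      rw [LinearMap.mem_ker] at h1 h2 ⊢
      rw [map_add, LinearMap.add_apply, h1, h2, add_zero])
    (by
      rintro a ⟨N, hN⟩
      refine ⟨N, fun p hp => ?_⟩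
      have h1 := hN hp
      rw [LinearMap.mem_ker] at h1 ⊢
      rw [map_neg, LinearMap.neg_apply, h1, neg_zero])
    (by
      rintro a b ⟨N, hN⟩
      refine ⟨N, fun p hp => ?_⟩
      have h1 := hN hp
      rw [LinearMap.mem_ker] at h1 ⊢
      rw [map_mul, Module.End.mul_apply, h1, map_zero])
    (by
      rintro a b ⟨N, hN⟩
      obtain ⟨M, hM⟩ := exists_tailSpan_le_comap b
      refine ⟨N + M, fun p hp => ?_⟩
      have h1 := hN (hM N hp)
      rw [LinearMap.mem_ker] at h1 ⊢
      rw [map_mul, Module.End.mul_apply, h1])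

theorem mem_vanishIdeal {a : Jac K n} :
    a ∈ vanishIdeal K n ↔ ∃ N, tailSpan K n N ≤ LinearMap.ker (jval K n a) :=
  TwoSidedIdeal.mem_mk' _ _ _ _ _ _ _

variable [CharZero K]

/-- One has $E_{kl}(i)=x_i^k(1-x_iy_i)y_i^l$. Since $y_ix_i=1$, the middle factor kills every
monomial divisible by $x_i$. -/
theorem idealA_le_vanishIdeal : idealA K n ≤ vanishIdeal K n := by
  refine iSup_le fun i => TwoSidedIdeal.span_le.2 ?_
  rintro _ ⟨⟨k, l⟩, rfl⟩
  have h0 : 1 - jX K i * (jHinv K i * jD K i) ∈ vanishIdeal K n := by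
    rw [mem_vanishIdeal]
    refine ⟨1, tailSpan_le fun β hβ => ?_⟩
    obtain ⟨γ, rfl⟩ : ∃ γ, β = γ + Finsupp.single i 1 :=
      ⟨β - Finsupp.single i 1, (tsub_add_cancel_of_le (by simpa using hβ i)).symm⟩
    have hy : opY K i * opX K i = 1 := opY_mul_opX K i
    rw [← opX_monomial, LinearMap.mem_ker]
    have : jval K n (1 - jX K i * (jHinv K i * jD K i)) = 1 - opX K i * opY K i := rfl
    rw [this, ← Module.End.mul_apply, sub_mul, mul_assoc, hy]
    simp
  have e : jE K i k l = jX K i ^ k * (1 - jX K i * (jHinv K i * jD K i)) * (jHinv K i * jD K i) ^ l := by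
    rw [jE, pow_succ, pow_succ']
    noncomm_ring
  change jE K i k l ∈ vanishIdeal K n
  rw [e]
  exact TwoSidedIdeal.mul_mem_right _ _ _ (TwoSidedIdeal.mul_mem_left _ _ _ h0)

theorem toCA_surjective : Function.Surjective (toCA K n) := Ideal.Quotient.mk_surjective

theorem exists_tailSpan_le_ker {a : Jac K n} (h : toCA K n a = 0) :
    ∃ N, tailSpan K n N ≤ LinearMap.ker (jval K n a) := by
  have : a ∈ (idealA K n).asIdeal := Ideal.Quotient.eq_zero_iff_mem.1 h
  rw [TwoSidedIdeal.mem_asIdeal] at this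
  exact mem_vanishIdeal.1 (idealA_le_vanishIdeal this)

/-- The unit `H_i`. -/
def cHUnit (i : Fin n) : (CA K n)ˣ where
  val := cH K i
  inv := toCA K n (jHinv K i)
  val_inv := by
    rw [cH, ← map_mul]
    have h : jD K i * jX K i * jHinv K i = 1 := Subtype.ext (opH_mul_opHinv K i)
    rw [h, map_one]
  inv_val := by
    rw [cH, ← map_mul]
    have h : jHinv K i * (jD K i * jX K i) = 1 := Subtype.ext (opHinv_mul_opH K i)
    rw [h, map_one]

theorem cX_comm (i j : Fin n) : cX K i * cX K j = cX K j * cX K i := by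
  have h : jX K i * jX K j = jX K j * jX K i := Subtype.ext (opX_comm i j)
  rw [cX, cX, ← map_mul, h, map_mul]

theorem cH_comm (i j : Fin n) : cH K i * cH K j = cH K j * cH K i := by
  have h : jD K i * jX K i * (jD K j * jX K j) = jD K j * jX K j * (jD K i * jX K i) :=
    Subtype.ext (opH_comm i j)
  rw [cH, cH, ← map_mul, h, map_mul]

theorem cX_mul_cH (i j : Fin n) :
    cX K i * cH K j = (cH K j - if i = j then 1 else 0) * cX K i := by
  have h : jX K i * (jD K j * jX K j) = (jD K j * jX K j - if i = j then 1 else 0) * jX K i := by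
    apply jval_injective
    have := opX_mul_opH (K := K) i j
    rw [map_mul, map_mul (jval K n) (_ - _), map_sub]
    by_cases hij : i = j <;> simpa [hij, opH] using this
  rw [cX, cH, ← map_mul, h, map_mul, map_sub]
  split_ifs <;> simp

variable (K n) in
/-- The generators of `𝒜_n`. -/
def cSys : ShiftSystem (CA K n) (Fin n) :=
  ShiftSystem.ofUnits (cXUnit K) (fun i => cHUnit i)
    (fun i j => Units.ext (cX_comm i j)) (fun i j => Units.ext (cH_comm i j)) cX_mul_cH

@[simp] theorem cSys_H (i : Fin n) : (cSys K n).H i = cH K i := rfl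

theorem toCA_jD (i : Fin n) : toCA K n (jD K i) = cH K i * ((cXUnit K i)⁻¹ : (CA K n)ˣ) := by
  rw [Units.eq_mul_inv_iff_mul_eq, cH, map_mul]
  rfl

theorem toCA_jHinv (i : Fin n) :
    toCA K n (jHinv K i) = (((cSys K n).U i 0)⁻¹ : (CA K n)ˣ) := by
  refine Units.eq_inv_of_mul_eq_one_right ?_
  rw [(cSys K n).U_val, Int.cast_zero, add_zero]
  exact (cHUnit (K := K) i).inv_val

theorem cSys_surjective : Function.Surjective ((cSys K n).phi K) := by
  refine ShiftSystem.phi_surjective _ fun A hX hX' hH hU => ?_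
  have : A.comap (toCA K n) = ⊤ := by
    refine jac_subalgebra_eq_top _ (fun i => hX i) (fun i => ?_) fun i => ?_
    · rw [Subalgebra.mem_comap, toCA_jD]
      exact mul_mem (hH i) (hX' i)
    · rw [Subalgebra.mem_comap, toCA_jHinv]
      exact hU i 0
  refine eq_top_iff.2 fun a _ => ?_
  obtain ⟨b, rfl⟩ := toCA_surjective a
  have hb : b ∈ A.comap (toCA K n) := this ▸ Algebra.mem_top
  exact hb

/-- Since $H_i$ multiplies $x^\beta$ by $\beta_i+1$, a polynomial in the $H_i$ lifts to a diagonal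
operator whose eigenvalues are its values at the points $\beta+(1,\dots,1)$. -/
theorem exists_jac_poly (p : MvPolynomial (Fin n) K) :
    ∃ a : Jac K n, toCA K n a = (cSys K n).theta (ofPoly K p) ∧
      ∀ β, jval K n a (monomial β 1) = eval (fun i => (β i : K) + 1) p • monomial β 1 := by
  induction p using MvPolynomial.induction_on with
  | C c =>
    refine ⟨algebraMap K _ c, ?_, fun β => ?_⟩
    · have : ofPoly K (C c : MvPolynomial (Fin n) K) = algebraMap K _ c := (ofPoly K).commutes c
      rw [this, AlgHom.commutes, AlgHom.commutes]
    · rw [AlgHom.commutes, Module.algebraMap_end_apply, eval_C]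
  | add p q hp hq =>
    obtain ⟨a, ha, ha'⟩ := hp
    obtain ⟨b, hb, hb'⟩ := hq
    exact ⟨a + b, by simp only [map_add, ha, hb], fun β => by
      simp only [map_add, LinearMap.add_apply, ha', hb', add_smul]⟩
  | mul_X p i hp =>
    obtain ⟨a, ha, ha'⟩ := hp
    refine ⟨a * (jD K i * jX K i), ?_, fun β => ?_⟩
    · have := (cSys K n).theta_gen (K := K) i
      rw [gen] at this
      rw [map_mul, ha, map_mul (ofPoly K), map_mul ((cSys K n).theta), this]
      rfl
    · rw [map_mul, Module.End.mul_apply]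
      have : jval K n (jD K i * jX K i) = opH K i := rfl
      rw [this, opH_monomial, map_smul, ha', smul_smul, map_mul, eval_X, mul_comm]

theorem exists_jac_monomial (α : Fin n →₀ ℕ) :
    ∃ a : Jac K n, toCA K n a = ((cSys K n).xpow fun i => (α i : ℤ)) ∧
      ∀ β, jval K n a (monomial β 1) = monomial (β + α) 1 := by
  induction α using Finsupp.induction_linear with
  | zero =>
    refine ⟨1, ?_, fun β => by simp⟩
    have : (fun i => ((0 : Fin n →₀ ℕ) i : ℤ)) = 0 := by ext; simp
    rw [this]; simp
  | add α α' h h' =>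
    obtain ⟨a, ha, ha'⟩ := h
    obtain ⟨b, hb, hb'⟩ := h'
    refine ⟨a * b, ?_, fun β => ?_⟩
    · have : (fun i => ((α + α') i : ℤ)) = (fun i => (α i : ℤ)) + fun i => (α' i : ℤ) := by
        ext; simp
      rw [this, ShiftSystem.xpow_add, map_mul, ha, hb, Units.val_mul]
    · rw [map_mul, Module.End.mul_apply, hb', ha', add_assoc, add_comm α']
  | single i k =>
    refine ⟨jX K i ^ k, ?_, fun β => ?_⟩
    · have : (fun j => (Finsupp.single i k j : ℤ)) = Pi.single i (k : ℤ) := by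
        ext j
        by_cases h : j = i
        · subst h; simp
        · simp [h]
      rw [this, ShiftSystem.xpow_single, map_pow, zpow_natCast, Units.val_pow_eq_pow_val]
      rfl
    · induction k with
      | zero => simp
      | succ k ih =>
        rw [pow_succ', map_mul, Module.End.mul_apply, ih, jval_jX, opX_monomial, add_assoc,
          ← Finsupp.single_add]

/-- Take polynomial coefficients and multiply by a monomial on the right to make all exponents
nonnegative. The relation then lifts to an operator in $\mathfrak{a}_n$, which kills $x^\gamma$ for
large $\gamma$. The terms $x^{\gamma+\alpha}$ of its value are distinct, so each coefficient
polynomial vanishes on an infinite grid and is zero. -/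
theorem cSys_injective : Function.Injective ((cSys K n).phi K) := by
  refine ShiftSystem.phi_injective _ fun f hf => ?_
  obtain ⟨N, hN⟩ : ∃ N : ℕ, ∀ α ∈ f.support, ∀ i, 0 ≤ α i + N := by
    refine ⟨∑ α ∈ f.support, ∑ i, (α i).natAbs, fun α hα i => ?_⟩
    have h1 : (α i).natAbs ≤ ∑ i, (α i).natAbs :=
      Finset.single_le_sum (f := fun i => (α i).natAbs) (fun _ _ => Nat.zero_le _) (Finset.mem_univ i)
    have h2 : ∑ i, (α i).natAbs ≤ ∑ α ∈ f.support, ∑ i, (α i).natAbs :=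
      Finset.single_le_sum (f := fun α : Fin n → ℤ => ∑ i, (α i).natAbs)
        (fun _ _ => Nat.zero_le _) hα
    omega
  let sh : (Fin n → ℤ) → (Fin n →₀ ℕ) := fun α =>
    Finsupp.equivFunOnFinite.symm fun i => (α i + N).toNat
  have hsh : ∀ α ∈ f.support, (fun i => (sh α i : ℤ)) = α + fun _ => (N : ℤ) := fun α hα => by
    ext i
    simp only [sh, Finsupp.equivFunOnFinite_symm_apply_apply, Pi.add_apply]
    exact Int.toNat_of_nonneg (hN α hα i)
  choose A hA hA' using exists_jac_poly (K := K) (n := n)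
  choose B hB hB' using exists_jac_monomial (K := K) (n := n)
  have ha : toCA K n (∑ α ∈ f.support, A (f α) * B (sh α)) = 0 := by
    have : (cSys K n).phi K (f.mapRange (ofPoly K) (map_zero _)) * (cSys K n).xpow (fun _ => (N : ℤ))
        = toCA K n (∑ α ∈ f.support, A (f α) * B (sh α)) := by
      have h1 : f.mapRange (ofPoly K) (map_zero _) =
          ∑ α ∈ f.support, Finsupp.single α (ofPoly K (f α)) := by
        ext α
        rw [Finsupp.mapRange_apply, Finsupp.finsetSum_apply]
        simp only [Finsupp.single_apply]
        rw [Finset.sum_ite_eq']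
        split_ifs with hα
        · rfl
        · rw [Finsupp.notMem_support_iff.1 hα, map_zero]
      rw [h1, map_sum, Finset.sum_mul, map_sum]
      refine Finset.sum_congr rfl fun α hα => ?_
      rw [ShiftSystem.phi_single, map_mul, hA, hB, hsh α hα, ShiftSystem.xpow_add, Units.val_mul,
        mul_assoc]
    rw [← this, hf, zero_mul]
  obtain ⟨M, hM⟩ := exists_tailSpan_le_ker ha
  have hinj : ∀ α ∈ f.support, ∀ α' ∈ f.support, sh α = sh α' → α = α' := by
    intro α hα α' hα' e
    have := (hsh α hα).symm.trans ((by rw [e] : _ = _).trans (hsh α' hα'))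
    exact add_right_cancel this
  ext1 α
  by_contra hne
  have hα : α ∈ f.support := Finsupp.mem_support_iff.2 hne
  apply hne
  rw [Finsupp.zero_apply]
  refine MvPolynomial.funext_set
    -- These are the eigenvalues of $H_i$ on $x^{\gamma+\mathrm{sh}(\alpha)}$ for $\gamma_i=k+M$,
    -- the range in which the operator is known to vanish.
    (fun i => Set.range fun k : ℕ => ((k + M + sh α i : ℕ) : K) + 1) (fun i => ?_) ?_
  · refine Set.infinite_range_of_injective fun a b hab => ?_
    simpa using hab
  · intro x hx
    simp only [Set.mem_pi, Set.mem_univ, Set.mem_range, true_implies] at hx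
    choose k hk using hx
    let γ : Fin n →₀ ℕ := Finsupp.equivFunOnFinite.symm fun i => k i + M
    have h0 := hM (monomial_mem_tailSpan (K := K) (β := γ) fun i => by simp [γ])
    rw [LinearMap.mem_ker, map_sum, LinearMap.sum_apply] at h0
    simp only [map_mul, Module.End.mul_apply, hB', hA'] at h0
    -- The map `sh` is injective on the support, so only the summand of `α` contributes to this
    -- coefficient.
    have h1 := congrArg (coeff (γ + sh α)) h0
    rw [coeff_sum, Finset.sum_eq_single_of_mem α hα, coeff_smul, coeff_monomial, if_pos rfl,
      coeff_zero, smul_eq_mul, mul_one] at h1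
    · rw [map_zero, ← h1]
      congr 1
      congr 1
      ext i
      rw [← hk i]
      simp [γ]
    · intro α' hα' hne'
      rw [coeff_smul, coeff_monomial, if_neg, smul_zero]
      intro e
      exact hne' (hinj α' hα' α hα (add_left_cancel e))

theorem cSys_isBasis : (cSys K n).IsBasis K := ⟨cSys_injective, cSys_surjective⟩

/-- The unit `x_i` of `𝒜_1(i)`. -/
def facXUnit (i : Fin n) : (fac K i)ˣ where
  val := facX K i
  inv := ⟨toCA K n (jHinv K i * jD K i), by
    rw [map_mul]
    exact mul_mem (Algebra.subset_adjoin (by simp)) (Algebra.subset_adjoin (by simp))⟩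
  val_inv := Subtype.ext (cXUnit K i).val_inv
  inv_val := Subtype.ext (cXUnit K i).inv_val

/-- The unit `H_i` of `𝒜_1(i)`. -/
def facHUnit (i : Fin n) : (fac K i)ˣ where
  val := facH K i
  inv := ⟨toCA K n (jHinv K i), Algebra.subset_adjoin (by simp)⟩
  val_inv := Subtype.ext (cHUnit i).val_inv
  inv_val := Subtype.ext (cHUnit i).inv_val

variable (K) in
/-- The generators of `𝒜_1(i)`. -/
def facSys (i : Fin n) : ShiftSystem (fac K i) (Fin 1) :=
  ShiftSystem.ofUnits (fun _ => facXUnit i) (fun _ => facHUnit i)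
    (fun _ _ => rfl) (fun _ _ => rfl) fun a b => by
      rw [if_pos (Subsingleton.elim a b)]
      refine Subtype.ext ?_
      have := cX_mul_cH (K := K) i i
      rw [if_pos rfl] at this
      exact this

@[simp] theorem facSys_X (i : Fin n) (k : Fin 1) : ((facSys K i).X k : fac K i) = facX K i := rfl

@[simp] theorem facSys_H (i : Fin n) (k : Fin 1) : (facSys K i).H k = facH K i := rfl

@[simp] theorem facX_val (i : Fin n) : (facX K i : CA K n) = cX K i := rfl

@[simp] theorem facH_val (i : Fin n) : (facH K i : CA K n) = cH K i := rfl

theorem facSys_surjective (i : Fin n) : Function.Surjective ((facSys K i).phi K) := by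
  refine ShiftSystem.phi_surjective _ fun A hX hX' hH hU => ?_
  have h : fac K i ≤ A.map (fac K i).val := by
    refine Algebra.adjoin_le ?_
    rintro _ (rfl | rfl | rfl)
    · exact ⟨_, hX 0, rfl⟩
    · refine ⟨_, mul_mem (hH 0) (hX' 0), ?_⟩
      rw [toCA_jD]
      rfl
    · refine ⟨_, hU 0 0, ?_⟩
      have h0 : (facSys K i).U 0 0 = facHUnit i := by
        ext
        rw [(facSys K i).U_val]
        simp [facHUnit]
      rw [h0]
      rfl
  refine eq_top_iff.2 fun a _ => ?_
  obtain ⟨b, hb, e⟩ := h a.2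
  rwa [← Subtype.ext e]

/-- A relation in $\mathcal{A}_1(i)$ is a relation in $\mathcal{A}_n$ supported on the $i$-th axis.
The maps on exponents and on polynomials are both injective, so independence is inherited. -/
theorem facSys_injective (i : Fin n) : Function.Injective ((facSys K i).phi K) := by
  refine ShiftSystem.phi_injective _ fun f hf => ?_
  let j : (Fin 1 → ℤ) → (Fin n → ℤ) := fun α => Pi.single i (α 0)
  have hj : Function.Injective j := fun α β h => by
    have := congrFun h i
    simp only [j, Pi.single_eq_same] at this
    ext k
    rwa [Subsingleton.elim k 0]
  let r : MvPolynomial (Fin 1) K →ₐ[K] MvPolynomial (Fin n) K := rename fun _ => i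
  have hr : Function.Injective r := rename_injective _ fun a b _ => Subsingleton.elim a b
  have hθ : ∀ p : MvPolynomial (Fin 1) K, ((facSys K i).theta (ofPoly K p) : CA K n) =
      (cSys K n).theta (ofPoly K (r p)) := by
    intro p
    have : ((fac K i).val.comp (facSys K i).theta).comp (ofPoly K) =
        ((cSys K n).theta.comp (ofPoly K)).comp r := by
      refine MvPolynomial.algHom_ext fun k => ?_
      have h1 := (facSys K i).theta_gen (K := K) k
      have h2 := (cSys K n).theta_gen (K := K) i
      rw [gen] at h1 h2
      simp only [AlgHom.comp_apply, h1, r, rename_X, h2]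
      rfl
    exact DFunLike.congr_fun this p
  have hx : ∀ α, ((facSys K i).xpow α : CA K n) = (cSys K n).xpow (j α) := by
    intro α
    have : α = Pi.single 0 (α 0) := by
      ext k
      rw [Subsingleton.elim k 0, Pi.single_eq_same]
    rw [this, ShiftSystem.xpow_single]
    simp only [j, Pi.single_eq_same, ShiftSystem.xpow_single]
    have h2 : Units.map ((fac K i).val : fac K i →* CA K n) ((facSys K i).X 0) = (cSys K n).X i := by
      ext; rfl
    rw [← h2, ← map_zpow]
    rfl
  let f' := Finsupp.mapDomain j (f.mapRange r (map_zero r))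
  have key : ((facSys K i).phi K (f.mapRange (ofPoly K) (map_zero _)) : CA K n) =
      (cSys K n).phi K (f'.mapRange (ofPoly K) (map_zero _)) := by
    simp only [f']
    clear hf f'
    induction f using Finsupp.induction_linear with
    | zero => simp
    | add f g hf hg =>
      rw [Finsupp.mapRange_add (map_add _), map_add, Subalgebra.coe_add, hf, hg,
        Finsupp.mapRange_add (map_add _), Finsupp.mapDomain_add, Finsupp.mapRange_add (map_add _),
        map_add]
    | single α p =>
      rw [Finsupp.mapRange_single, Finsupp.mapRange_single, Finsupp.mapDomain_single,
        Finsupp.mapRange_single, ShiftSystem.phi_single, ShiftSystem.phi_single, Subalgebra.coe_mul,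
        hθ, hx]
  rw [hf, Subalgebra.coe_zero, eq_comm, map_eq_zero_iff _ cSys_injective] at key
  have h0 : f' = 0 := by
    ext1 α
    have := DFunLike.congr_fun key α
    rw [Finsupp.mapRange_apply, Finsupp.zero_apply, map_eq_zero_iff _ (ofPoly_injective K)] at this
    rw [this, Finsupp.zero_apply]
  have h1 : f.mapRange r (map_zero r) = 0 := by
    apply Finsupp.mapDomain_injective hj
    rw [Finsupp.mapDomain_zero]
    exact h0
  ext1 α
  have := DFunLike.congr_fun h1 α
  rw [Finsupp.mapRange_apply, Finsupp.zero_apply, map_eq_zero_iff _ hr] at this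
  rw [this, Finsupp.zero_apply]

theorem facSys_isBasis (i : Fin n) : (facSys K i).IsBasis K :=
  ⟨facSys_injective i, facSys_surjective i⟩

end

end Jacobian

/-- A function on $\mathbb{Z}$ invariant under translation by $\pm1$ is constant, and a finitely
supported one takes the value zero. It serves to show that exponents of units vanish. -/
theorem Finsupp.eq_zero_of_add_unit {M : Type*} [Zero M] (f : ℤ →₀ M) (b : ℤˣ)
    (h : ∀ j, f (j + b) = f j) : f = 0 := by
  have h1 : ∀ j, f (j + 1) = f j := by
    rcases Int.units_eq_one_or b with rfl | rfl
    · exact h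
    · intro j
      have := h (j + 1)
      simpa using this.symm
  have h2 : ∀ j, f j = f 0 := by
    intro j
    induction j using Int.induction_on with
    | zero => rfl
    | succ i ih => rw [h1, ih]
    | pred i ih => rw [← ih, ← h1 (-i - 1)]; simp
  obtain ⟨j, hj⟩ := Infinite.exists_notMem_finset f.support
  ext k
  rw [h2, ← h2 j, Finsupp.notMem_support_iff.1 hj, Finsupp.zero_apply]

/-! ### Units that involve a single variable -/

namespace LinLoc

noncomputable section

variable {K ι : Type*} [Field K]

/-- The products of integer powers of the `H_i + j` with `i` fixed. -/
def linProdAt (i : ι) : Multiplicative (ℤ →₀ ℤ) →* (LinLoc K ι)ˣ :=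
  linProd.comp (AddMonoidHom.toMultiplicative (Finsupp.mapDomain.addMonoidHom (Prod.mk i)))

theorem linProdAt_apply (i : ι) (w : ℤ →₀ ℤ) : linProdAt i (Multiplicative.ofAdd w) =
    (linProd (Multiplicative.ofAdd (w.mapDomain (Prod.mk i))) : (LinLoc K ι)ˣ) := rfl

@[simp]
theorem linProdAt_single (i : ι) (j k : ℤ) :
    linProdAt i (Multiplicative.ofAdd (Finsupp.single j k)) = linUnit K i j ^ k := by
  rw [linProdAt_apply, Finsupp.mapDomain_single, linProd_single]

theorem exists_linProdAt (i : ι) {m : ι × ℤ →₀ ℤ} (h : ∀ k j, k ≠ i → m (k, j) = 0) :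
    ∃ w : ℤ →₀ ℤ, linProd (Multiplicative.ofAdd m) =
      (linProdAt i (Multiplicative.ofAdd w) : (LinLoc K ι)ˣ) := by
  have hinj : Function.Injective (Prod.mk i : ℤ → ι × ℤ) := Prod.mk_right_injective i
  refine ⟨m.comapDomain (Prod.mk i) hinj.injOn, ?_⟩
  rw [linProdAt_apply, Finsupp.mapDomain_comapDomain _ hinj]
  rintro ⟨k, j⟩ hk
  by_cases hki : k = i
  · exact ⟨j, by rw [hki]⟩
  · exact absurd (h k j hki) (Finsupp.mem_support_iff.1 hk)

variable [CharZero K] [DecidableEq ι]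

/-- The unit shift in the direction $i$ lowers the left side by $1$ and the right side by $a$ if
$k=i$, by $0$ otherwise. -/
theorem gen_linear_inj {i k : ι} {a c : K}
    (h : gen K i = algebraMap K (LinLoc K ι) a * gen K k + algebraMap K _ c) : k = i ∧ a = 1 := by
  have e := congrArg (shift K (Pi.single i 1)) h
  simp only [map_add, map_mul, shift_gen, AlgHom.commutes, Pi.single_eq_same] at e
  by_cases hk : k = i
  · subst hk
    refine ⟨rfl, ?_⟩
    apply (algebraMap K (LinLoc K ι)).injective
    simp only [Pi.single_eq_same, Int.cast_one] at e
    rw [map_one]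
    linear_combination e - h
  · exfalso
    simp only [Pi.single_eq_of_ne hk, Int.cast_zero, Int.cast_one, sub_zero] at e
    have : (1 : LinLoc K ι) = 0 := by linear_combination h - e
    exact one_ne_zero this

end

end LinLoc

/-! ### The shape of an arbitrary automorphism -/

namespace ShiftSystem

noncomputable section

open LinLoc

variable {K R ι : Type*} [Field K] [Ring R] [Algebra K R] [DecidableEq ι] [Fintype ι]
  {S : ShiftSystem R ι}

/-- Coefficients commute with $H_i$, so only the degree of a homogeneous unit acts. Conversely the
degree of a unit can be read off from its action on the $H_i$. -/
theorem thetaU_xpow_conj_H (l : (LinLoc K ι)ˣ) (α : ι → ℤ) (i : ι) :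
    innerHom K R (S.thetaU l * S.xpow α) (S.H i) = S.H i - (α i : R) := by
  rw [map_mul, AlgEquiv.mul_apply, innerHom_xpow_H]
  have : S.H i - (α i : R) = S.theta (gen K i - (α i : LinLoc K ι)) := by simp
  rw [this, innerHom_apply, thetaU_val, thetaU_inv_val, ← map_mul, ← map_mul, mul_right_comm,
    Units.mul_inv, one_mul]

theorem innerHom_X_H (i j : ι) :
    innerHom K R (S.X i) (S.H j) = S.H j - if i = j then 1 else 0 := by
  rw [innerHom_apply, X_mul_H, mul_assoc, Units.mul_inv, mul_one]

theorem map_innerHom (σ : R ≃ₐ[K] R) (u : Rˣ) (a : R) :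
    σ (innerHom K R u a) = innerHom K R (Units.map (σ : R →* R) u) (σ a) := by
  simp

namespace IsBasis

variable [CharZero K]

theorem exists_unit' (h : S.IsBasis K) (w : Rˣ) : ∃ (c : Kˣ) (m : ι × ℤ →₀ ℤ) (α : ι → ℤ),
    w = S.thetaU (scalarUnit K (LinLoc K ι) c * linProd (Multiplicative.ofAdd m)) * S.xpow α := by
  obtain ⟨l, α, hw⟩ := h.exists_unit w
  obtain ⟨c, m, rfl⟩ := exists_linProd l
  exact ⟨c, m, α, hw⟩

theorem thetaU_xpow_inj (h : S.IsBasis K) {l l' : (LinLoc K ι)ˣ} {α β : ι → ℤ}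
    (e : S.thetaU l * S.xpow α = S.thetaU l' * S.xpow β) : l = l' ∧ α = β := by
  have := h.theta_mul_xpow_inj (l := l) (l' := l') l.ne_zero (congrArg Units.val e)
  exact ⟨Units.ext this.2, this.1⟩

theorem intCast_inj (h : S.IsBasis K) {a b : ℤ} (e : (a : R) = b) : a = b := by
  have : S.theta (a : LinLoc K ι) = S.theta (b : LinLoc K ι) := by simpa using e
  have e' := h.theta_injective this
  have : algebraMap K (LinLoc K ι) a = algebraMap K (LinLoc K ι) b := by simpa using e'
  exact_mod_cast (algebraMap K (LinLoc K ι)).injective this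

/-- Both $\sigma(H_i)$ and $\sigma(H_i)+1$ are units, hence homogeneous. Adding $1$ to a nonzero
homogeneous element of nonzero degree destroys homogeneity. -/
theorem exists_map_H_eq_theta (h : S.IsBasis K) (σ : R ≃ₐ[K] R) (i : ι) :
    ∃ l : (LinLoc K ι)ˣ, σ (S.H i) = S.theta (l : LinLoc K ι) := by
  obtain ⟨l, α, hl⟩ := h.exists_unit (Units.map (σ : R →* R) (S.U i 0))
  obtain ⟨l', β, hl'⟩ := h.exists_unit (Units.map (σ : R →* R) (S.U i 1))
  have e := congrArg Units.val hl
  have e' := congrArg Units.val hl'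
  simp only [Units.coe_map, MonoidHom.coe_coe, U_val, Units.val_mul, thetaU_val, Int.cast_zero,
    add_zero, Int.cast_one, map_add, map_one] at e e'
  have hs : Finsupp.single β (l' : LinLoc K ι) = Finsupp.single α (l : LinLoc K ι) + Finsupp.single 0 1 := by
    apply h.1
    have h1 : S.phi K (Finsupp.single 0 1) = 1 := by simp
    have e2 : σ (S.H i) + 1 = S.theta (l' : LinLoc K ι) * S.xpow β := e'
    rw [map_add, phi_single, phi_single, h1, ← e2]
    exact congrArg (· + 1) e
  have hα : α = 0 := by
    by_contra hα
    have h1 := DFunLike.congr_fun hs α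
    have h2 := DFunLike.congr_fun hs 0
    simp only [Finsupp.add_apply, Finsupp.single_apply, if_true, if_neg hα, if_neg (Ne.symm hα),
      add_zero, zero_add] at h1 h2
    split_ifs at h1 h2 with h3 h4 h5
    · exact hα (h3.symm.trans h4)
    · exact zero_ne_one h2
    · exact l.ne_zero h1.symm
    · exact l.ne_zero h1.symm
  refine ⟨l, ?_⟩
  have e2 : σ (S.H i) = S.theta (l : LinLoc K ι) * S.xpow α := e
  rw [e2, hα]
  simp

/-- Conjugation by the homogeneous unit $\sigma^{-1}(x_k)$ lowers $H_i$ by an integer. Applying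
$\sigma$, the unit shift in the direction $k$ lowers $\sigma(H_i)$ by that integer, so
`linear_of_shift_eq_sub` applies. -/
theorem exists_map_H_linear (h : S.IsBasis K) (σ : R ≃ₐ[K] R) (i : ι) :
    ∃ (k : ι) (j b : ℤ), σ (S.H i) = (b : R) * (S.H k + (j : R)) := by
  obtain ⟨l, hl⟩ := h.exists_map_H_eq_theta σ i
  have hb : ∀ k, ∃ b : ℤ, shift K (Pi.single k 1) (l : LinLoc K ι) = l - (b : LinLoc K ι) := by
    intro k
    obtain ⟨l', β, e⟩ := h.exists_unit (Units.map (σ.symm : R →* R) (S.X k))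
    have e1 := thetaU_xpow_conj_H (S := S) l' β i
    rw [← e] at e1
    have e2 := congrArg σ e1
    rw [map_innerHom] at e2
    have hx : Units.map (σ : R →* R) (Units.map (σ.symm : R →* R) (S.X k)) = S.xpow (Pi.single k 1) := by
      ext; simp [xpow_single]
    rw [hx, map_sub, map_intCast, hl, innerHom_apply, xpow_mul_theta, mul_assoc, Units.mul_inv,
      mul_one] at e2
    refine ⟨β i, h.theta_injective ?_⟩
    rw [e2]; simp
  choose b hb using hb
  rcases linear_of_shift_eq_sub l b hb with ⟨c, hc⟩ | ⟨k, j, hkj⟩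
  -- If $\sigma(H_i)$ were a scalar, so would be $H_i$, but the shift moves $H_i$.
  · exfalso
    rw [hc, AlgHom.commutes] at hl
    have h1 := congrArg σ.symm hl
    rw [AlgEquiv.symm_apply_apply, AlgEquiv.commutes, ← theta_gen (K := K), ← AlgHom.commutes S.theta c] at h1
    have h2 := h.theta_injective h1
    have h3 := congrArg (shift K (Pi.single i 1)) h2
    rw [shift_gen, AlgHom.commutes, ← h2] at h3
    simp at h3
  · exact ⟨k, j, b k, by rw [hl, hkj]; simp⟩

/-- The values of an automorphism on the `H_i`. -/
theorem exists_map_H (h : S.IsBasis K) (σ : R ≃ₐ[K] R) :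
    ∃ (π : Equiv.Perm ι) (ε : ι → ℤˣ) (m : ι → ℤ),
      ∀ i, σ (S.H i) = ((ε i : ℤ) : R) * (S.H (π i) + (m i : R)) := by
  choose k j b hk using h.exists_map_H_linear
  -- The choices are made for all automorphisms at once, so they can be compared for $\sigma$ and
  -- $\sigma^{-1}$: composing gives $H_i$ as an affine function of a single generator.
  have key : ∀ (σ : R ≃ₐ[K] R) i, k σ⁻¹ (k σ i) = i ∧ b σ i * b σ⁻¹ (k σ i) = 1 := by
    intro σ i
    have e : S.H i = σ⁻¹ (σ (S.H i)) := (σ.symm_apply_apply _).symm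
    rw [hk σ i, map_mul, map_add, map_intCast, map_intCast, hk σ⁻¹ (k σ i)] at e
    have e' : S.theta (gen K i) = S.theta (algebraMap K (LinLoc K ι) ((b σ i * b σ⁻¹ (k σ i) : ℤ) : K) *
        gen K (k σ⁻¹ (k σ i)) + algebraMap K _
          ((b σ i * (b σ⁻¹ (k σ i) * j σ⁻¹ (k σ i) + j σ i) : ℤ) : K)) := by
      rw [theta_gen]
      refine e.trans ?_
      simp only [map_add, map_mul, theta_gen, map_intCast, Int.cast_mul, Int.cast_add]
      noncomm_ring
    obtain ⟨h1, h2⟩ := gen_linear_inj (h.theta_injective e')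
    exact ⟨h1, by exact_mod_cast h2⟩
  have key' : ∀ i, k σ (k σ⁻¹ i) = i := fun i => by simpa using (key σ⁻¹ i).1
  refine ⟨⟨k σ, k σ⁻¹, fun i => (key σ i).1, key'⟩,
    fun i => Units.mkOfMulEqOne _ _ (key σ i).2, j σ, fun i => ?_⟩
  exact hk σ i

theorem thetaU_mul_xpow_mul (l l' : (LinLoc K ι)ˣ) (α β : ι → ℤ) :
    S.thetaU l * S.xpow α * (S.thetaU l' * S.xpow β) =
      S.thetaU (l * Units.map (shift K α : LinLoc K ι →* LinLoc K ι) l') * S.xpow (α + β) := by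
  ext
  have := S.phi_single_mul α β (l : LinLoc K ι) l'
  rw [phi_single, phi_single, phi_single] at this
  exact this

/-- The structure of automorphisms. -/
theorem exists_map_form (h : S.IsBasis K) (σ : R ≃ₐ[K] R) :
    ∃ (π : Equiv.Perm ι) (ε : ι → ℤˣ) (m : ι → ℤ) (c : ι → Kˣ) (w : ι → ℤ →₀ ℤ),
      ∀ i, σ (S.H i) = ((ε i : ℤ) : R) * (S.H (π i) + (m i : R)) ∧
        Units.map (σ : R →* R) (S.X i) =
          S.thetaU (scalarUnit K (LinLoc K ι) (c i) * linProdAt (π i) (Multiplicative.ofAdd (w i))) *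
            S.X (π i) ^ (ε i : ℤ) := by
  obtain ⟨π, ε, m, hH⟩ := h.exists_map_H σ
  choose c M α hX using fun i => h.exists_unit' (Units.map (σ : R →* R) (S.X i))
  -- Applying $\sigma$ to $x_iH_lx_i^{-1}=H_l-\delta_{il}$ gives
  -- $\varepsilon_l\,\alpha_i(\pi(l))=\delta_{il}$.
  have hα : ∀ i, α i = Pi.single (π i) (ε i : ℤ) := by
    intro i
    have hl : ∀ l, (ε l : ℤ) * α i (π l) = if i = l then 1 else 0 := by
      intro l
      have e := congrArg σ (S.innerHom_X_H (K := K) i l)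
      rw [map_innerHom, hX i, hH l, map_mul, map_intCast, map_add, map_intCast, thetaU_xpow_conj_H,
        map_sub, hH l] at e
      apply h.intCast_inj
      have e1 : ((ε l : ℤ) : R) * (α i (π l) : R) = σ (if i = l then 1 else 0) := by
        have h3 : ((ε l : ℤ) : R) * (S.H (π l) - (α i (π l) : R) + (m l : R)) =
            ((ε l : ℤ) : R) * (S.H (π l) + (m l : R)) - ((ε l : ℤ) : R) * (α i (π l) : R) := by
          noncomm_ring
        rw [h3] at e
        exact sub_right_inj.1 e
      push_cast
      rw [e1]
      split_ifs <;> simp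
    ext k
    obtain ⟨l, rfl⟩ := π.surjective k
    have h1 := hl l
    have h2 : α i (π l) = (ε l : ℤ) * ((ε l : ℤ) * α i (π l)) := by
      rw [← mul_assoc, Int.units_coe_mul_self, one_mul]
    rw [h2, h1]
    by_cases hil : i = l
    · subst hil; simp
    · have : π l ≠ π i := fun e => hil (π.injective e).symm
      simp [hil, this]
  -- The images of $x_l$ and $x_i$ commute. Comparing exponents of the $H_{\pi(l)}+j$, the
  -- contribution of $\sigma(x_l)$ cancels, and the exponents of $\sigma(x_i)$ are invariant under
  -- translation by $\varepsilon_l=\pm1$, hence zero.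
  have hM : ∀ i k j, k ≠ π i → M i (k, j) = 0 := by
    intro i k j hk
    obtain ⟨l, rfl⟩ := π.surjective k
    have hli : l ≠ i := fun e => hk (by rw [e])
    have hc : Units.map (σ : R →* R) (S.X l) * Units.map (σ : R →* R) (S.X i) =
        Units.map (σ : R →* R) (S.X i) * Units.map (σ : R →* R) (S.X l) := by
      rw [← map_mul, (S.comm_X l i).eq, map_mul]
    rw [hX l, hX i, thetaU_mul_xpow_mul, thetaU_mul_xpow_mul] at hc
    have e := (h.thetaU_xpow_inj hc).1
    simp only [map_mul, map_shift_scalarUnit, map_shift_linProd] at e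
    have e' : scalarUnit K (LinLoc K ι) (c l * c i) *
          linProd (Multiplicative.ofAdd (M l + shiftExp (α l) (M i))) =
        scalarUnit K _ (c i * c l) * linProd (Multiplicative.ofAdd (M i + shiftExp (α i) (M l))) := by
      rw [ofAdd_add, ofAdd_add, map_mul, map_mul, map_mul, map_mul, mul_mul_mul_comm, e,
        mul_mul_mul_comm]
    have e2 := (linProd_inj e').2
    have hinj : Function.Injective (Prod.mk (π l) : ℤ → ι × ℤ) := Prod.mk_right_injective _
    have h0 := Finsupp.eq_zero_of_add_unit ((M i).comapDomain (Prod.mk (π l)) hinj.injOn) (ε l) (by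
      intro j
      have e3 := DFunLike.congr_fun e2 (π l, j)
      simp only [Finsupp.add_apply, shiftExp_apply, hα, Pi.single_eq_same, Pi.single_eq_of_ne hk,
        add_zero] at e3
      rw [Finsupp.comapDomain_apply, Finsupp.comapDomain_apply]
      linarith)
    exact DFunLike.congr_fun h0 j
  choose w hw using fun i => exists_linProdAt (K := K) (π i) (hM i)
  refine ⟨π, ε, m, c, w, fun i => ⟨hH i, ?_⟩⟩
  rw [hX i, hw, hα, xpow_single]

end IsBasis

end

end ShiftSystem

/-- A multiplicative family of endomorphisms indexed by a group consists of automorphisms. -/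
def AlgEquiv.homOfEnd {K R G : Type*} [CommSemiring K] [Semiring R] [Algebra K R] [Group G]
    (F : G → R →ₐ[K] R) (h1 : F 1 = AlgHom.id K R) (hmul : ∀ g g', F (g * g') = (F g).comp (F g')) :
    G →* (R ≃ₐ[K] R) :=
  (AlgEquiv.algHomUnitsEquiv K R).toMonoidHom.comp
    (MonoidHom.toHomUnits { toFun := F, map_one' := h1, map_mul' := hmul })

namespace ShiftSystem

/-- The system obtained by a permutation of the indices. -/
def reindex {R ι : Type*} [Ring R] [DecidableEq ι] (S : ShiftSystem R ι) (s : Equiv.Perm ι) :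
    ShiftSystem R ι where
  X i := S.X (s i)
  H i := S.H (s i)
  U i := S.U (s i)
  U_val i := S.U_val (s i)
  comm_X i j := S.comm_X (s i) (s j)
  comm_H i j := S.comm_H (s i) (s j)
  X_mul_H i j := by simpa using S.X_mul_H (s i) (s j)

end ShiftSystem

/-! ### The actions of $S_n$ and $\prod_i\mathcal{G}_1(i)$, and the decomposition of $\mathcal{G}_n$
-/

namespace Jacobian

noncomputable section

open LinLoc ShiftSystem

variable {K : Type*} [Field K] [CharZero K] {n : ℕ}

variable (K n) in
/-- The action of the symmetric group on `𝒜_n`. -/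
def permHom : Equiv.Perm (Fin n) →* (CA K n ≃ₐ[K] CA K n) :=
  AlgEquiv.homOfEnd (fun s => (cSys_isBasis (K := K)).lift ((cSys K n).reindex s))
    (cSys_isBasis.hom_ext (fun i => by rw [IsBasis.lift_X]; rfl) fun i => by
      rw [IsBasis.lift_H]; rfl)
    (fun s t => cSys_isBasis.hom_ext
      (fun i => by
        rw [IsBasis.lift_X, AlgHom.comp_apply, IsBasis.lift_X]
        exact (cSys_isBasis.lift_X ((cSys K n).reindex s) (t i)).symm)
      (fun i => by
        rw [IsBasis.lift_H, AlgHom.comp_apply, IsBasis.lift_H]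
        exact (cSys_isBasis.lift_H ((cSys K n).reindex s) (t i)).symm))

@[simp]
theorem permHom_cX (s : Equiv.Perm (Fin n)) (i : Fin n) : permHom K n s (cX K i) = cX K (s i) :=
  cSys_isBasis.lift_X _ i

@[simp]
theorem permHom_cH (s : Equiv.Perm (Fin n)) (i : Fin n) : permHom K n s (cH K i) = cH K (s i) :=
  cSys_isBasis.lift_H _ i

theorem commute_of_mem_fac {j : Fin n} {a b : CA K n} (hX : Commute a (cX K j))
    (hH : Commute a (cH K j)) (hb : b ∈ fac K j) : Commute a b := by
  have h : fac K j ≤ Subalgebra.centralizer K {a} := by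
    refine Algebra.adjoin_le ?_
    have hx : Commute a ((cXUnit K j)⁻¹ : (CA K n)ˣ) := Commute.units_inv_right (u := cXUnit K j) hX
    rintro _ (rfl | rfl | rfl) <;> rw [SetLike.mem_coe, Subalgebra.mem_centralizer_iff] <;>
      rintro _ rfl
    · exact hX
    · rw [toCA_jD]
      exact hH.mul_right hx
    · exact Commute.units_inv_right (u := cHUnit j) hH
  exact (Subalgebra.mem_centralizer_iff K).1 (h hb) a rfl

theorem fac_commute {i j : Fin n} (hij : i ≠ j) {a b : CA K n} (ha : a ∈ fac K i)
    (hb : b ∈ fac K j) : Commute a b := by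
  have hxx : Commute (cX K i) (cX K j) := cX_comm i j
  have hhh : Commute (cH K i) (cH K j) := cH_comm i j
  have hxh : Commute (cX K i) (cH K j) := by
    have := cX_mul_cH (K := K) i j
    rwa [if_neg hij, sub_zero] at this
  have hhx : Commute (cH K i) (cX K j) := by
    have := cX_mul_cH (K := K) j i
    rw [if_neg hij.symm, sub_zero] at this
    exact this.symm
  exact (commute_of_mem_fac (commute_of_mem_fac hxx hxh hb).symm (commute_of_mem_fac hhx hhh hb).symm
    ha).symm

/-- Homomorphisms of the algebras `𝒜_1(i)` whose images commute give a system of generators. -/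
def tupleSys (τ : ∀ i : Fin n, fac K i →ₐ[K] fac K i) : ShiftSystem (CA K n) (Fin n) :=
  ShiftSystem.ofUnits
    (fun i => Units.map (((fac K i).val.comp (τ i) : fac K i →ₐ[K] CA K n) : fac K i →* CA K n)
      (facXUnit i))
    (fun i => Units.map (((fac K i).val.comp (τ i) : fac K i →ₐ[K] CA K n) : fac K i →* CA K n)
      (facHUnit i))
    (fun i j => by
      by_cases hij : i = j
      · subst hij; rfl
      · exact Units.ext (fac_commute hij (τ i (facX K i)).2 (τ j (facX K j)).2))
    (fun i j => by
      by_cases hij : i = j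
      · subst hij; rfl
      · exact Units.ext (fac_commute hij (τ i (facH K i)).2 (τ j (facH K j)).2))
    (fun i j => by
      by_cases hij : i = j
      · subst hij
        have h := (facSys K i).X_mul_H 0 0
        have := congrArg (fun a => ((τ i a : fac K i) : CA K n)) h
        simpa using! this
      · have := fac_commute hij (τ i (facX K i)).2 (τ j (facH K j)).2
        rw [if_neg hij, sub_zero]
        exact this)

/-- The extension of a tuple of endomorphisms. -/
def tupleEnd (τ : ∀ i : Fin n, fac K i →ₐ[K] fac K i) : CA K n →ₐ[K] CA K n :=
  (cSys_isBasis (K := K)).lift (tupleSys τ)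

theorem tupleEnd_apply (τ : ∀ i : Fin n, fac K i →ₐ[K] fac K i) (i : Fin n) (a : fac K i) :
    tupleEnd τ a = τ i a := by
  have : (tupleEnd τ).comp (fac K i).val = (fac K i).val.comp (τ i) :=
    (facSys_isBasis i).hom_ext (fun _ => cSys_isBasis.lift_X (tupleSys τ) i)
      fun _ => cSys_isBasis.lift_H (tupleSys τ) i
  exact DFunLike.congr_fun this a

theorem hom_ext_fac {R : Type*} [Ring R] [Algebra K R] {f g : CA K n →ₐ[K] R}
    (h : ∀ (i : Fin n) (a : fac K i), f (a : CA K n) = g a) : f = g :=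
  cSys_isBasis.hom_ext (fun i => h i (facX K i)) fun i => h i (facH K i)

theorem equiv_ext_fac {f g : CA K n ≃ₐ[K] CA K n}
    (h : ∀ (i : Fin n) (a : fac K i), f (a : CA K n) = g a) : f = g :=
  cSys_isBasis.equiv_ext (fun i => h i (facX K i)) fun i => h i (facH K i)

variable (K n) in
/-- The action of the product of the groups `Aut(𝒜_1(i))` on `𝒜_n`. -/
def facHom : (∀ i : Fin n, fac K i ≃ₐ[K] fac K i) →* (CA K n ≃ₐ[K] CA K n) :=
  AlgEquiv.homOfEnd (fun τ => tupleEnd fun i => (τ i : fac K i →ₐ[K] fac K i))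
    (hom_ext_fac fun i a => tupleEnd_apply _ i a)
    (fun τ τ' => hom_ext_fac fun i a => by
      rw [AlgHom.comp_apply, tupleEnd_apply, tupleEnd_apply, tupleEnd_apply]
      rfl)

theorem facHom_apply (τ : ∀ i : Fin n, fac K i ≃ₐ[K] fac K i) (i : Fin n) (a : fac K i) :
    facHom K n τ a = τ i a := tupleEnd_apply _ i a

theorem facHom_injective : Function.Injective (facHom K n) := by
  intro τ τ' h
  ext i a
  have := DFunLike.congr_fun h (a : CA K n)
  rwa [facHom_apply, facHom_apply] at this

theorem cX_mem_fac (i : Fin n) : cX K i ∈ fac K i := (facX K i).2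

theorem cH_mem_fac (i : Fin n) : cH K i ∈ fac K i := (facH K i).2

theorem one_ne_zero_CA : (1 : CA K n) ≠ 0 := by
  intro h
  have := (cSys_isBasis (K := K) (n := n)).intCast_inj (a := 1) (b := 0) (by simpa using h)
  exact one_ne_zero this

/-- Different factors commute, so otherwise $H_i$ would commute with $x_i$, against
$x_iH_i=(H_i-1)x_i$. This recovers the index of a factor from an element in it. -/
theorem eq_of_cH_mem_fac {i k : Fin n} (h : cH K i ∈ fac K k) : i = k := by
  by_contra hik
  have h1 : Commute (cX K i) (cH K i) := fac_commute hik (cX_mem_fac i) h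
  have h2 := cX_mul_cH (K := K) i i
  rw [h1.eq, if_pos rfl, sub_mul, one_mul, eq_comm, sub_eq_self] at h2
  have h3 := (cXUnit K i).inv_val
  change _ * cX K i = 1 at h3
  rw [h2, mul_zero] at h3
  exact one_ne_zero_CA h3.symm

theorem eq_of_cX_mem_fac {i k : Fin n} (h : cX K i ∈ fac K k) : i = k := by
  by_contra hik
  have h1 : Commute (cH K i) (cX K i) := fac_commute hik (cH_mem_fac i) h
  have h2 := cX_mul_cH (K := K) i i
  rw [h1.eq.symm, if_pos rfl, sub_mul, one_mul, eq_comm, sub_eq_self] at h2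
  have h3 := (cXUnit K i).inv_val
  change _ * cX K i = 1 at h3
  rw [h2, mul_zero] at h3
  exact one_ne_zero_CA h3.symm

theorem permHom_injective : Function.Injective (permHom K n) := by
  intro s t h
  ext i
  have h1 := DFunLike.congr_fun h (cX K i)
  rw [permHom_cX, permHom_cX] at h1
  rw [eq_of_cX_mem_fac (K := K) (h1 ▸ cX_mem_fac (s i) : cX K (t i) ∈ fac K (s i))]

/-- The units of `𝒜_1(i)`, as units of `𝒜_n`. -/
def facUnits (K : Type*) [Field K] (i : Fin n) : Subgroup (CA K n)ˣ :=
  (Units.map ((fac K i).val : fac K i →* CA K n)).range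

theorem facUnits_val_mem {i : Fin n} {u : (CA K n)ˣ} (h : u ∈ facUnits K i) : (u : CA K n) ∈ fac K i := by
  obtain ⟨v, rfl⟩ := h
  exact (v : fac K i).2

theorem facUnits_inv_val_mem {i : Fin n} {u : (CA K n)ˣ} (h : u ∈ facUnits K i) :
    ((u⁻¹ : (CA K n)ˣ) : CA K n) ∈ fac K i := facUnits_val_mem (inv_mem h)

theorem scalarUnit_mem_facUnits (i : Fin n) (c : Kˣ) : scalarUnit K (CA K n) c ∈ facUnits K i :=
  ⟨scalarUnit K _ c, by ext; rfl⟩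

theorem X_mem_facUnits (i : Fin n) : (cSys K n).X i ∈ facUnits K i := ⟨facXUnit i, by ext; rfl⟩

theorem U_mem_facUnits (i : Fin n) (j : ℤ) : (cSys K n).U i j ∈ facUnits K i := by
  refine ⟨(facSys K i).U 0 j, ?_⟩
  ext
  rw [(cSys K n).U_val]
  change (((facSys K i).U 0 j : fac K i) : CA K n) = _
  rw [(facSys K i).U_val]
  simp

theorem linProdAt_mem_facUnits (i : Fin n) (w : ℤ →₀ ℤ) :
    (cSys K n).thetaU (linProdAt (K := K) i (Multiplicative.ofAdd w)) ∈ facUnits K i := by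
  induction w using Finsupp.induction_linear with
  | zero => rw [ofAdd_zero, map_one, map_one]; exact one_mem _
  | add w w' h h' => rw [ofAdd_add, map_mul, map_mul]; exact mul_mem h h'
  | single j k =>
    rw [linProdAt_single, map_zpow, thetaU_linUnit]
    exact zpow_mem (U_mem_facUnits i j) k

theorem linProd_mem_iSup (m : Fin n × ℤ →₀ ℤ) :
    (cSys K n).thetaU (linProd (K := K) (Multiplicative.ofAdd m)) ∈ ⨆ i, facUnits (n := n) K i := by
  induction m using Finsupp.induction_linear with
  | zero => rw [ofAdd_zero, map_one, map_one]; exact one_mem _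
  | add w w' h h' => rw [ofAdd_add, map_mul, map_mul]; exact mul_mem h h'
  | single p k =>
    obtain ⟨i, j⟩ := p
    rw [linProd_single, map_zpow, thetaU_linUnit]
    exact zpow_mem (le_iSup (facUnits (n := n) K) i (U_mem_facUnits i j)) k

/-- The units of `𝒜_n` are products of units of the algebras `𝒜_1(i)`. -/
theorem iSup_facUnits (hn : 1 ≤ n) : ⨆ i, facUnits (n := n) K i = ⊤ := by
  refine eq_top_iff.2 fun w _ => ?_
  obtain ⟨c, m, α, rfl⟩ := (cSys_isBasis (K := K) (n := n)).exists_unit' w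
  rw [map_mul, thetaU_scalarUnit]
  refine mul_mem (mul_mem ?_ (linProd_mem_iSup m)) ?_
  -- Scalars lie in every factor; $n\geq1$ provides one.
  · exact le_iSup (facUnits (n := n) K) ⟨0, hn⟩ (scalarUnit_mem_facUnits _ c)
  · refine intVec_induction (P := fun α => (cSys K n).xpow α ∈ ⨆ i, facUnits (n := n) K i)
      ?_ ?_ ?_ ?_ α
    · rw [xpow_zero]; exact one_mem _
    · intro α β h h'; rw [xpow_add]; exact mul_mem h h'
    · intro α h; rw [xpow_neg]; exact inv_mem h
    · intro i
      rw [xpow_single, zpow_one]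
      exact le_iSup (facUnits (n := n) K) i (X_mem_facUnits i)

/-- Being a unit of the factor, rather than a unit lying in it, also controls inverses; these are
needed because $\partial_i=H_ix_i^{-1}$ and $H_i^{-1}$ are among the generators. -/
theorem fac_le_comap {g : CA K n →ₐ[K] CA K n} {i k : Fin n}
    (hX : Units.map (g : CA K n →* CA K n) ((cSys K n).X i) ∈ facUnits K k)
    (hH : Units.map (g : CA K n →* CA K n) ((cSys K n).U i 0) ∈ facUnits K k) :
    fac K i ≤ (fac K k).comap g := by
  refine Algebra.adjoin_le ?_
  have hX' := facUnits_inv_val_mem hX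
  have hH' := facUnits_inv_val_mem hH
  have hH0 := facUnits_val_mem hH
  rw [← map_inv] at hX' hH'
  rintro _ (rfl | rfl | rfl) <;> rw [SetLike.mem_coe, Subalgebra.mem_comap]
  · exact facUnits_val_mem hX
  · rw [toCA_jD, map_mul]
    refine mul_mem ?_ hX'
    have e : (((cSys K n).U i 0 : (CA K n)ˣ) : CA K n) = cH K i := by
      rw [(cSys K n).U_val]; simp
    rw [← e]
    exact hH0
  · rw [toCA_jHinv]
    exact hH'

theorem exists_perm_map_fac (g : CA K n ≃ₐ[K] CA K n) : ∃ π : Equiv.Perm (Fin n), ∀ i,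
    g (cH K i) ∈ fac K (π i) ∧ ∀ a ∈ fac K i, g a ∈ fac K (π i) := by
  obtain ⟨π, ε, m, c, w, h⟩ := (cSys_isBasis (K := K) (n := n)).exists_map_form g
  refine ⟨π, fun i => ?_⟩
  have hle : fac K i ≤ (fac K (π i)).comap (g : CA K n →ₐ[K] CA K n) := by
    apply fac_le_comap
    · have := (h i).2
      refine (show _ = _ from this) ▸ ?_
      rw [map_mul, thetaU_scalarUnit]
      exact mul_mem (mul_mem (scalarUnit_mem_facUnits _ _) (linProdAt_mem_facUnits _ _))
        (zpow_mem (X_mem_facUnits _) _)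
    · have e : Units.map (((g : CA K n →ₐ[K] CA K n)) : CA K n →* CA K n) ((cSys K n).U i 0) =
          scalarUnit K (CA K n) (Units.map (Int.castRingHom K : ℤ →* K) (ε i)) *
            (cSys K n).U (π i) (m i) := by
        ext
        have e0 : (((cSys K n).U i 0 : (CA K n)ˣ) : CA K n) = (cSys K n).H i := by
          rw [(cSys K n).U_val]; simp
        change g (((cSys K n).U i 0 : (CA K n)ˣ) : CA K n) = _
        rw [e0, (h i).1, Units.val_mul, (cSys K n).U_val]
        congr 1
        simp [scalarUnit]
      rw [e]
      exact mul_mem (scalarUnit_mem_facUnits _ _) (U_mem_facUnits _ _)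
  exact ⟨hle (cH_mem_fac i), fun a ha => hle ha⟩

/-- Automorphisms permute the subalgebras `𝒜_1(i)`. -/
theorem exists_perm (g : CA K n ≃ₐ[K] CA K n) : ∃ π : Equiv.Perm (Fin n), ∀ i,
    (∀ a ∈ fac K i, g a ∈ fac K (π i)) ∧ ∀ a ∈ fac K (π i), g⁻¹ a ∈ fac K i := by
  obtain ⟨π, h⟩ := exists_perm_map_fac g
  obtain ⟨π', h'⟩ := exists_perm_map_fac g⁻¹
  refine ⟨π, fun i => ⟨(h i).2, fun a ha => ?_⟩⟩
  -- The permutations found for $g$ and $g^{-1}$ are inverse to each other: $H_i=g^{-1}(g(H_i))$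
  -- lies in the factor with index $\pi'(\pi(i))$.
  have h1 := (h' (π i)).2 _ (h i).1
  have h2 : g⁻¹ (g (cH K i)) = cH K i := g.symm_apply_apply _
  rw [h2] at h1
  rw [eq_of_cH_mem_fac h1]
  have := (h' (π i)).2 a ha
  rwa [← eq_of_cH_mem_fac h1] at this ⊢

/-- The product of the groups $\mathcal{G}_1(i)$ is the stabilizer of all the factors. An
automorphism preserving each factor restricts to a tuple, and it is determined by that tuple. -/
theorem mem_range_facHom_iff (g : CA K n ≃ₐ[K] CA K n) :
    g ∈ (facHom K n).range ↔ ∀ i, (∀ a ∈ fac K i, g a ∈ fac K i) ∧ ∀ a ∈ fac K i, g⁻¹ a ∈ fac K i := by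
  constructor
  · rintro ⟨τ, rfl⟩ i
    refine ⟨fun a ha => ?_, fun a ha => ?_⟩
    · rw [facHom_apply τ i ⟨a, ha⟩]; exact Subtype.property _
    · rw [← map_inv, facHom_apply τ⁻¹ i ⟨a, ha⟩]; exact Subtype.property _
  · intro h
    refine ⟨fun i => AlgEquiv.ofAlgHom
      (((g : CA K n →ₐ[K] CA K n).comp (fac K i).val).codRestrict (fac K i) fun a => (h i).1 a a.2)
      (((g⁻¹ : CA K n ≃ₐ[K] CA K n) : CA K n →ₐ[K] CA K n).comp (fac K i).val |>.codRestrict (fac K i)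
        fun a => (h i).2 a a.2) ?_ ?_, ?_⟩
    · ext a
      exact g.apply_symm_apply a
    · ext a
      exact g.symm_apply_apply a
    · refine equiv_ext_fac fun i a => ?_
      rw [facHom_apply]
      rfl

theorem permHom_mem_fac (s : Equiv.Perm (Fin n)) {i : Fin n} {a : CA K n} (ha : a ∈ fac K i) :
    permHom K n s a ∈ fac K (s i) := by
  have hle : fac K i ≤ (fac K (s i)).comap (permHom K n s : CA K n →ₐ[K] CA K n) := by
    apply fac_le_comap
    · have : Units.map ((permHom K n s : CA K n →ₐ[K] CA K n) : CA K n →* CA K n) ((cSys K n).X i) =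
          (cSys K n).X (s i) := by
        ext; exact permHom_cX s i
      rw [this]
      exact X_mem_facUnits _
    · have : Units.map ((permHom K n s : CA K n →ₐ[K] CA K n) : CA K n →* CA K n) ((cSys K n).U i 0) =
          (cSys K n).U (s i) 0 := by
        ext
        change permHom K n s (((cSys K n).U i 0 : (CA K n)ˣ) : CA K n) = _
        rw [(cSys K n).U_val, (cSys K n).U_val, map_add, map_intCast, cSys_H, permHom_cH, cSys_H]
      rw [this]
      exact U_mem_facUnits _ _
  exact hle ha

/-- Dividing an automorphism by the permutation it induces leaves one that stabilizes every factor.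
Permutations normalize this stabilizer, and a permutation inside it is trivial. -/
theorem isInternalSemidirect_top :
    IsInternalSemidirect ⊤ (permHom K n).range (facHom K n).range := by
  refine ⟨eq_top_iff.2 fun g _ => ?_, Subgroup.disjoint_def.2 ?_, ?_⟩
  · obtain ⟨π, h⟩ := exists_perm g
    have h1 : (permHom K n π)⁻¹ * g ∈ (facHom K n).range := by
      rw [mem_range_facHom_iff]
      refine fun i => ⟨fun a ha => ?_, fun a ha => ?_⟩
      · rw [AlgEquiv.mul_apply, ← map_inv]
        have := permHom_mem_fac π⁻¹ ((h i).1 a ha)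
        simpa using this
      · rw [mul_inv_rev, inv_inv, AlgEquiv.mul_apply]
        exact (h i).2 _ (permHom_mem_fac π ha)
    have : g = permHom K n π * ((permHom K n π)⁻¹ * g) := by group
    rw [this]
    exact Subgroup.mul_mem_sup ⟨π, rfl⟩ h1
  · rintro _ ⟨s, rfl⟩ hs
    rw [mem_range_facHom_iff] at hs
    have : s = 1 := by
      ext i
      have := (hs i).1 _ (cX_mem_fac i)
      rw [permHom_cX] at this
      rw [eq_of_cX_mem_fac this]
      rfl
    rw [this, map_one]
  · rintro _ ⟨s, rfl⟩ g hg
    rw [mem_range_facHom_iff] at hg ⊢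
    have key : ∀ g : CA K n ≃ₐ[K] CA K n, (∀ i, ∀ a ∈ fac K i, g a ∈ fac K i) →
        ∀ i, ∀ a ∈ fac K i, (permHom K n s * g * (permHom K n s)⁻¹) a ∈ fac K i := by
      intro g hg i a ha
      rw [AlgEquiv.mul_apply, AlgEquiv.mul_apply, ← map_inv]
      have := permHom_mem_fac s (hg _ _ (permHom_mem_fac s⁻¹ ha))
      simpa using this
    refine fun i => ⟨key g (fun i => (hg i).1) i, ?_⟩
    have := key g⁻¹ (fun i => (hg i).2) i
    simpa [mul_assoc] using this

end

end Jacobian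

/-! ### Units in one variable: shifts, the twist, leading terms -/

namespace LinLoc

noncomputable section

variable {K : Type*} [Field K] [CharZero K]

/-- Units of the localization in one variable are generated by the scalars and the `H + j`. -/
theorem units_hom_ext {M : Type*} [Monoid M] {f g : (LinLoc K (Fin 1))ˣ →* M}
    (hc : ∀ c : Kˣ, f (scalarUnit K _ c) = g (scalarUnit K _ c))
    (hU : ∀ j, f (linUnit K 0 j) = g (linUnit K 0 j)) : f = g := by
  have hU' : ∀ j (k : ℤ), f (linUnit K 0 j ^ k) = g (linUnit K 0 j ^ k) := by
    intro j k
    have h : f.comp (zpowersHom _ (linUnit K 0 j)) = g.comp (zpowersHom _ (linUnit K 0 j)) := by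
      ext
      simpa using hU j
    have := DFunLike.congr_fun h (Multiplicative.ofAdd k)
    simpa using this
  ext u
  obtain ⟨c, m, rfl⟩ := exists_linProd u
  rw [map_mul, map_mul, hc]
  congr 1
  induction m using Finsupp.induction_linear with
  | zero => simp
  | add w w' h h' => rw [ofAdd_add, map_mul, map_mul, map_mul, h, h']
  | single p k =>
    obtain ⟨i, j⟩ := p
    rw [Subsingleton.elim i 0, linProd_single, hU']

theorem units_subgroup_eq_top {A : Subgroup (LinLoc K (Fin 1))ˣ} (hc : ∀ c : Kˣ, scalarUnit K _ c ∈ A)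
    (hU : ∀ j, linUnit K 0 j ∈ A) : A = ⊤ := by
  refine eq_top_iff.2 fun u _ => ?_
  obtain ⟨c, m, rfl⟩ := exists_linProd u
  refine mul_mem (hc c) ?_
  clear * - hU
  induction m using Finsupp.induction_linear with
  | zero => simp
  | add w w' h h' => rw [ofAdd_add, map_mul]; exact mul_mem h h'
  | single p k =>
    obtain ⟨i, j⟩ := p
    rw [Subsingleton.elim i 0, linProd_single]
    exact zpow_mem (hU j) k

/-- The shift `H ↦ H - j` on units in one variable. -/
def sh (j : ℤ) : (LinLoc K (Fin 1))ˣ →* (LinLoc K (Fin 1))ˣ :=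
  Units.map ((shift K fun _ => j : LinLoc K (Fin 1) →ₐ[K] LinLoc K (Fin 1)) :
    LinLoc K (Fin 1) →* LinLoc K (Fin 1))

@[simp]
theorem sh_val (j : ℤ) (l : (LinLoc K (Fin 1))ˣ) :
    (sh j l : LinLoc K (Fin 1)) = shift K (fun _ => j) (l : LinLoc K (Fin 1)) := rfl

@[simp]
theorem sh_scalarUnit (j : ℤ) (c : Kˣ) : sh j (scalarUnit K (LinLoc K (Fin 1)) c) = scalarUnit K _ c :=
  map_shift_scalarUnit _ c

@[simp]
theorem sh_linUnit (j k : ℤ) : sh j (linUnit K 0 k) = linUnit K 0 (k - j) := by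
  ext
  rw [sh_val, linUnit_val, linUnit_val, map_add, shift_gen, map_intCast]
  push_cast; ring

theorem sh_sh (j k : ℤ) (l : (LinLoc K (Fin 1))ˣ) : sh j (sh k l) = sh (j + k) l := by
  ext
  rw [sh_val, sh_val, sh_val, shift_shift]
  rfl

/-- The automorphism `H ↦ -H`. -/
def neg : LinLoc K (Fin 1) →ₐ[K] LinLoc K (Fin 1) :=
  lift (fun i => -gen K i) fun i j => by
    have := (isUnit_gen_add K i (-j)).neg
    convert this using 1
    push_cast; ring

@[simp]
theorem neg_gen (i : Fin 1) : neg (gen K i) = -gen K i := lift_gen _ _ _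

/-- The map on the units `u` induced by conjugation of `x ↦ u x` with `x ↦ x⁻¹`, `H ↦ -H`. -/
def twist : (LinLoc K (Fin 1))ˣ →* (LinLoc K (Fin 1))ˣ :=
  invMonoidHom.comp ((sh 1).comp (Units.map ((neg : LinLoc K (Fin 1) →ₐ[K] _) : LinLoc K (Fin 1) →* LinLoc K (Fin 1))))

theorem twist_scalarUnit (c : Kˣ) : twist (scalarUnit K (LinLoc K (Fin 1)) c) = scalarUnit K _ c⁻¹ := by
  have : Units.map ((neg : LinLoc K (Fin 1) →ₐ[K] _) : LinLoc K (Fin 1) →* LinLoc K (Fin 1)) (scalarUnit K _ c) =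
      scalarUnit K _ c := by
    ext
    exact neg.commutes (c : K)
  rw [twist, MonoidHom.comp_apply, MonoidHom.comp_apply, this, sh_scalarUnit, invMonoidHom_apply,
    map_inv]

theorem twist_linUnit (j : ℤ) :
    twist (linUnit K 0 j) = (scalarUnit K (LinLoc K (Fin 1)) (-1) * linUnit K 0 (-1 - j))⁻¹ := by
  rw [twist, MonoidHom.comp_apply, MonoidHom.comp_apply, invMonoidHom_apply]
  congr 1
  ext
  simp only [sh_val, Units.coe_map, MonoidHom.coe_coe, linUnit_val, map_add, map_intCast, neg_gen,
    map_neg, shift_gen, Units.val_mul, scalarUnit, Units.val_neg, Units.val_one, map_one]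
  push_cast
  ring

/-- The products of the `(H + j) / (H + j + 1)`. -/
def ratioGroup (K : Type*) [Field K] : Subgroup (LinLoc K (Fin 1))ˣ :=
  Subgroup.closure (Set.range fun j : ℤ => linUnit K 0 j / linUnit K 0 (j + 1))

/-- The products of the `(H + j) (H + j + 2) / (H + j + 1) ^ 2`. -/
def ratioGroup₂ (K : Type*) [Field K] : Subgroup (LinLoc K (Fin 1))ˣ :=
  Subgroup.closure (Set.range fun j : ℤ =>
    linUnit K 0 j * linUnit K 0 (j + 2) / linUnit K 0 (j + 1) ^ 2)

/-- The unit `-H ^ 2`. -/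
def negSq (K : Type*) [Field K] : (LinLoc K (Fin 1))ˣ := scalarUnit K _ (-1) * linUnit K 0 0 ^ 2

/-- The group `K*² · ⟨(H + j) / (H + j + 1)⟩ · ⟨-H²⟩`. -/
def commGroup (K : Type*) [Field K] : Subgroup (LinLoc K (Fin 1))ˣ :=
  ((scalarUnit K (LinLoc K (Fin 1))).comp (powMonoidHom 2)).range ⊔ ratioGroup K ⊔
    Subgroup.zpowers (negSq K)

theorem paramHom_bijective : Function.Bijective
    ((scalarUnit K (LinLoc K (Fin 1))).coprod (linProdAt (K := K) (0 : Fin 1))) := by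
  constructor
  · rintro ⟨c, w⟩ ⟨c', w'⟩ h
    obtain ⟨rfl, h2⟩ := linProd_inj (K := K) (ι := Fin 1)
      (m := w.toAdd.mapDomain (Prod.mk 0)) (m' := w'.toAdd.mapDomain (Prod.mk 0)) h
    have := Finsupp.mapDomain_injective (Prod.mk_right_injective (0 : Fin 1)) h2
    exact Prod.ext rfl this
  · intro u
    obtain ⟨c, m, rfl⟩ := exists_linProd u
    obtain ⟨w, hw⟩ := exists_linProdAt (K := K) (0 : Fin 1) (m := m)
      fun k _ hk => absurd (Subsingleton.elim k 0) hk
    exact ⟨(c, Multiplicative.ofAdd w), by rw [hw]; rfl⟩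

/-- The description of the units in one variable. -/
def paramEquiv (K : Type*) [Field K] [CharZero K] :
    Kˣ × Multiplicative (ℤ →₀ ℤ) ≃* (LinLoc K (Fin 1))ˣ :=
  MulEquiv.ofBijective _ (paramHom_bijective (K := K))

@[simp]
theorem paramEquiv_scalar (c : Kˣ) : paramEquiv K (c, 1) = scalarUnit K _ c := by
  simp [paramEquiv]

@[simp]
theorem paramEquiv_single (j : ℤ) :
    paramEquiv K (1, Multiplicative.ofAdd (Finsupp.single j 1)) = linUnit K 0 j := by
  simp [paramEquiv]

/-- The leading coefficient and the degree of a unit. -/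
def lead (K : Type*) [Field K] [CharZero K] : (LinLoc K (Fin 1))ˣ →* Kˣ × Multiplicative ℤ :=
  (MonoidHom.prodMap (MonoidHom.id Kˣ)
    (AddMonoidHom.toMultiplicative (Finsupp.liftAddHom fun _ : ℤ => AddMonoidHom.id ℤ))).comp
    (paramEquiv K).symm.toMonoidHom

@[simp]
theorem lead_scalarUnit (c : Kˣ) : lead K (scalarUnit K _ c) = (c, 1) := by
  have := (paramEquiv K).symm_apply_apply (c, 1)
  rw [paramEquiv_scalar] at this
  simp [lead, this]

@[simp]
theorem lead_linUnit (j : ℤ) : lead K (linUnit K 0 j) = (1, Multiplicative.ofAdd 1) := by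
  have := (paramEquiv K).symm_apply_apply (1, Multiplicative.ofAdd (Finsupp.single j 1))
  rw [paramEquiv_single] at this
  simp [lead, this]

theorem lead_sh (j : ℤ) (l : (LinLoc K (Fin 1))ˣ) : lead K (sh j l) = lead K l := by
  have : (lead K).comp (sh j) = lead K := units_hom_ext (by simp) (by simp)
  exact DFunLike.congr_fun this l

/-- The subgroup `K*² ⟨-H²⟩` of `K* × ⟨H⟩`. -/
def leadGroup (K : Type*) [Field K] : Subgroup (Kˣ × Multiplicative ℤ) :=
  (powMonoidHom 2 : Kˣ →* Kˣ).range.prod ⊥ ⊔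
    Subgroup.zpowers ((-1 : Kˣ), Multiplicative.ofAdd (2 : ℤ))

/-- On generators: the twist inverts a scalar, changing it by a square, and it sends $H+j$ to
$(-(H-1-j))^{-1}$, which changes the leading data by the class of $-H^2$. -/
theorem mk_lead_twist (l : (LinLoc K (Fin 1))ˣ) :
    QuotientGroup.mk' (leadGroup K) (lead K (twist l)) = QuotientGroup.mk' (leadGroup K) (lead K l) := by
  have : ((QuotientGroup.mk' (leadGroup K)).comp (lead K)).comp twist =
      (QuotientGroup.mk' (leadGroup K)).comp (lead K) := by
    refine units_hom_ext (fun c => ?_) fun j => ?_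
    · simp only [MonoidHom.comp_apply, twist_scalarUnit, lead_scalarUnit]
      refine (QuotientGroup.eq (s := leadGroup K)).2 ?_
      refine (le_sup_left : _ ≤ leadGroup K) ⟨⟨c, ?_⟩, ?_⟩
      · simp [sq]
      · simp
    · simp only [MonoidHom.comp_apply, twist_linUnit, lead_linUnit, map_mul, map_inv,
        lead_scalarUnit]
      refine (QuotientGroup.eq (s := leadGroup K)).2 ?_
      refine (le_sup_right : _ ≤ leadGroup K) ⟨1, ?_⟩
      ext <;> simp
  exact DFunLike.congr_fun this l

/-- Modulo the ratios $(H+j)/(H+j+1)$ every $H+j$ equals $H$, so a unit reduces to its leading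
coefficient times a power of $H$. -/
theorem div_linUnit_mem (l : (LinLoc K (Fin 1))ˣ) :
    l / (scalarUnit K _ (lead K l).1 * linUnit K 0 0 ^ (lead K l).2.toAdd) ∈ ratioGroup K := by
  have : (QuotientGroup.mk' (ratioGroup K)) = (QuotientGroup.mk' (ratioGroup K)).comp
      (((scalarUnit K (LinLoc K (Fin 1))).coprod (zpowersHom _ (linUnit K 0 0))).comp (lead K)) := by
    have hstep : ∀ j : ℤ, QuotientGroup.mk' (ratioGroup K) (linUnit K 0 (j + 1)) =
        QuotientGroup.mk' (ratioGroup K) (linUnit K 0 j) := fun j => by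
      refine (QuotientGroup.eq (s := ratioGroup K)).2 (Subgroup.subset_closure ⟨j, ?_⟩)
      simp only [div_eq_mul_inv, mul_comm]
    refine units_hom_ext (fun c => ?_) fun j => ?_
    · simp
    · have hj : QuotientGroup.mk' (ratioGroup K) (linUnit K 0 j) =
          QuotientGroup.mk' (ratioGroup K) (linUnit K 0 0) := by
        induction j using Int.induction_on with
        | zero => rfl
        | succ i ih => rw [hstep, ih]
        | pred i ih => rw [← ih, ← hstep (-i - 1)]; simp
      rw [hj]
      simp
  have h := DFunLike.congr_fun this l
  have h2 := (QuotientGroup.eq (s := ratioGroup K)).1 h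
  have h3 := inv_mem h2
  rw [mul_inv_rev, inv_inv, mul_comm, ← div_eq_mul_inv] at h3
  exact h3

theorem mem_commGroup_of_lead {l : (LinLoc K (Fin 1))ˣ} (h : lead K l ∈ leadGroup K) :
    l ∈ commGroup K := by
  have h1 : l = l / (scalarUnit K _ (lead K l).1 * linUnit K 0 0 ^ (lead K l).2.toAdd) *
      (scalarUnit K _ (lead K l).1 * linUnit K 0 0 ^ (lead K l).2.toAdd) := by simp
  rw [h1]
  refine mul_mem ((le_sup_left.trans' le_sup_right : ratioGroup K ≤ commGroup K) (div_linUnit_mem l)) ?_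
  obtain ⟨a, ⟨⟨d, hd⟩, ha2⟩, b, ⟨k, rfl⟩, hab⟩ := Subgroup.mem_sup.1 h
  have ha2 : a.2 = 1 := ha2
  have e1 : (lead K l).1 = d ^ 2 * (-1) ^ k := by
    rw [← hab, Prod.fst_mul, ← hd]; simp
  have e2 : (lead K l).2.toAdd = 2 * k := by
    rw [← hab, Prod.snd_mul, ha2]; simp [mul_comm]
  have e : scalarUnit K (LinLoc K (Fin 1)) (lead K l).1 * linUnit K 0 0 ^ (lead K l).2.toAdd =
      scalarUnit K _ (d ^ 2) * negSq K ^ k := by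
    rw [e1, e2, negSq, mul_zpow, map_mul, map_zpow, mul_assoc, zpow_mul]
    rfl
  rw [e]
  exact mul_mem ((le_sup_left.trans' le_sup_left : _ ≤ commGroup K) ⟨d, rfl⟩)
    ((le_sup_right : _ ≤ commGroup K) ⟨k, rfl⟩)

/-- Second differences of units lie in `ratioGroup₂`. -/
theorem sh_div_mem (k : ℤ) (l : (LinLoc K (Fin 1))ˣ) :
    (l / sh 1 l) / sh k (l / sh 1 l) ∈ ratioGroup₂ K := by
  have h1 : ∀ l : (LinLoc K (Fin 1))ˣ, (l / sh 1 l) / sh 1 (l / sh 1 l) ∈ ratioGroup₂ K := by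
    intro l
    -- The multiplicative difference operator; the claim for $k=1$ is about its square.
    let D : (LinLoc K (Fin 1))ˣ →* (LinLoc K (Fin 1))ˣ := MonoidHom.id _ / sh 1
    have hD : (ratioGroup₂ K).comap (D.comp D) = ⊤ := by
      refine units_subgroup_eq_top (fun c => ?_) fun j => ?_
      · rw [Subgroup.mem_comap]
        have : D (scalarUnit K _ c) = 1 := by simp [D]
        rw [MonoidHom.comp_apply, this, map_one]
        exact one_mem _
      · rw [Subgroup.mem_comap]
        -- The second difference of $H+j$ is $(H+j)(H+j-2)/(H+j-1)^2$, the generator with index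
        -- $j-2$.
        refine Subgroup.subset_closure ⟨j - 2, ?_⟩
        simp only [D, MonoidHom.comp_apply, MonoidHom.div_apply, MonoidHom.id_apply, sh_linUnit, map_div]
        rw [show j - 2 + 2 = j by ring, show j - 2 + 1 = j - 1 by ring,
          show j - 1 - 1 = j - 2 by ring]
        simp only [div_eq_mul_inv, mul_inv_rev, inv_inv, sq]
        exact Units.ext (by push_cast; ring)
    have : l ∈ (ratioGroup₂ K).comap (D.comp D) := hD ▸ Subgroup.mem_top l
    exact this
  -- Telescoping: passing from $k$ to $k+1$ contributes one more second difference, that of the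
  -- shifted unit.
  have hstep : ∀ (k : ℤ), (l / sh 1 l) / sh (k + 1) (l / sh 1 l) =
      (l / sh 1 l) / sh k (l / sh 1 l) *
        ((sh k l / sh 1 (sh k l)) / sh 1 (sh k l / sh 1 (sh k l))) := by
    intro k
    have : sh (k + 1) (l / sh 1 l) = sh 1 (sh k l / sh 1 (sh k l)) := by
      rw [map_div, map_div, sh_sh, sh_sh, sh_sh]
      congr 3 <;> ring
    rw [this]
    have h2 : sh k (l / sh 1 l) = sh k l / sh 1 (sh k l) := by
      rw [map_div, sh_sh, sh_sh, add_comm]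
    rw [h2, div_mul_div_cancel]
  induction k using Int.induction_on with
  | zero =>
    have : ∀ l : (LinLoc K (Fin 1))ˣ, sh 0 l = l := fun l => by
      exact Units.ext (shift_zero (l : LinLoc K (Fin 1)))
    rw [this, div_self']
    exact one_mem _
  | succ i ih => rw [hstep]; exact mul_mem ih (h1 _)
  | pred i ih =>
    have := hstep (-i - 1)
    rw [sub_add_cancel] at this
    rw [eq_div_of_mul_eq' this.symm]
    exact div_mem ih (h1 _)

end

end LinLoc

/-! ### The automorphisms $\zeta$, $s_j$, $\sigma_u$ and the structure of $\mathcal{G}_1$ -/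

namespace ShiftSystem

noncomputable section

open LinLoc

variable {K R : Type*} [Field K] [CharZero K] [Ring R] [Algebra K R]

section Systems

variable (S : ShiftSystem R (Fin 1))

theorem X_mul_H_zero : (S.X 0 : R) * S.H 0 = (S.H 0 - 1) * S.X 0 := by simpa using S.X_mul_H 0 0

theorem X_inv_mul_H : ((S.X 0)⁻¹ : Rˣ) * S.H 0 = (S.H 0 + 1) * ((S.X 0)⁻¹ : Rˣ) := by
  rw [Units.eq_mul_inv_iff_mul_eq, mul_assoc, Units.inv_mul_eq_iff_eq_mul, mul_add, X_mul_H_zero]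
  noncomm_ring

/-- A system with one index. -/
def ofOne (X : Rˣ) (H : R) (U : ℤ → Rˣ) (hU : ∀ j, (U j : R) = H + (j : R))
    (h : (X : R) * H = (H - 1) * X) : ShiftSystem R (Fin 1) where
  X _ := X
  H _ := H
  U _ := U
  U_val _ := hU
  comm_X _ _ := rfl
  comm_H _ _ := rfl
  X_mul_H i j := by rw [if_pos (Subsingleton.elim i j), h]

/-- The system `x⁻¹`, `-H`. -/
def zetaSys : ShiftSystem R (Fin 1) :=
  ofOne (S.X 0)⁻¹ (-S.H 0) (fun j => -S.U 0 (-j))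
    (fun j => by rw [Units.val_neg, S.U_val]; push_cast; abel)
    (by rw [mul_neg, X_inv_mul_H]; noncomm_ring)

/-- The system `x`, `H - j`. -/
def shiftSys (j : ℤ) : ShiftSystem R (Fin 1) :=
  ofOne (S.X 0) (S.H 0 - (j : R)) (fun k => S.U 0 (k - j))
    (fun k => by rw [S.U_val]; push_cast; abel)
    (by
      rw [mul_sub, X_mul_H_zero, (Int.cast_commute j (S.X 0 : R)).symm.eq]
      noncomm_ring)

/-- The system `u x`, `H`. -/
def rhoSys (l : (LinLoc K (Fin 1))ˣ) : ShiftSystem R (Fin 1) :=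
  ofOne (S.thetaU l * S.X 0) (S.H 0) (fun k => S.U 0 k) (fun k => S.U_val 0 k)
    (by
      have : S.theta (l : LinLoc K (Fin 1)) * (S.H 0 - 1) = (S.H 0 - 1) * S.theta (l : LinLoc K (Fin 1)) := by
        have e : S.H 0 - 1 = S.theta (gen K 0 - 1) := by simp
        rw [e, ← map_mul, ← map_mul, mul_comm]
      rw [Units.val_mul, mul_assoc, X_mul_H_zero, ← mul_assoc, thetaU_val, this, mul_assoc])

end Systems

variable {S : ShiftSystem R (Fin 1)}

namespace IsBasis

theorem equiv_ext_one (h : S.IsBasis K) {f g : R ≃ₐ[K] R} (hX : f (S.X 0) = g (S.X 0))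
    (hH : f (S.H 0) = g (S.H 0)) : f = g :=
  h.equiv_ext (fun i => by rwa [Subsingleton.elim i 0]) fun i => by rwa [Subsingleton.elim i 0]

theorem hom_ext_one (h : S.IsBasis K) {f g : R →ₐ[K] R} (hX : f (S.X 0) = g (S.X 0))
    (hH : f (S.H 0) = g (S.H 0)) : f = g :=
  h.hom_ext (fun i => by rwa [Subsingleton.elim i 0]) fun i => by rwa [Subsingleton.elim i 0]

theorem map_inv_val (f : R →ₐ[K] R) (u v : Rˣ) (e : f u = v) :
    f (u⁻¹ : Rˣ) = (v⁻¹ : Rˣ) := by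
  have : Units.map (f : R →* R) u = v := Units.ext e
  rw [← this, ← map_inv]
  rfl

theorem lift_zeta_X_inv (h : S.IsBasis K) :
    h.lift S.zetaSys ((S.X 0)⁻¹ : Rˣ) = S.X 0 := by
  have := map_inv_val (h.lift S.zetaSys) (S.X 0) (S.X 0)⁻¹ (h.lift_X S.zetaSys 0)
  rwa [inv_inv] at this

/-- The automorphism `x ↦ x⁻¹`, `H ↦ -H`. -/
def zeta (h : S.IsBasis K) : R ≃ₐ[K] R :=
  have hh : (h.lift S.zetaSys).comp (h.lift S.zetaSys) = AlgHom.id K R := by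
    refine h.hom_ext_one ?_ ?_
    · rw [AlgHom.comp_apply, lift_X]
      exact h.lift_zeta_X_inv
    · rw [AlgHom.comp_apply, lift_H]
      change h.lift S.zetaSys (-S.H 0) = _
      rw [map_neg, lift_H]
      exact neg_neg _
  AlgEquiv.ofAlgHom (h.lift S.zetaSys) (h.lift S.zetaSys) hh hh

@[simp]
theorem zeta_X (h : S.IsBasis K) : h.zeta (S.X 0) = ((S.X 0)⁻¹ : Rˣ) := h.lift_X S.zetaSys 0

@[simp]
theorem zeta_X_inv (h : S.IsBasis K) : h.zeta ((S.X 0)⁻¹ : Rˣ) = S.X 0 := h.lift_zeta_X_inv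

@[simp]
theorem zeta_H (h : S.IsBasis K) : h.zeta (S.H 0) = -S.H 0 := h.lift_H S.zetaSys 0

theorem zeta_mul_self (h : S.IsBasis K) : h.zeta * h.zeta = 1 :=
  h.equiv_ext_one (by simp) (by simp)

/-- The automorphisms `x ↦ x`, `H ↦ H - j`. -/
def shiftAut (h : S.IsBasis K) : Multiplicative ℤ →* (R ≃ₐ[K] R) :=
  AlgEquiv.homOfEnd (fun j => h.lift (S.shiftSys j.toAdd))
    (h.hom_ext_one (h.lift_X (S.shiftSys 0) 0) ((h.lift_H (S.shiftSys 0) 0).trans (by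
      change S.H 0 - ((0 : ℤ) : R) = _
      simp)))
    (fun j k => h.hom_ext_one
      (by
        rw [AlgHom.comp_apply, lift_X, lift_X]
        exact (h.lift_X (S.shiftSys j.toAdd) 0).symm)
      (by
        rw [AlgHom.comp_apply, lift_H, lift_H]
        change S.H 0 - ((j.toAdd + k.toAdd : ℤ) : R) =
          h.lift (S.shiftSys j.toAdd) (S.H 0 - ((k.toAdd : ℤ) : R))
        rw [map_sub, lift_H, map_intCast]
        change _ = S.H 0 - ((j.toAdd : ℤ) : R) - _
        push_cast; abel))

@[simp]
theorem shiftAut_X (h : S.IsBasis K) (j : ℤ) : h.shiftAut (Multiplicative.ofAdd j) (S.X 0) = S.X 0 :=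
  h.lift_X (S.shiftSys j) 0

@[simp]
theorem shiftAut_H (h : S.IsBasis K) (j : ℤ) :
    h.shiftAut (Multiplicative.ofAdd j) (S.H 0) = S.H 0 - (j : R) :=
  h.lift_H (S.shiftSys j) 0

theorem lift_rho_theta (h : S.IsBasis K) (l : (LinLoc K (Fin 1))ˣ) (a : LinLoc K (Fin 1)) :
    h.lift (S.rhoSys l) (S.theta a) = S.theta a := by
  have : (h.lift (S.rhoSys l)).comp S.theta = S.theta := LinLoc.algHom_ext fun i => by
    rw [Subsingleton.elim i 0, AlgHom.comp_apply, theta_gen]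
    exact h.lift_H (S.rhoSys l) 0
  exact DFunLike.congr_fun this a

/-- The automorphisms `x ↦ u x`, `H ↦ H`. -/
def rho (h : S.IsBasis K) : (LinLoc K (Fin 1))ˣ →* (R ≃ₐ[K] R) :=
  AlgEquiv.homOfEnd (fun l => h.lift (S.rhoSys l))
    (h.hom_ext_one ((h.lift_X (S.rhoSys (1 : (LinLoc K (Fin 1))ˣ)) 0).trans (by
        change ((S.thetaU (1 : (LinLoc K (Fin 1))ˣ) * S.X 0 : Rˣ) : R) = _
        simp))
      (h.lift_H (S.rhoSys (1 : (LinLoc K (Fin 1))ˣ)) 0))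
    (fun l l' => h.hom_ext_one
      (by
        rw [AlgHom.comp_apply, lift_X, lift_X]
        change S.theta ((l * l' : (LinLoc K (Fin 1))ˣ) : LinLoc K (Fin 1)) * (S.X 0 : R) =
          h.lift (S.rhoSys l) (S.theta (l' : LinLoc K (Fin 1)) * S.X 0)
        rw [map_mul, lift_X, lift_rho_theta, Units.val_mul, mul_comm (l : LinLoc K (Fin 1)), map_mul,
          mul_assoc]
        rfl)
      (by
        rw [AlgHom.comp_apply, lift_H, lift_H]
        exact (h.lift_H (S.rhoSys l) 0).symm))

@[simp]
theorem rho_X (h : S.IsBasis K) (l : (LinLoc K (Fin 1))ˣ) :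
    h.rho l (S.X 0) = S.theta (l : LinLoc K (Fin 1)) * S.X 0 := h.lift_X (S.rhoSys l) 0

@[simp]
theorem rho_H (h : S.IsBasis K) (l : (LinLoc K (Fin 1))ˣ) : h.rho l (S.H 0) = S.H 0 :=
  h.lift_H (S.rhoSys l) 0

@[simp]
theorem shiftAut_theta (h : S.IsBasis K) (j : ℤ) (a : LinLoc K (Fin 1)) :
    h.shiftAut (Multiplicative.ofAdd j) (S.theta a) = S.theta (shift K (fun _ => j) a) := by
  have : ((h.shiftAut (Multiplicative.ofAdd j) : R ≃ₐ[K] R) : R →ₐ[K] R).comp S.theta =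
      S.theta.comp (shift K fun _ => j) := LinLoc.algHom_ext fun i => by
    rw [Subsingleton.elim i 0, AlgHom.comp_apply, AlgHom.comp_apply, theta_gen, shift_gen, map_sub,
      theta_gen, map_intCast]
    exact h.shiftAut_H j
  exact DFunLike.congr_fun this a

@[simp]
theorem zeta_theta (h : S.IsBasis K) (a : LinLoc K (Fin 1)) :
    h.zeta (S.theta a) = S.theta (LinLoc.neg a) := by
  have : ((h.zeta : R ≃ₐ[K] R) : R →ₐ[K] R).comp S.theta =
      S.theta.comp LinLoc.neg := LinLoc.algHom_ext fun i => by
    rw [Subsingleton.elim i 0, AlgHom.comp_apply, AlgHom.comp_apply, theta_gen, neg_gen, map_neg,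
      theta_gen]
    exact h.zeta_H
  exact DFunLike.congr_fun this a

theorem X_mul_theta (a : LinLoc K (Fin 1)) :
    (S.X 0 : R) * S.theta a = S.theta (shift K (fun _ => 1) a) * S.X 0 := by
  have := S.xpow_mul_theta (Pi.single 0 1) a
  rw [xpow_single, zpow_one] at this
  rw [this]
  congr 4
  ext i
  rw [Subsingleton.elim i 0, Pi.single_eq_same]

theorem shiftAut_mul_rho (h : S.IsBasis K) (j : ℤ) (l : (LinLoc K (Fin 1))ˣ) :
    h.shiftAut (Multiplicative.ofAdd j) * h.rho l =
      h.rho (sh j l) * h.shiftAut (Multiplicative.ofAdd j) :=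
  h.equiv_ext_one (by simp) (by simp)

theorem zeta_mul_shiftAut (h : S.IsBasis K) (j : ℤ) :
    h.zeta * h.shiftAut (Multiplicative.ofAdd j) = h.shiftAut (Multiplicative.ofAdd (-j)) * h.zeta :=
  h.equiv_ext_one
    (by
      have := map_inv_val (h.shiftAut (Multiplicative.ofAdd (-j)) : R →ₐ[K] R) (S.X 0) (S.X 0)
        (h.shiftAut_X (-j))
      simpa using this.symm)
    (by
      simp only [AlgEquiv.mul_apply, shiftAut_H, zeta_H, map_sub, map_neg, map_intCast]
      push_cast; abel)

/-- On $x$, the left side gives $l(-H)\,x^{-1}$, while $\sigma_v$ sends $x^{-1}$ to $x^{-1}v^{-1}$.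
Moving $x^{-1}$ to the right shifts $v$ by one; this is the origin of the shift in `twist`. -/
theorem zeta_mul_rho (h : S.IsBasis K) (l : (LinLoc K (Fin 1))ˣ) :
    h.zeta * h.rho l = h.rho (twist l) * h.zeta := by
  refine h.equiv_ext_one ?_ (by simp)
  have e := map_inv_val (h.rho (twist l) : R →ₐ[K] R) (S.X 0) (S.thetaU (twist l) * S.X 0)
    (h.rho_X (twist l))
  have e' : h.rho (twist l) ((S.X 0)⁻¹ : Rˣ) = _ := e
  rw [AlgEquiv.mul_apply, AlgEquiv.mul_apply, zeta_X, e', rho_X, map_mul, zeta_theta, zeta_X,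
    mul_inv_rev, Units.val_mul, thetaU_inv_val, Units.eq_inv_mul_iff_mul_eq, ← mul_assoc, X_mul_theta,
    mul_assoc, Units.mul_inv, mul_one]
  rw [twist, MonoidHom.comp_apply, MonoidHom.comp_apply, invMonoidHom_apply, inv_inv]
  rfl

theorem shiftAut_injective (h : S.IsBasis K) : Function.Injective h.shiftAut := by
  intro j k e
  have := DFunLike.congr_fun e (S.H 0)
  rw [← ofAdd_toAdd j, ← ofAdd_toAdd k, shiftAut_H, shiftAut_H, sub_right_inj] at this
  exact Multiplicative.toAdd.injective (h.intCast_inj this)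

theorem rho_injective (h : S.IsBasis K) : Function.Injective h.rho := by
  intro l l' e
  have := DFunLike.congr_fun e (S.X 0 : R)
  rw [rho_X, rho_X, Units.mul_left_inj] at this
  exact Units.ext (h.theta_injective this)

theorem H_ne_neg_H_add (h : S.IsBasis K) (j : ℤ) : S.H 0 ≠ -S.H 0 + (j : R) := by
  intro e
  have e' : S.theta (gen K 0) = S.theta (algebraMap K (LinLoc K (Fin 1)) (-1) * gen K 0 +
      algebraMap K _ (j : K)) := by
    simpa using e
  have := (gen_linear_inj (h.theta_injective e')).2
  have h2 : (2 : K) = 0 := by linear_combination -this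
  exact two_ne_zero h2

theorem orderOf_zeta (h : S.IsBasis K) : orderOf h.zeta = 2 := by
  refine orderOf_eq_prime (by rw [sq, zeta_mul_self]) fun e => ?_
  have := DFunLike.congr_fun e (S.H 0)
  rw [zeta_H] at this
  exact h.H_ne_neg_H_add 0 (by simpa using this.symm)

/-- The structure of automorphisms. -/
theorem exists_aut_form (h : S.IsBasis K) (σ : R ≃ₐ[K] R) :
    ∃ (a : ℤ) (j : ℤ) (l : (LinLoc K (Fin 1))ˣ),
      σ = h.zeta ^ a * (h.shiftAut (Multiplicative.ofAdd j) * h.rho l) := by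
  -- The shift of `l` by `m` compensates for the shift by `-m` that $s_{-m}$ applies to the
  -- coefficient.
  have key : ∀ (σ : R ≃ₐ[K] R) (m : ℤ) (l : (LinLoc K (Fin 1))ˣ), σ (S.H 0) = S.H 0 + (m : R) →
      σ (S.X 0) = S.theta (l : LinLoc K (Fin 1)) * S.X 0 →
      σ = h.shiftAut (Multiplicative.ofAdd (-m)) * h.rho (sh m l) := by
    intro σ m l hH hX
    rw [shiftAut_mul_rho, sh_sh]
    refine h.equiv_ext_one ?_ ?_
    · rw [hX]
      have : sh (-m + m) l = l := by
        rw [neg_add_cancel]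
        exact Units.ext (shift_zero (l : LinLoc K (Fin 1)))
      rw [this, AlgEquiv.mul_apply, shiftAut_X, rho_X]
    · rw [hH, AlgEquiv.mul_apply, shiftAut_H, map_sub, rho_H, map_intCast]
      push_cast; abel
  obtain ⟨π, ε, m, c, w, hσ⟩ := h.exists_map_form σ
  obtain ⟨hH, hX⟩ := hσ 0
  have hπ : π 0 = 0 := Subsingleton.elim _ _
  rw [hπ] at hH hX
  rcases Int.units_eq_one_or (ε 0) with hε | hε
  · rw [hε] at hH hX
    have hX' := congrArg Units.val hX
    rw [Units.val_one, zpow_one] at hX'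
    exact ⟨0, _, _, by rw [zpow_zero, one_mul]; exact key σ (m 0) _ (by simpa using hH) hX'⟩
  · rw [hε] at hH hX
    set l := scalarUnit K (LinLoc K (Fin 1)) (c 0) * linProdAt 0 (Multiplicative.ofAdd (w 0))
    have hX' : σ (S.X 0) = S.theta (l : LinLoc K (Fin 1)) * ((S.X 0)⁻¹ : Rˣ) := by
      have := congrArg Units.val hX
      rw [Units.val_neg, Units.val_one, zpow_neg_one] at this
      exact this
    -- If the sign is $-1$, composition with $\zeta$ restores the sign $+1$, and $\zeta$ is an
    -- involution.
    have e := key (h.zeta * σ) (-m 0) (Units.map ((LinLoc.neg : LinLoc K (Fin 1) →ₐ[K] _) :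
        LinLoc K (Fin 1) →* LinLoc K (Fin 1)) l)
      (by
        rw [AlgEquiv.mul_apply, hH]
        simp [add_comm])
      (by
        rw [AlgEquiv.mul_apply, hX', map_mul, zeta_theta, zeta_X_inv]
        rfl)
    have e' : σ = h.zeta * (h.zeta * σ) := by rw [← mul_assoc, zeta_mul_self, one_mul]
    rw [e] at e'
    exact ⟨1, _, _, by rw [zpow_one]; exact e'⟩

/-- Acting on $H$ by a translation is a property closed under the group operations. It separates
this subgroup from $\zeta$, which sends $H$ to $-H$. -/
theorem apply_H_of_mem (h : S.IsBasis K) {g : R ≃ₐ[K] R} (hg : g ∈ h.shiftAut.range ⊔ h.rho.range) :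
    ∃ j : ℤ, g (S.H 0) = S.H 0 + (j : R) := by
  let P : Subgroup (R ≃ₐ[K] R) :=
    { carrier := {g | ∃ j : ℤ, g (S.H 0) = S.H 0 + (j : R)}
      one_mem' := ⟨0, by simp⟩
      mul_mem' := by
        rintro g g' ⟨j, e⟩ ⟨j', e'⟩
        exact ⟨j + j', by rw [AlgEquiv.mul_apply, e', map_add, e, map_intCast]; push_cast; abel⟩
      inv_mem' := by
        rintro g ⟨j, e⟩
        refine ⟨-j, ?_⟩
        apply g.injective
        rw [map_add, e, map_intCast]
        change g (g.symm _) = _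
        rw [AlgEquiv.apply_symm_apply]
        push_cast; abel }
  have : h.shiftAut.range ⊔ h.rho.range ≤ P := by
    refine sup_le ?_ ?_
    · rintro _ ⟨j, rfl⟩
      refine ⟨-j.toAdd, ?_⟩
      have := h.shiftAut_H j.toAdd
      rw [ofAdd_toAdd] at this
      rw [this]; push_cast; abel
    · rintro _ ⟨l, rfl⟩
      exact ⟨0, by simp⟩
  exact this hg

theorem isInternalSemidirect_shiftAut_rho (h : S.IsBasis K) :
    IsInternalSemidirect (h.shiftAut.range ⊔ h.rho.range) h.shiftAut.range h.rho.range := by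
  refine ⟨rfl, Subgroup.disjoint_def.2 ?_, ?_⟩
  · rintro _ ⟨j, rfl⟩ ⟨l, e⟩
    have := DFunLike.congr_fun e (S.H 0)
    rw [rho_H, ← ofAdd_toAdd j, shiftAut_H, eq_comm, sub_eq_self] at this
    have hj : j.toAdd = 0 := h.intCast_inj (by simpa using this)
    rw [← ofAdd_toAdd j, hj, ofAdd_zero, map_one]
  · rintro _ ⟨j, rfl⟩ _ ⟨l, rfl⟩
    refine ⟨sh j.toAdd l, ?_⟩
    rw [eq_mul_inv_iff_mul_eq]
    exact (h.shiftAut_mul_rho j.toAdd l).symm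

theorem zeta_conj_mem (h : S.IsBasis K) {g : R ≃ₐ[K] R} (hg : g ∈ h.shiftAut.range ⊔ h.rho.range) :
    h.zeta * g * h.zeta⁻¹ ∈ h.shiftAut.range ⊔ h.rho.range := by
  obtain ⟨_, ⟨j, rfl⟩, _, ⟨l, rfl⟩, rfl⟩ := h.isInternalSemidirect_shiftAut_rho.exists_mul hg
  have e : h.zeta * (h.shiftAut j * h.rho l) * h.zeta⁻¹ =
      h.shiftAut (Multiplicative.ofAdd (-j.toAdd)) * h.rho (twist l) := by
    rw [mul_inv_eq_iff_eq_mul, ← mul_assoc, mul_assoc _ (h.rho (twist l)), ← zeta_mul_rho, ← mul_assoc,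
      ← zeta_mul_shiftAut, ofAdd_toAdd]
  rw [e]
  exact Subgroup.mul_mem_sup ⟨_, rfl⟩ ⟨_, rfl⟩

theorem zeta_zpow_cases (h : S.IsBasis K) (a : ℤ) : h.zeta ^ a = 1 ∨ h.zeta ^ a = h.zeta := by
  have h2 : h.zeta ^ (2 : ℤ) = 1 := by
    rw [zpow_ofNat, sq, zeta_mul_self]
  rcases Int.even_or_odd' a with ⟨k, rfl | rfl⟩
  · left; rw [zpow_mul, h2, one_zpow]
  · right; rw [zpow_add, zpow_mul, h2, one_zpow, one_mul, zpow_one]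

theorem isInternalSemidirect_zeta (h : S.IsBasis K) :
    IsInternalSemidirect ⊤ (Subgroup.zpowers h.zeta) (h.shiftAut.range ⊔ h.rho.range) := by
  refine ⟨eq_top_iff.2 fun σ _ => ?_, Subgroup.disjoint_def.2 ?_, ?_⟩
  · obtain ⟨a, j, l, rfl⟩ := h.exists_aut_form σ
    exact Subgroup.mul_mem_sup ⟨a, rfl⟩ (Subgroup.mul_mem_sup ⟨_, rfl⟩ ⟨_, rfl⟩)
  · rintro _ ⟨a, rfl⟩ hg
    rcases h.zeta_zpow_cases a with e | e
    · exact e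
    · exfalso
      obtain ⟨j, hj⟩ := h.apply_H_of_mem hg
      simp only [e, zeta_H] at hj
      refine h.H_ne_neg_H_add (-j) ?_
      push_cast
      rw [← sub_eq_add_neg, eq_sub_iff_add_eq]
      exact hj.symm
  · rintro _ ⟨a, rfl⟩ g hg
    rcases h.zeta_zpow_cases a with e | e
    · simpa only [e, one_mul, inv_one, mul_one] using hg
    · simpa only [e] using h.zeta_conj_mem hg

end IsBasis

end

end ShiftSystem

theorem IsInternalSemidirect.exists_lift_hom {G A B T : Type*} [Group G] [Group A] [Group B]
    [CommGroup T] {C : Subgroup G} {ι : A →* G} {κ : B →* G}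
    (h : IsInternalSemidirect C ι.range κ.range) (hι : Function.Injective ι)
    (hκ : Function.Injective κ) (fA : A →* T) (fB : B →* T)
    (hf : ∀ a b b', ι a * κ b * (ι a)⁻¹ = κ b' → fB b' = fB b) :
    ∃ f : C →* T, (∀ a, f ⟨ι a, h.left_le ⟨a, rfl⟩⟩ = fA a) ∧
      ∀ b, f ⟨κ b, h.right_le ⟨b, rfl⟩⟩ = fB b := by
  obtain ⟨f, h1, h2⟩ := h.exists_lift (fA.comp (MonoidHom.ofInjective hι).symm.toMonoidHom)
    (fB.comp (MonoidHom.ofInjective hκ).symm.toMonoidHom) (by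
      rintro ⟨_, a, rfl⟩ ⟨_, b, rfl⟩ ⟨_, b', rfl⟩ e
      have := hf a b b' e
      have e1 := (MonoidHom.ofInjective hκ).symm_apply_apply b
      have e2 := (MonoidHom.ofInjective hκ).symm_apply_apply b'
      simp only [MonoidHom.comp_apply, MulEquiv.coe_toMonoidHom]
      exact (congrArg fB e2).trans (this.trans (congrArg fB e1).symm))
  refine ⟨f, fun a => (h1 ⟨ι a, a, rfl⟩).trans ?_, fun b => (h2 ⟨κ b, b, rfl⟩).trans ?_⟩
  · exact congrArg fA ((MonoidHom.ofInjective hι).symm_apply_apply a)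
  · exact congrArg fB ((MonoidHom.ofInjective hκ).symm_apply_apply b)

/-- Only the kernel and surjectivity of the quotient map matter later. With an abstract target, the
same arguments serve the quotient itself and, over an algebraically closed field, the parity map. -/
theorem exists_ker_eq.{u} {G : Type u} [CommGroup G] (N : Subgroup G) :
    ∃ (Q : Type u) (_ : CommGroup Q) (q : G →* Q), q.ker = N ∧ Function.Surjective q :=
  ⟨G ⧸ N, inferInstance, QuotientGroup.mk' N, QuotientGroup.ker_mk' N, QuotientGroup.mk'_surjective N⟩

/-! ### The commutator subgroup and the abelianization of $\mathcal{G}_1$ -/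

namespace ShiftSystem

noncomputable section

open LinLoc

variable {K R : Type*} [Field K] [CharZero K] [Ring R] [Algebra K R] {S : ShiftSystem R (Fin 1)}

theorem calL_eq_base (S : ShiftSystem R (Fin 1)) : calL K (S.H 0) = S.base K := by
  rw [calL, base]
  congr 1
  ext a
  constructor
  · rintro (rfl | ⟨j, h1, h2⟩)
    · exact Or.inl ⟨0, rfl⟩
    · refine Or.inr ⟨(0, j), ?_⟩
      exact (Units.eq_inv_of_mul_eq_one_right (u := S.U 0 j) (by rw [S.U_val]; exact h1)).symm
  · rintro (⟨i, rfl⟩ | ⟨⟨i, j⟩, rfl⟩)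
    · exact Or.inl (by rw [Subsingleton.elim i 0]; rfl)
    · refine Or.inr ⟨j, ?_, ?_⟩ <;> rw [← S.U_val, Subsingleton.elim i 0]
      · exact Units.inv_mul _
      · exact Units.mul_inv _

theorem calL0_eq_map (S : ShiftSystem R (Fin 1)) :
    calL0 (S.H 0) = (ratioGroup K).map (S.thetaU : (LinLoc K (Fin 1))ˣ →* Rˣ) := by
  rw [calL0, ratioGroup, MonoidHom.map_closure]
  congr 1
  ext u
  have key : ∀ j : ℤ, (u : R) * (S.H 0 + (j : R) + 1) = S.H 0 + (j : R) ↔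
      S.thetaU (linUnit K 0 j / linUnit K 0 (j + 1)) = u := by
    intro j
    have : S.H 0 + (j : R) + 1 = S.U 0 (j + 1) := by rw [S.U_val]; push_cast; abel
    rw [this, ← S.U_val, ← Units.val_mul, Units.val_inj, map_div, thetaU_linUnit, thetaU_linUnit,
      div_eq_iff_eq_mul, eq_comm]
  simp [key]

theorem calL00_eq_map (S : ShiftSystem R (Fin 1)) :
    calL00 (S.H 0) = (ratioGroup₂ K).map (S.thetaU : (LinLoc K (Fin 1))ˣ →* Rˣ) := by
  rw [calL00, ratioGroup₂, MonoidHom.map_closure]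
  congr 1
  ext u
  have key : ∀ j : ℤ, (u : R) * (S.H 0 + (j : R) + 1) ^ 2 = (S.H 0 + (j : R)) * (S.H 0 + (j : R) + 2) ↔
      S.thetaU (linUnit K 0 j * linUnit K 0 (j + 2) / linUnit K 0 (j + 1) ^ 2) = u := by
    intro j
    have h1 : S.H 0 + (j : R) + 1 = S.U 0 (j + 1) := by rw [S.U_val]; push_cast; abel
    have h2 : S.H 0 + (j : R) + 2 = S.U 0 (j + 2) := by rw [S.U_val]; push_cast; abel
    rw [h1, h2, ← S.U_val, ← Units.val_mul, ← Units.val_pow_eq_pow_val, ← Units.val_mul, Units.val_inj,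
      map_div, map_mul, map_pow, thetaU_linUnit, thetaU_linUnit, thetaU_linUnit, div_eq_iff_eq_mul,
      eq_comm]
  simp [key]

theorem calLComm_eq_map (S : ShiftSystem R (Fin 1)) :
    calLComm K (S.H 0) = (commGroup K).map (S.thetaU : (LinLoc K (Fin 1))ˣ →* Rˣ) := by
  rw [calLComm, commGroup, Subgroup.map_sup, Subgroup.map_sup, calL0_eq_map (K := K)]
  congr 1
  · congr 1
    rw [MonoidHom.map_range]
    congr 1
    ext c
    simp [thetaU_scalarUnit]
  · rw [Subgroup.zpowers_eq_closure, MonoidHom.map_closure]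
    congr 1
    ext u
    have hn : ((S.thetaU (negSq K) : Rˣ) : R) = -S.H 0 ^ 2 := by
      rw [negSq, map_mul, map_pow, thetaU_scalarUnit, thetaU_linUnit, Units.val_mul,
        Units.val_pow_eq_pow_val, S.U_val]
      simp [scalarUnit]
    rw [Set.image_singleton, Set.mem_singleton_iff, ← Units.val_inj, hn]
    rfl

namespace IsBasis

theorem thetaU_injective (h : S.IsBasis K) :
    Function.Injective (S.thetaU : (LinLoc K (Fin 1))ˣ →* Rˣ) :=
  Units.map_injective h.theta_injective

/-- Both a unit and its inverse must have preimages in the localization; by injectivity of `theta`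
these are inverse to each other. -/
theorem calLUnits_eq_range (h : S.IsBasis K) :
    calLUnits K (S.H 0) = (S.thetaU : (LinLoc K (Fin 1))ˣ →* Rˣ).range := by
  ext u
  rw [calLUnits, calL_eq_base, ← theta_range, Submonoid.mem_units_iff]
  constructor
  · rintro ⟨⟨a, ha⟩, ⟨b, hb⟩⟩
    have hab : a * b = 1 := h.theta_injective (by
      rw [map_mul, map_one]
      exact (congrArg₂ _ ha hb).trans u.mul_inv)
    refine ⟨(IsUnit.of_mul_eq_one _ hab).unit, ?_⟩
    ext
    exact ha
  · rintro ⟨l, rfl⟩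
    exact ⟨⟨l, rfl⟩, ⟨((l⁻¹ : (LinLoc K (Fin 1))ˣ) : LinLoc K (Fin 1)), rfl⟩⟩

/-- The units of the localization as units of the algebra. -/
def unitsEquiv (h : S.IsBasis K) : (LinLoc K (Fin 1))ˣ ≃* calLUnits K (S.H 0) :=
  (MonoidHom.ofInjective h.thetaU_injective).trans (MulEquiv.subgroupCongr h.calLUnits_eq_range.symm)

theorem map_rho_calLComm (h : S.IsBasis K) :
    ((calLComm K (S.H 0)).subgroupOf (calLUnits K (S.H 0))).map
      (h.rho.comp h.unitsEquiv.symm.toMonoidHom) = (commGroup K).map h.rho := by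
  ext g
  constructor
  · rintro ⟨u, hu, rfl⟩
    obtain ⟨l, rfl⟩ := h.unitsEquiv.surjective u
    refine ⟨l, ?_, by simp⟩
    have hu' : S.thetaU l ∈ calLComm K (S.H 0) := hu
    rw [calLComm_eq_map] at hu'
    obtain ⟨l', hl', e⟩ := hu'
    rwa [← h.thetaU_injective e]
  · rintro ⟨l, hl, rfl⟩
    refine ⟨h.unitsEquiv l, ?_, by simp⟩
    change S.thetaU l ∈ calLComm K (S.H 0)
    rw [calLComm_eq_map]
    exact ⟨l, hl, rfl⟩

/-- The homomorphism from `ℤ/2` that gives the automorphism `x ↦ x⁻¹`, `H ↦ -H`. -/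
def zetaHom (h : S.IsBasis K) : Multiplicative (ZMod 2) →* (R ≃ₐ[K] R) :=
  AddMonoidHom.toMultiplicativeLeft (ZMod.lift 2 ⟨zmultiplesHom (Additive (R ≃ₐ[K] R)) (Additive.ofMul h.zeta),
    by
      rw [zmultiplesHom_apply, ← ofMul_zpow]
      have : h.zeta ^ ((2 : ℕ) : ℤ) = 1 := by rw [zpow_natCast, sq, zeta_mul_self]
      rw [this]; rfl⟩)

theorem zetaHom_ofAdd_intCast (h : S.IsBasis K) (a : ℤ) :
    h.zetaHom (Multiplicative.ofAdd (a : ZMod 2)) = h.zeta ^ a := by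
  change Additive.toMul (ZMod.lift 2 _ (a : ZMod 2)) = _
  rw [ZMod.lift_coe]
  rfl

theorem zetaHom_range (h : S.IsBasis K) : h.zetaHom.range = Subgroup.zpowers h.zeta := by
  ext g
  constructor
  · rintro ⟨a, rfl⟩
    obtain ⟨k, hk⟩ := ZMod.intCast_surjective a.toAdd
    rw [← ofAdd_toAdd a, ← hk, zetaHom_ofAdd_intCast]
    exact ⟨k, rfl⟩
  · rintro ⟨k, rfl⟩
    exact ⟨_, h.zetaHom_ofAdd_intCast k⟩

theorem zetaHom_injective (h : S.IsBasis K) : Function.Injective h.zetaHom := by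
  rw [injective_iff_map_eq_one]
  intro a ha
  obtain ⟨k, hk⟩ := ZMod.intCast_surjective a.toAdd
  rw [← ofAdd_toAdd a, ← hk, zetaHom_ofAdd_intCast, ← orderOf_dvd_iff_zpow_eq_one, orderOf_zeta] at ha
  rw [← ofAdd_toAdd a, ← hk, (ZMod.intCast_zmod_eq_zero_iff_dvd k 2).2 ha]
  rfl

section Abelianization

variable {Q : Type*} [CommGroup Q] {q : Kˣ × Multiplicative ℤ →* Q}

/-- Two successive extensions. On the $s_j$ and $\sigma_u$ it works because shifts preserve leading
data. Conjugation by $\zeta$ replaces $j$ by $-j$, invisible modulo $2$, and twists $u$, invisible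
modulo `leadGroup`. -/
theorem exists_abelianization_hom (h : S.IsBasis K) (hq : leadGroup K ≤ q.ker) :
    ∃ f : (R ≃ₐ[K] R) →* Multiplicative (ZMod 2) × Multiplicative (ZMod 2) × Q,
    (∀ a : ℤ, f (h.zeta ^ a) = (Multiplicative.ofAdd (a : ZMod 2), 1, 1)) ∧
    (∀ j : ℤ, f (h.shiftAut (Multiplicative.ofAdd j)) = (1, Multiplicative.ofAdd (j : ZMod 2), 1)) ∧
    ∀ l, f (h.rho l) = (1, 1, q (lead K l)) := by
  have hC := h.isInternalSemidirect_shiftAut_rho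
  obtain ⟨fC, hs, hr⟩ := hC.exists_lift_hom h.shiftAut_injective h.rho_injective 
    (T := Multiplicative (ZMod 2) × Multiplicative (ZMod 2) × Q)
    ((MonoidHom.inr _ _).comp ((MonoidHom.inl _ _).comp
      (AddMonoidHom.toMultiplicative (Int.castAddHom (ZMod 2)))))
    ((MonoidHom.inr _ _).comp ((MonoidHom.inr _ _).comp
      (q.comp (lead K))))
    (by
      intro j l l' e
      rw [mul_inv_eq_iff_eq_mul, ← ofAdd_toAdd j, shiftAut_mul_rho, mul_left_inj] at e
      rw [← h.rho_injective e]
      simp only [MonoidHom.comp_apply, lead_sh])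
  have hz := h.isInternalSemidirect_zeta
  rw [← zetaHom_range, ← Subgroup.range_subtype (h.shiftAut.range ⊔ h.rho.range)] at hz
  obtain ⟨f, h1, h2⟩ := hz.exists_lift_hom h.zetaHom_injective (Subgroup.subtype_injective _)
    (MonoidHom.inl _ _) fC (by
      intro a b b' e
      obtain ⟨k, hk⟩ := ZMod.intCast_surjective a.toAdd
      rw [← ofAdd_toAdd a, ← hk, zetaHom_ofAdd_intCast] at e
      rcases h.zeta_zpow_cases k with e1 | e1
      · rw [e1, one_mul, inv_one, mul_one] at e
        rw [Subgroup.subtype_injective _ e]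
      · rw [e1] at e
        obtain ⟨b, hb⟩ := b
        obtain ⟨_, ⟨j, rfl⟩, _, ⟨l, rfl⟩, rfl⟩ := hC.exists_mul hb
        have e2 : h.zeta * (h.shiftAut j * h.rho l) * h.zeta⁻¹ =
            h.shiftAut (Multiplicative.ofAdd (-j.toAdd)) * h.rho (twist l) := by
          rw [mul_inv_eq_iff_eq_mul, ← mul_assoc, mul_assoc _ (h.rho (twist l)), ← zeta_mul_rho,
            ← mul_assoc, ← zeta_mul_shiftAut, ofAdd_toAdd]
        have e3 : b' = ⟨h.shiftAut (Multiplicative.ofAdd (-j.toAdd)), hC.left_le ⟨_, rfl⟩⟩ *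
            ⟨h.rho (twist l), hC.right_le ⟨_, rfl⟩⟩ := Subtype.ext (e.symm.trans e2)
        have e4 : (⟨h.shiftAut j * h.rho l, hb⟩ : (h.shiftAut.range ⊔ h.rho.range : Subgroup _)) =
            ⟨h.shiftAut j, hC.left_le ⟨_, rfl⟩⟩ * ⟨h.rho l, hC.right_le ⟨_, rfl⟩⟩ := rfl
        rw [e3, e4, map_mul, map_mul, hs, hr, hs, hr]
        refine Prod.ext rfl (Prod.ext ?_ ?_)
        · change Multiplicative.ofAdd ((-j.toAdd : ℤ) : ZMod 2) * 1 =
            Multiplicative.ofAdd ((j.toAdd : ℤ) : ZMod 2) * 1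
          rw [Int.cast_neg, ZMod.neg_eq_self_mod_two]
        · change 1 * q (lead K (twist l)) =
            1 * q (lead K l)
          have := hq ((QuotientGroup.eq (s := leadGroup K)).1 (mk_lead_twist l))
          rw [MonoidHom.mem_ker, map_mul, map_inv, inv_mul_eq_one] at this
          rw [this])
  refine ⟨f.comp Subgroup.topEquiv.symm.toMonoidHom, fun a => ?_, fun j => ?_, fun l => ?_⟩
  · have := h1 (Multiplicative.ofAdd (a : ZMod 2))
    simp only [zetaHom_ofAdd_intCast] at this
    exact this
  · have := (h2 ⟨h.shiftAut (Multiplicative.ofAdd j), hC.left_le ⟨_, rfl⟩⟩).trans (hs _)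
    exact this
  · exact (h2 ⟨h.rho l, hC.right_le ⟨_, rfl⟩⟩).trans (hr _)

open scoped commutatorElement in
-- Commutators of $\sigma_l$ with $\zeta$ and $s_1$ are $\sigma$ of `twist l / l` and `sh 1 l / l`.
-- Scalars with $\zeta$ give the squares, the $H+j$ with $s_1$ give the ratios, and combining both
-- on $H$ gives $-H^2$.
theorem rho_mem_commutator (h : S.IsBasis K) {l : (LinLoc K (Fin 1))ˣ} (hl : l ∈ commGroup K) :
    h.rho l ∈ commutator (R ≃ₐ[K] R) := by
  have hcomm : ∀ a b : R ≃ₐ[K] R, ⁅a, b⁆ ∈ commutator (R ≃ₐ[K] R) := fun a b =>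
    Subgroup.commutator_mem_commutator (Subgroup.mem_top a) (Subgroup.mem_top b)
  have hζ : ∀ l, h.rho (twist l / l) ∈ commutator (R ≃ₐ[K] R) := by
    intro l
    have : h.rho (twist l / l) = ⁅h.zeta, h.rho l⁆ := by
      rw [commutatorElement_def, zeta_mul_rho, mul_inv_cancel_right, map_div, div_eq_mul_inv]
    rw [this]; exact hcomm _ _
  have hs : ∀ l, h.rho (sh 1 l / l) ∈ commutator (R ≃ₐ[K] R) := by
    intro l
    have : h.rho (sh 1 l / l) = ⁅h.shiftAut (Multiplicative.ofAdd 1), h.rho l⁆ := by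
      rw [commutatorElement_def, shiftAut_mul_rho, mul_inv_cancel_right, map_div, div_eq_mul_inv]
    rw [this]; exact hcomm _ _
  suffices commGroup K ≤ (commutator (R ≃ₐ[K] R)).comap h.rho from this hl
  refine sup_le (sup_le ?_ ?_) ?_
  · rintro _ ⟨c, rfl⟩
    have := hζ (scalarUnit K _ c⁻¹)
    rw [twist_scalarUnit, ← map_div, inv_inv, div_inv_eq_mul, ← sq] at this
    exact this
  · rw [ratioGroup, Subgroup.closure_le]
    rintro _ ⟨j, rfl⟩
    have := hs (linUnit K 0 (j + 1))
    rw [sh_linUnit, add_sub_cancel_right] at this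
    exact this
  · rw [Subgroup.zpowers_le]
    have h1 := hζ (linUnit K 0 0)
    have h2 := hs (linUnit K 0 0)
    rw [twist_linUnit] at h1
    rw [sh_linUnit] at h2
    -- The product of $(-(H-1))^{-1}/H$ and $(H-1)/H$ is $-H^{-2}$, so its inverse is $-H^2$.
    have h3 := inv_mem (mul_mem h1 h2)
    rw [← map_mul, ← map_inv] at h3
    rw [Subgroup.mem_comap]
    convert h3 using 2
    rw [negSq, sub_zero, zero_sub]
    generalize scalarUnit K (LinLoc K (Fin 1)) (-1) = s
    generalize linUnit K (0 : Fin 1) 0 = x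
    generalize linUnit K (0 : Fin 1) (-1) = y
    have : ((s * y)⁻¹ / x * (y / x))⁻¹ = s * (x * x) * (y * y⁻¹) := by
      simp only [div_eq_mul_inv, mul_inv_rev, inv_inv]
      simp only [mul_assoc, mul_comm, mul_left_comm]
    rw [this, mul_inv_cancel, mul_one, sq]

open scoped commutatorElement in
theorem shiftAut_two_mem_commutator (h : S.IsBasis K) :
    h.shiftAut (Multiplicative.ofAdd 2) ∈ commutator (R ≃ₐ[K] R) := by
  have : h.shiftAut (Multiplicative.ofAdd 2) = ⁅h.zeta, h.shiftAut (Multiplicative.ofAdd (-1))⁆ := by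
    rw [commutatorElement_def, zeta_mul_shiftAut, mul_inv_cancel_right, ← map_inv, ← map_mul]
    rfl
  rw [this]
  exact Subgroup.commutator_mem_commutator (Subgroup.mem_top _) (Subgroup.mem_top _)

/-- In the form $\zeta^as_j\sigma_l$, trivial image makes $a$ and $j$ even and puts the leading data
of $l$ in `leadGroup`; then $\zeta^a=1$ and $l$ lies in `commGroup`. -/
theorem mem_of_abelianization_eq_one (h : S.IsBasis K) (hq : q.ker ≤ leadGroup K)
    {f : (R ≃ₐ[K] R) →* Multiplicative (ZMod 2) × Multiplicative (ZMod 2) × Q}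
    (hz : ∀ a : ℤ, f (h.zeta ^ a) = (Multiplicative.ofAdd (a : ZMod 2), 1, 1))
    (hs : ∀ j : ℤ, f (h.shiftAut (Multiplicative.ofAdd j)) = (1, Multiplicative.ofAdd (j : ZMod 2), 1))
    (hr : ∀ l, f (h.rho l) = (1, 1, q (lead K l)))
    {g : R ≃ₐ[K] R} (hg : f g = 1) :
    g ∈ Subgroup.zpowers (h.shiftAut (Multiplicative.ofAdd 2)) ⊔ (commGroup K).map h.rho := by
  obtain ⟨a, j, l, rfl⟩ := h.exists_aut_form g
  rw [map_mul, map_mul, hz, hs, hr] at hg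
  simp only [Prod.mk_mul_mk, mul_one, one_mul, Prod.mk_eq_one] at hg
  obtain ⟨ha, hj, hl⟩ := hg
  have ha' : h.zeta ^ a = 1 := by
    rw [← orderOf_dvd_iff_zpow_eq_one, orderOf_zeta]
    exact (ZMod.intCast_zmod_eq_zero_iff_dvd a 2).1 ha
  obtain ⟨k, rfl⟩ := (ZMod.intCast_zmod_eq_zero_iff_dvd j 2).1 hj
  rw [ha', one_mul]
  refine Subgroup.mul_mem_sup ⟨k, ?_⟩ ⟨l, mem_commGroup_of_lead (hq hl), rfl⟩
  change h.shiftAut (Multiplicative.ofAdd 2) ^ k = _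
  rw [← map_zpow, ← ofAdd_zsmul, smul_eq_mul, mul_comm]
  rfl

theorem rho_mem_commutator_iff (h : S.IsBasis K) {l : (LinLoc K (Fin 1))ˣ} :
    h.rho l ∈ commutator (R ≃ₐ[K] R) ↔ l ∈ commGroup K := by
  refine ⟨fun hl => ?_, h.rho_mem_commutator⟩
  obtain ⟨Q, _, q, hq, _⟩ := exists_ker_eq (leadGroup K)
  obtain ⟨f, hz, hs, hr⟩ := h.exists_abelianization_hom hq.ge
  have : f (h.rho l) = 1 := Abelianization.commutator_subset_ker f hl
  rw [hr, Prod.mk_eq_one, Prod.mk_eq_one] at this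
  exact mem_commGroup_of_lead (hq.le this.2.2)

/-- A squeeze: the group generated by $s_2$ and the $\sigma_l$ with $l$ in `commGroup` lies in the
commutator subgroup, which lies in the kernel of the map to the abelian group, which lies in that
generated group. -/
theorem isInternalSemidirect_commutator (h : S.IsBasis K) :
    IsInternalSemidirect (commutator (R ≃ₐ[K] R))
      (Subgroup.zpowers (h.shiftAut (Multiplicative.ofAdd 2))) ((commGroup K).map h.rho) := by
  obtain ⟨Q, _, q, hq, _⟩ := exists_ker_eq (leadGroup K)
  obtain ⟨f, hz, hs, hr⟩ := h.exists_abelianization_hom hq.ge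
  refine ⟨le_antisymm (sup_le ?_ ?_) fun g hg => ?_, ?_, ?_⟩
  · rw [Subgroup.zpowers_le]
    exact h.shiftAut_two_mem_commutator
  · rintro _ ⟨l, hl, rfl⟩
    exact h.rho_mem_commutator hl
  · exact h.mem_of_abelianization_eq_one hq.le hz hs hr
      (Abelianization.commutator_subset_ker f hg)
  · refine h.isInternalSemidirect_shiftAut_rho.disjoint.mono ?_ ?_
    · rw [Subgroup.zpowers_le]; exact ⟨_, rfl⟩
    · rintro _ ⟨l, _, rfl⟩; exact ⟨l, rfl⟩
  · rintro _ ⟨k, rfl⟩ _ ⟨l, hl, rfl⟩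
    -- The conjugate is some $\sigma_{l'}$ and lies in the normal commutator subgroup, so $l'$
    -- belongs to `commGroup`.
    have h1 := (inferInstance : (commutator (R ≃ₐ[K] R)).Normal).conj_mem _ (h.rho_mem_commutator hl)
      (h.shiftAut (Multiplicative.ofAdd 2) ^ k)
    have h2 := h.isInternalSemidirect_shiftAut_rho.conj_mem
      (h.shiftAut (Multiplicative.ofAdd 2) ^ k)
      (zpow_mem (show h.shiftAut _ ∈ h.shiftAut.range from ⟨_, rfl⟩) k) (h.rho l) ⟨l, rfl⟩
    obtain ⟨l', e⟩ := h2
    simp only [← e] at h1 ⊢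
    exact ⟨l', h.rho_mem_commutator_iff.1 h1, rfl⟩

theorem nonempty_abelianization_equiv (h : S.IsBasis K) (hq : q.ker = leadGroup K)
    (hq' : Function.Surjective q) :
    Nonempty (Abelianization (R ≃ₐ[K] R) ≃* Multiplicative (ZMod 2) × Multiplicative (ZMod 2) × Q) := by
  obtain ⟨f, hz, hs, hr⟩ := h.exists_abelianization_hom hq.ge
  have hker : f.ker = commutator (R ≃ₐ[K] R) := by
    refine le_antisymm (fun g hg => ?_) (Abelianization.commutator_subset_ker f)
    rw [← h.isInternalSemidirect_commutator.sup_eq]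
    exact h.mem_of_abelianization_eq_one hq.le hz hs hr hg
  have hsurj : Function.Surjective f := by
    rintro ⟨a, j, t⟩
    obtain ⟨k, hk⟩ := ZMod.intCast_surjective a.toAdd
    obtain ⟨m, hm⟩ := ZMod.intCast_surjective j.toAdd
    obtain ⟨⟨c, d⟩, rfl⟩ := hq' t
    refine ⟨h.zeta ^ k * (h.shiftAut (Multiplicative.ofAdd m) *
      h.rho (scalarUnit K _ c * linUnit K 0 0 ^ d.toAdd)), ?_⟩
    have hl : lead K (scalarUnit K _ c * linUnit K 0 0 ^ d.toAdd) = (c, d) := by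
      rw [map_mul, map_zpow, lead_scalarUnit, lead_linUnit]
      ext <;> simp [← ofAdd_zsmul]
    rw [map_mul, map_mul, hz, hs, hr, hk, hm, hl]
    simp
  exact ⟨(QuotientGroup.quotientMulEquivOfEq hker.symm).trans
    (QuotientGroup.quotientKerEquivOfSurjective f hsurj)⟩

end Abelianization

end IsBasis

end

end ShiftSystem

/-! ### Inner automorphisms in one variable and their commutators -/

namespace ShiftSystem

noncomputable section

open LinLoc

variable {K R : Type*} [Field K] [CharZero K] [Ring R] [Algebra K R] {S : ShiftSystem R (Fin 1)}

namespace IsBasis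

theorem innerHom_thetaU (h : S.IsBasis K) (l : (LinLoc K (Fin 1))ˣ) :
    innerHom K R (S.thetaU l) = h.rho (l / sh 1 l) := by
  refine h.equiv_ext_one ?_ ?_
  · rw [innerHom_apply, rho_X, thetaU_val, thetaU_inv_val, mul_assoc, X_mul_theta, ← mul_assoc,
      ← map_mul, div_eq_mul_inv, ← map_inv]
    rfl
  · rw [rho_H, innerHom_apply, thetaU_val, thetaU_inv_val]
    have : S.H 0 = S.theta (gen K 0) := (S.theta_gen 0).symm
    rw [this, ← map_mul, ← map_mul, mul_right_comm, Units.mul_inv, one_mul]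

theorem innerHom_X (h : S.IsBasis K) :
    innerHom K R (S.X 0) = h.shiftAut (Multiplicative.ofAdd 1) := by
  refine h.equiv_ext_one ?_ ?_
  · rw [innerHom_apply, shiftAut_X, mul_assoc, Units.mul_inv, mul_one]
  · rw [innerHom_X_H, shiftAut_H]
    simp

/-- Units have the form $l\,x^j$; conjugation by $l$ multiplies $x$ by $l/\tau_1(l)$, and
conjugation by $x^j$ is $s_j$. -/
theorem exists_innAut_form (h : S.IsBasis K) {σ : R ≃ₐ[K] R} (hσ : σ ∈ innAut K R) :
    ∃ (l : (LinLoc K (Fin 1))ˣ) (j : ℤ),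
      σ = h.rho (l / sh 1 l) * h.shiftAut (Multiplicative.ofAdd j) := by
  rw [innAut_eq_range] at hσ
  obtain ⟨u, rfl⟩ := hσ
  obtain ⟨l, α, rfl⟩ := h.exists_unit u
  refine ⟨l, α 0, ?_⟩
  have : α = Pi.single 0 (α 0) := by
    ext k
    rw [Subsingleton.elim k 0, Pi.single_eq_same]
  rw [map_mul, innerHom_thetaU h, this, xpow_single, map_zpow, innerHom_X h, ← map_zpow,
    ← ofAdd_zsmul, Pi.single_eq_same, smul_eq_mul, mul_one]

theorem rho_mul_shiftAut_mul (h : S.IsBasis K) (a b : (LinLoc K (Fin 1))ˣ) (j k : ℤ) :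
    h.rho a * h.shiftAut (Multiplicative.ofAdd j) * (h.rho b * h.shiftAut (Multiplicative.ofAdd k)) =
      h.rho (a * sh j b) * h.shiftAut (Multiplicative.ofAdd (j + k)) := by
  rw [mul_assoc, ← mul_assoc (h.shiftAut _), shiftAut_mul_rho, ofAdd_add, map_mul, map_mul]
  simp only [mul_assoc]

open scoped commutatorElement in
theorem commutatorElement_rho_mul_shiftAut (h : S.IsBasis K) (a b : (LinLoc K (Fin 1))ˣ) (j k : ℤ) :
    ⁅h.rho a * h.shiftAut (Multiplicative.ofAdd j), h.rho b * h.shiftAut (Multiplicative.ofAdd k)⁆ =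
      h.rho ((a / sh k a) / (b / sh j b)) := by
  have e : ∀ x y : R ≃ₐ[K] R, ⁅x, y⁆ = (x * y) * (y * x)⁻¹ := fun x y => by
    rw [commutatorElement_def, mul_inv_rev, mul_assoc, mul_assoc]
  rw [e, rho_mul_shiftAut_mul, rho_mul_shiftAut_mul, add_comm k j, mul_inv_rev, mul_assoc,
    mul_inv_cancel_left, ← map_inv, ← map_mul]
  congr 1
  simp only [div_eq_mul_inv, mul_inv_rev, inv_inv]
  ac_rfl

/-- The commutator of two inner automorphisms is $\sigma_u$ with $u$ a quotient of differences of
differences, covered by `sh_div_mem`. Conversely, conjugations by $H+j+2$ and by $x$ have the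
generator with index $j$ as their commutator. -/
theorem commutator_innAut (h : S.IsBasis K) :
    ⁅innAut K R, innAut K R⁆ = (ratioGroup₂ K).map h.rho := by
  apply le_antisymm
  · rw [Subgroup.commutator_le]
    intro σ hσ τ hτ
    obtain ⟨l, j, rfl⟩ := h.exists_innAut_form hσ
    obtain ⟨m, k, rfl⟩ := h.exists_innAut_form hτ
    rw [commutatorElement_rho_mul_shiftAut]
    exact ⟨_, div_mem (sh_div_mem k l) (sh_div_mem j m), rfl⟩
  · rw [Subgroup.map_le_iff_le_comap, ratioGroup₂, Subgroup.closure_le]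
    rintro _ ⟨j, rfl⟩
    have hu : ∀ u, innerHom K R u ∈ innAut K R := fun u => by
      rw [innAut_eq_range]; exact ⟨u, rfl⟩
    have h1 := Subgroup.commutator_mem_commutator (hu (S.thetaU (linUnit K 0 (j + 2)))) (hu (S.X 0))
    have h2 := h.commutatorElement_rho_mul_shiftAut (linUnit K 0 (j + 2) / sh 1 (linUnit K 0 (j + 2)))
      1 0 1
    rw [ofAdd_zero, map_one h.shiftAut, map_one h.rho, mul_one, one_mul, map_one (sh 0), div_self', div_one,
      ← innerHom_thetaU, ← innerHom_X] at h2
    rw [h2] at h1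
    rw [SetLike.mem_coe, Subgroup.mem_comap]
    convert h1 using 2
    rw [map_div, sh_linUnit, sh_linUnit, show j + 2 - 1 = j + 1 by ring, add_sub_cancel_right,
      div_div_div_eq, ← sq, mul_comm (linUnit K 0 (j + 2))]

theorem commutator_innAut_eq_sigmaAut (h : S.IsBasis K) :
    ((⁅innAut K R, innAut K R⁆ : Subgroup (R ≃ₐ[K] R)) : Set (R ≃ₐ[K] R)) =
      sigmaAut K (S.X 0 : R) (S.H 0) (calL00 (S.H 0)) := by
  rw [commutator_innAut h, calL00_eq_map (K := K)]
  ext σ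
  constructor
  · rintro ⟨l, hl, rfl⟩
    exact ⟨S.thetaU l, ⟨l, hl, rfl⟩, h.rho_X l, h.rho_H l⟩
  · rintro ⟨_, ⟨l, hl, rfl⟩, hX, hH⟩
    exact ⟨l, hl, h.equiv_ext_one ((h.rho_X l).trans hX.symm) ((h.rho_H l).trans hH.symm)⟩

end IsBasis

end

end ShiftSystem

/-! ### Quotients and commutators of products of groups -/

section Groups

variable {G : Type*} [Group G]

/-- The quotient of a semidirect product by a normal subgroup of the normal factor. -/
theorem IsInternalSemidirect.map_mk {A B M : Subgroup G} [M.Normal]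
    (h : IsInternalSemidirect ⊤ A B) (hM : M ≤ B) :
    IsInternalSemidirect ⊤ (A.map (QuotientGroup.mk' M)) (B.map (QuotientGroup.mk' M)) := by
  refine ⟨?_, Subgroup.disjoint_def.2 ?_, ?_⟩
  · rw [← Subgroup.map_sup, h.sup_eq, ← MonoidHom.range_eq_map,
      MonoidHom.range_eq_top.2 (QuotientGroup.mk'_surjective M)]
  · rintro _ ⟨a, ha, rfl⟩ ⟨b, hb, e⟩
    have h1 : b⁻¹ * a ∈ B := hM ((QuotientGroup.eq (s := M)).1 e)
    have h2 : a ∈ B := by simpa using mul_mem hb h1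
    rw [Subgroup.disjoint_def.1 h.disjoint ha h2, map_one]
  · rintro _ ⟨a, ha, rfl⟩ _ ⟨b, hb, rfl⟩
    exact ⟨_, h.conj_mem a ha b hb, by simp⟩

/-- The kernel of $\prod A_i\to\prod A_i/N_i$ is $\prod N_i$, which by hypothesis and injectivity of
`κ` is also the preimage of `M`; so `κ` descends injectively. -/
theorem QuotientGroup.exists_pi_hom {I : Type*} {A : I → Type*} [∀ i, Group (A i)]
    (N : ∀ i, Subgroup (A i)) [∀ i, (N i).Normal] (M : Subgroup G) [M.Normal]
    {κ : (∀ i, A i) →* G} (hκ : Function.Injective κ) (hM : M = (Subgroup.pi Set.univ N).map κ) :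
    ∃ κ' : (∀ i, A i ⧸ N i) →* G ⧸ M,
      (∀ τ : ∀ i, A i, κ' (fun i => QuotientGroup.mk' (N i) (τ i)) = QuotientGroup.mk' M (κ τ)) ∧
      Function.Injective κ' ∧ κ'.range = κ.range.map (QuotientGroup.mk' M) := by
  let p : (∀ i, A i) →* ∀ i, A i ⧸ N i :=
    MonoidHom.piMap fun i => QuotientGroup.mk' (N i)
  have hp : Function.Surjective p := fun t => by
    choose τ hτ using fun i => QuotientGroup.mk'_surjective (N i) (t i)
    exact ⟨τ, funext hτ⟩
  have hker : ∀ τ, p τ = 1 ↔ QuotientGroup.mk' M (κ τ) = 1 := by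
    intro τ
    have h1 : QuotientGroup.mk' M (κ τ) = 1 ↔ κ τ ∈ M := QuotientGroup.eq_one_iff _
    rw [h1, hM]
    constructor
    · intro h
      exact ⟨τ, fun i _ => (QuotientGroup.eq_one_iff (N := N i) _).1 (congrFun h i), rfl⟩
    · rintro ⟨τ', h', e⟩
      rw [← hκ e]
      exact funext fun i => (QuotientGroup.eq_one_iff (N := N i) _).2 (h' i trivial)
  let κ' := p.liftOfSurjective hp ⟨(QuotientGroup.mk' M).comp κ, fun τ hτ => (hker τ).1 hτ⟩
  have hκ' : ∀ τ, κ' (p τ) = QuotientGroup.mk' M (κ τ) := fun τ =>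
    p.liftOfRightInverse_comp_apply _ (Function.rightInverse_surjInv hp) _ τ
  refine ⟨κ', hκ', ?_, ?_⟩
  · rw [injective_iff_map_eq_one]
    intro t ht
    obtain ⟨τ, rfl⟩ := hp t
    rw [hκ'] at ht
    exact (hker τ).2 ht
  · ext g
    constructor
    · rintro ⟨t, rfl⟩
      obtain ⟨τ, rfl⟩ := hp t
      exact ⟨_, ⟨τ, rfl⟩, (hκ' τ).symm⟩
    · rintro ⟨_, ⟨τ, rfl⟩, rfl⟩
      exact ⟨p τ, hκ' τ⟩

theorem map_pi_commutator {I : Type*} [Finite I] {A : I → Type*} [∀ i, Group (A i)]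
    (κ : (∀ i, A i) →* G) :
    (Subgroup.pi Set.univ fun i => commutator (A i)).map κ = ⁅κ.range, κ.range⁆ := by
  have : (Subgroup.pi Set.univ fun i => commutator (A i)) = ⁅(⊤ : Subgroup (∀ i, A i)), ⊤⁆ := by
    simp only [commutator_def]
    rw [← Subgroup.commutator_pi_pi_of_finite, Subgroup.pi_top]
  rw [this, Subgroup.map_commutator, ← MonoidHom.range_eq_map]

end Groups

/-! ### Inner and outer automorphisms of $\mathcal{A}_n$; its commutator subgroup -/

namespace Jacobian

noncomputable section

open LinLoc ShiftSystem

variable {K : Type*} [Field K] [CharZero K] {n : ℕ}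

/-- A unit of one factor commutes with the other factors, so its conjugation acts on that factor
alone. -/
theorem facHom_mulSingle_innerHom (i : Fin n) (v : (fac K i)ˣ) :
    facHom K n (Pi.mulSingle i (innerHom K (fac K i) v)) =
      innerHom K (CA K n) (Units.map ((fac K i).val : fac K i →* CA K n) v) := by
  refine equiv_ext_fac fun j a => ?_
  rw [facHom_apply]
  by_cases hij : j = i
  · subst hij
    rw [Pi.mulSingle_eq_same]
    rfl
  · rw [Pi.mulSingle_eq_of_ne hij, innerHom_apply, Units.eq_mul_inv_iff_mul_eq]
    exact (fac_commute (Ne.symm hij) (v : fac K i).2 a.2).symm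

/-- The units of $\mathcal{A}_n$ are generated by units of the factors, so inner automorphisms are
generated by those coming from single factors. -/
theorem innAut_eq_map (hn : 1 ≤ n) : innAut K (CA K n) =
    (Subgroup.pi Set.univ fun i : Fin n => innAut K (fac K i)).map (facHom K n) := by
  apply le_antisymm
  · rw [innAut_eq_range, MonoidHom.range_eq_map, ← iSup_facUnits hn, Subgroup.map_iSup, iSup_le_iff]
    rintro i _ ⟨_, ⟨v, rfl⟩, rfl⟩
    refine ⟨Pi.mulSingle i (innerHom K (fac K i) v), ?_, facHom_mulSingle_innerHom i v⟩
    rw [SetLike.mem_coe, Subgroup.mulSingle_mem_pi]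
    intro _
    rw [innAut_eq_range]
    exact ⟨v, rfl⟩
  · rw [Subgroup.map_le_iff_le_comap, Subgroup.pi_le_iff]
    rintro i _ ⟨σ, hσ, rfl⟩
    rw [SetLike.mem_coe, innAut_eq_range] at hσ
    obtain ⟨v, rfl⟩ := hσ
    rw [innAut_eq_range]
    exact ⟨_, (facHom_mulSingle_innerHom i v).symm⟩

theorem exists_outAut_hom (hn : 1 ≤ n) :
    ∃ κ' : (∀ i : Fin n, OutAut K (fac K i)) →* OutAut K (CA K n),
      (∀ τ : ∀ i : Fin n, fac K i ≃ₐ[K] fac K i,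
        κ' (fun i => QuotientGroup.mk' (innAut K (fac K i)) (τ i)) =
          QuotientGroup.mk' (innAut K (CA K n)) (facHom K n τ)) ∧
      Function.Injective ((QuotientGroup.mk' (innAut K (CA K n))).comp (permHom K n)) ∧
      Function.Injective κ' ∧
      IsInternalSemidirect ⊤ ((QuotientGroup.mk' (innAut K (CA K n))).comp (permHom K n)).range
        κ'.range := by
  obtain ⟨κ', h1, h2, h3⟩ := QuotientGroup.exists_pi_hom (fun i : Fin n => innAut K (fac K i))
    (innAut K (CA K n)) facHom_injective (innAut_eq_map hn)
  have hle : innAut K (CA K n) ≤ (facHom K n).range := by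
    rw [innAut_eq_map hn, MonoidHom.range_eq_map]
    exact Subgroup.map_mono le_top
  refine ⟨κ', h1, ?_, h2, ?_⟩
  · rw [injective_iff_map_eq_one]
    intro s hs
    have h4 : permHom K n s ∈ (facHom K n).range := hle ((QuotientGroup.eq_one_iff _).1 hs)
    have := Subgroup.disjoint_def.1 isInternalSemidirect_top.disjoint ⟨s, rfl⟩ h4
    exact permHom_injective (this.trans (map_one _).symm)
  · rw [h3, MonoidHom.range_comp]
    exact isInternalSemidirect_top.map_mk hle

theorem commutator_innAut_eq_map (hn : 1 ≤ n) : ⁅innAut K (CA K n), innAut K (CA K n)⁆ =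
    (Subgroup.pi Set.univ fun i : Fin n =>
      ⁅innAut K (fac K i), innAut K (fac K i)⁆).map (facHom K n) := by
  rw [innAut_eq_map hn, ← Subgroup.map_commutator, Subgroup.commutator_pi_pi_of_finite]

theorem exists_commutator_eq : ∃ N : Subgroup (CA K n ≃ₐ[K] CA K n),
    (∀ g, g ∈ N ↔ ∃ a ∈ ⁅(permHom K n).range, (facHom K n).range⁆,
      ∃ b ∈ (Subgroup.pi Set.univ fun i : Fin n =>
        commutator (fac K i ≃ₐ[K] fac K i)).map (facHom K n), g = a * b) ∧
    IsInternalSemidirect (commutator (CA K n ≃ₐ[K] CA K n))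
      ((commutator (Equiv.Perm (Fin n))).map (permHom K n)) N := by
  refine ⟨⁅(permHom K n).range, (facHom K n).range⁆ ⊔ ⁅(facHom K n).range, (facHom K n).range⁆,
    fun g => ?_, ?_⟩
  rotate_left
  · rw [commutator_def (Equiv.Perm (Fin n)), Subgroup.map_commutator, ← MonoidHom.range_eq_map]
    exact isInternalSemidirect_top.commutator
  · rw [map_pi_commutator]
    exact isInternalSemidirect_top.mem_sup_commutator g

end

end Jacobian

/-! ### Central automorphisms -/

namespace ShiftSystem.IsBasis

noncomputable section

open LinLoc

variable {K R ι : Type*} [Field K] [CharZero K] [Ring R] [Algebra K R] [DecidableEq ι] [Fintype ι]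
  {S : ShiftSystem R ι}

/-- The central units are the scalars. -/
theorem exists_scalarUnit_of_innerHom_eq_one (h : S.IsBasis K) {w : Rˣ} (hw : innerHom K R w = 1) :
    ∃ c : Kˣ, w = scalarUnit K R c := by
  obtain ⟨c, m, α, rfl⟩ := h.exists_unit' w
  have hα : α = 0 := by
    ext i
    have e := S.thetaU_xpow_conj_H (scalarUnit K (LinLoc K ι) c * linProd (Multiplicative.ofAdd m)) α i
    rw [hw, AlgEquiv.one_apply, eq_comm, sub_eq_self] at e
    exact h.intCast_inj (by simpa using e)
  subst hα
  rw [xpow_zero, mul_one] at hw ⊢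
  have hm : m = 0 := by
    -- Commuting with $x_i$ makes the exponents periodic in the direction $i$, hence zero by
    -- finiteness of the support.
    have hs : ∀ i, shiftExp (Pi.single i 1) m = m := by
      intro i
      have e := DFunLike.congr_fun hw ((S.xpow (Pi.single i 1) : Rˣ) : R)
      rw [AlgEquiv.one_apply, innerHom_apply, Units.mul_inv_eq_iff_eq_mul, thetaU_val,
        xpow_mul_theta] at e
      have e1 := (h.theta_mul_xpow_inj (Units.ne_zero _) e).2
      have e2 : scalarUnit K (LinLoc K ι) c * linProd (Multiplicative.ofAdd m) =
          Units.map (shift K (Pi.single i 1) : LinLoc K ι →* LinLoc K ι)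
            (scalarUnit K _ c * linProd (Multiplicative.ofAdd m)) := Units.ext e1
      rw [map_mul, map_shift_scalarUnit, map_shift_linProd] at e2
      exact (linProd_inj e2).2.symm
    ext ⟨i, j⟩
    have hinj : Function.Injective (Prod.mk i : ℤ → ι × ℤ) := Prod.mk_right_injective i
    have h0 := Finsupp.eq_zero_of_add_unit (m.comapDomain (Prod.mk i) hinj.injOn) 1 (by
      intro j
      have := DFunLike.congr_fun (hs i) (i, j)
      rw [shiftExp_apply, Pi.single_eq_same] at this
      exact this)
    exact DFunLike.congr_fun h0 j
  refine ⟨c, ?_⟩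
  rw [hm, ofAdd_zero, map_one, mul_one, thetaU_scalarUnit]

/-- A central $g$ commutes with conjugation by $v$, so $g(v)$ and $v$ induce the same inner
automorphism and $g(v)v^{-1}$ is a central unit, that is, a scalar. -/
theorem exists_scalar_of_mem_center (h : S.IsBasis K) {g : R ≃ₐ[K] R}
    (hg : g ∈ Subgroup.center (R ≃ₐ[K] R)) (v : Rˣ) :
    ∃ c : Kˣ, g v = algebraMap K R c * v := by
  rw [Subgroup.mem_center_iff] at hg
  have h1 : innerHom K R (Units.map (g : R →* R) v) = innerHom K R v := by
    ext a
    have e := map_innerHom g v (g⁻¹ a)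
    have e1 : g (g⁻¹ a) = a := g.apply_symm_apply a
    rw [e1] at e
    rw [← e]
    have e2 := DFunLike.congr_fun (hg (innerHom K R v)) (g⁻¹ a)
    rw [AlgEquiv.mul_apply, AlgEquiv.mul_apply, e1] at e2
    exact e2.symm
  obtain ⟨c, hc⟩ := h.exists_scalarUnit_of_innerHom_eq_one (w := Units.map (g : R →* R) v * v⁻¹)
    (by rw [map_mul, h1, ← map_mul, mul_inv_cancel, map_one])
  rw [mul_inv_eq_iff_eq_mul] at hc
  exact ⟨c, congrArg Units.val hc⟩

/-- Both units $H_i$ and $H_i+1$ are scaled, so $cH_i+1=d(H_i+1)$; hence $c=d=1$. -/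
theorem map_H_of_mem_center (h : S.IsBasis K) {g : R ≃ₐ[K] R}
    (hg : g ∈ Subgroup.center (R ≃ₐ[K] R)) (i : ι) : g (S.H i) = S.H i := by
  obtain ⟨c, hc⟩ := h.exists_scalar_of_mem_center hg (S.U i 0)
  rw [S.U_val, Int.cast_zero, add_zero] at hc
  obtain ⟨d, hd⟩ := h.exists_scalar_of_mem_center hg (S.U i 1)
  rw [S.U_val, Int.cast_one, map_add, map_one, hc] at hd
  have e : S.theta (algebraMap K (LinLoc K ι) c * gen K i + 1) =
      S.theta (algebraMap K (LinLoc K ι) d * (gen K i + 1)) := by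
    simpa using hd
  have e1 := h.theta_injective e
  have e2 := congrArg (shift K (Pi.single i 1)) e1
  simp only [map_add, map_mul, shift_gen, AlgHom.commutes, Pi.single_eq_same, map_one,
    Int.cast_one] at e2
  have e3 : algebraMap K (LinLoc K ι) c = algebraMap K _ d := by linear_combination e1 - e2
  have e4 : algebraMap K (LinLoc K ι) c = 1 := by
    rw [← e3] at e1
    linear_combination -e1
  have e5 : (c : K) = 1 := (algebraMap K (LinLoc K ι)).injective (by rw [e4, map_one])
  rw [hc, e5, map_one, one_mul]

end

end ShiftSystem.IsBasis

/-! ### The centre of $\mathcal{G}_n$ -/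

namespace Jacobian

noncomputable section

open LinLoc ShiftSystem

variable {K : Type*} [Field K] [CharZero K] {n : ℕ}

variable (K n) in
/-- The automorphism `x_i ↦ -x_i`, `H_i ↦ H_i`. -/
def signAut : CA K n ≃ₐ[K] CA K n :=
  facHom K n fun i => (facSys_isBasis i).rho (scalarUnit K _ (-1))

@[simp]
theorem signAut_cX (i : Fin n) : signAut K n (cX K i) = -cX K i := by
  have := (facSys_isBasis (K := K) i).rho_X (scalarUnit K _ (-1))
  rw [← thetaU_val, thetaU_scalarUnit] at this
  refine (facHom_apply _ i (facX K i)).trans ((congrArg Subtype.val this).trans ?_)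
  simp [scalarUnit]

@[simp]
theorem signAut_cH (i : Fin n) : signAut K n (cH K i) = cH K i :=
  (facHom_apply _ i (facH K i)).trans
    (congrArg Subtype.val ((facSys_isBasis i).rho_H (scalarUnit K _ (-1))))

theorem signAut_theta (a : LinLoc K (Fin n)) :
    signAut K n ((cSys K n).theta a) = (cSys K n).theta a := by
  have : (signAut K n : CA K n →ₐ[K] CA K n).comp (cSys K n).theta = (cSys K n).theta :=
    LinLoc.algHom_ext fun i => by
      rw [AlgHom.comp_apply, theta_gen]
      exact signAut_cH i
  exact DFunLike.congr_fun this a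

/-- It fixes all coefficients and negates each $x_k^{\pm1}$, while every automorphism sends $x_i$ to
a coefficient times some $x_k^{\pm1}$ and $H_i$ to a coefficient. -/
theorem signAut_mem_center : signAut K n ∈ Subgroup.center (CA K n ≃ₐ[K] CA K n) := by
  rw [Subgroup.mem_center_iff]
  intro g
  obtain ⟨π, ε, m, c, w, h⟩ := (cSys_isBasis (K := K) (n := n)).exists_map_form g
  have hX : ∀ (i : Fin n) (e : ℤˣ), Units.map (signAut K n : CA K n →* CA K n) ((cSys K n).X i ^ (e : ℤ)) =
      -(cSys K n).X i ^ (e : ℤ) := by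
    intro i e
    have h1 : Units.map (signAut K n : CA K n →* CA K n) ((cSys K n).X i) = -(cSys K n).X i :=
      Units.ext (signAut_cX i)
    rcases Int.units_eq_one_or e with rfl | rfl
    · simpa using h1
    · rw [Units.val_neg, Units.val_one, zpow_neg_one, map_inv, h1]
      exact inv_eq_of_mul_eq_one_right (by rw [neg_mul_neg, mul_inv_cancel])
  refine cSys_isBasis.equiv_ext (fun i => ?_) fun i => ?_
  · have h1 := congrArg Units.val (h i).2
    have h2 := congrArg Units.val (hX (π i) (ε i))
    rw [Units.coe_map, MonoidHom.coe_coe, Units.val_mul, thetaU_val] at h1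
    rw [Units.coe_map, MonoidHom.coe_coe, Units.val_neg] at h2
    have h3 : signAut K n ((cSys K n).X i : CA K n) = -((cSys K n).X i : CA K n) := signAut_cX i
    have h1' : g ((cSys K n).X i : CA K n) = _ := h1
    have h2' : signAut K n (((cSys K n).X (π i) ^ (ε i : ℤ) : (CA K n)ˣ) : CA K n) = _ := h2
    rw [AlgEquiv.mul_apply, AlgEquiv.mul_apply, h3, map_neg, h1', map_mul, signAut_theta, h2', mul_neg]
  · have h3 : ∀ k, signAut K n ((cSys K n).H k) = (cSys K n).H k := signAut_cH
    rw [AlgEquiv.mul_apply, AlgEquiv.mul_apply, h3, (h i).1, map_mul, map_intCast, map_add,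
      map_intCast, h3]

theorem algebraMap_mul_cX_inj {i : Fin n} {c d : Kˣ}
    (h : algebraMap K (CA K n) c * cX K i = algebraMap K (CA K n) d * cX K i) : c = d := by
  have : Nontrivial (CA K n) := ⟨1, 0, one_ne_zero_CA⟩
  have h1 := (Units.mul_left_inj (cXUnit K i)).1 h
  exact Units.ext ((algebraMap K (CA K n)).injective h1)

theorem eq_of_mem_center {g : CA K n ≃ₐ[K] CA K n} (hg : g ∈ Subgroup.center (CA K n ≃ₐ[K] CA K n)) :
    g = 1 ∨ g = signAut K n := by
  choose c hc using fun i => cSys_isBasis.exists_scalar_of_mem_center hg (cXUnit K i)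
  have hc' : ∀ i, g (cX K i) = algebraMap K (CA K n) (c i) * cX K i := hc
  have hcomm := Subgroup.mem_center_iff.1 hg
  -- Commutation with transpositions makes the scalars equal; commutation with $x_i\mapsto x_i^{-1}$
  -- then makes their squares $1$.
  have hconst : ∀ i j, c i = c j := by
    intro i j
    have e := DFunLike.congr_fun (hcomm (permHom K n (Equiv.swap i j))) (cX K i)
    rw [AlgEquiv.mul_apply, AlgEquiv.mul_apply, hc', map_mul, AlgEquiv.commutes, permHom_cX,
      Equiv.swap_apply_left, hc'] at e
    exact algebraMap_mul_cX_inj e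
  have hsq : ∀ i, c i * c i = 1 := by
    intro i
    have hz : ∀ a : fac K i, facHom K n (Pi.mulSingle i (facSys_isBasis i).zeta) a =
        (facSys_isBasis i).zeta a := fun a => by
      rw [facHom_apply, Pi.mulSingle_eq_same]
    have hz1 : Units.map (facHom K n (Pi.mulSingle i (facSys_isBasis i).zeta) : CA K n →* CA K n)
        (cXUnit K i) = (cXUnit K i)⁻¹ := by
      ext
      refine (hz (facX K i)).trans ?_
      refine (congrArg Subtype.val (facSys_isBasis i).zeta_X).trans ?_
      have : Units.map ((fac K i).val : fac K i →* CA K n) ((facSys K i).X 0) = cXUnit K i := Units.ext rfl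
      rw [← this, ← map_inv]
      rfl
    have hg1 : Units.map (g : CA K n →* CA K n) (cXUnit K i) = scalarUnit K _ (c i) * cXUnit K i :=
      Units.ext (hc i)
    have hz2 : facHom K n (Pi.mulSingle i (facSys_isBasis i).zeta) (cX K i) =
        ((cXUnit K i)⁻¹ : (CA K n)ˣ) := congrArg Units.val hz1
    have e := DFunLike.congr_fun (hcomm (facHom K n (Pi.mulSingle i (facSys_isBasis i).zeta))) (cX K i)
    rw [AlgEquiv.mul_apply, AlgEquiv.mul_apply, hc', map_mul, AlgEquiv.commutes, hz2] at e
    have e1 : scalarUnit K (CA K n) (c i) * (cXUnit K i)⁻¹ =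
        Units.map (g : CA K n →* CA K n) (cXUnit K i)⁻¹ := Units.ext e
    rw [map_inv, hg1, mul_inv_rev, eq_inv_mul_iff_mul_eq, eq_comm, ← map_inv] at e1
    have e2 : cXUnit K i * (scalarUnit K (CA K n) (c i) * (cXUnit K i)⁻¹) = scalarUnit K _ (c i) := by
      ext
      have := (Algebra.commutes (c i : K) ((cXUnit K i : (CA K n)ˣ) : CA K n)).symm
      have e3 : ((cXUnit K i : (CA K n)ˣ) : CA K n) * (scalarUnit K (CA K n) (c i) : (CA K n)ˣ) =
        (scalarUnit K (CA K n) (c i) : (CA K n)ˣ) * ((cXUnit K i : (CA K n)ˣ) : CA K n) := this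
      rw [Units.val_mul, Units.val_mul, ← mul_assoc, e3, mul_assoc, Units.mul_inv, mul_one]
    rw [e2] at e1
    have : Nontrivial (CA K n) := ⟨1, 0, one_ne_zero_CA⟩
    have e4 : (c i)⁻¹ = c i := by
      have := congrArg Units.val e1
      exact Units.ext ((algebraMap K (CA K n)).injective this)
    rw [← inv_eq_iff_mul_eq_one, e4]
  have hH : ∀ i, g (cH K i) = cH K i := fun i => cSys_isBasis.map_H_of_mem_center hg i
  rcases isEmpty_or_nonempty (Fin n) with hempty | ⟨⟨i₀⟩⟩
  · exact Or.inl (cSys_isBasis.equiv_ext (fun i => hempty.elim i) fun i => hempty.elim i)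
  · have h1 : (c i₀ : K) * (c i₀ : K) = 1 := congrArg Units.val (hsq i₀)
    rcases mul_self_eq_one_iff.1 h1 with h2 | h2
    · refine Or.inl (cSys_isBasis.equiv_ext (fun i => ?_) hH)
      refine (hc' i).trans ?_
      rw [hconst i i₀, h2, map_one, one_mul]
      rfl
    · refine Or.inr (cSys_isBasis.equiv_ext (fun i => ?_) fun i => (hH i).trans (signAut_cH i).symm)
      refine (hc' i).trans ?_
      rw [hconst i i₀, h2, map_neg, map_one, neg_one_mul]
      exact (signAut_cX i).symm

theorem center_eq : (Subgroup.center (CA K n ≃ₐ[K] CA K n) : Set (CA K n ≃ₐ[K] CA K n)) =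
    {1, signAut K n} := by
  ext g
  constructor
  · exact fun hg => eq_of_mem_center hg
  · rintro (rfl | rfl)
    · exact one_mem _
    · exact signAut_mem_center

end

end Jacobian

/-! ### Abelianizations of wreath products with $S_n$ and of $S_n$ -/

section Groups

theorem Abelianization.of_surjective (G : Type*) [Group G] :
    Function.Surjective (Abelianization.of : G →* Abelianization G) :=
  QuotientGroup.mk'_surjective (commutator G)

theorem Abelianization.of_conj {G : Type*} [Group G] (g h : G) :
    Abelianization.of (g * h * g⁻¹) = Abelianization.of h := by
  rw [map_mul, map_mul, map_inv, mul_right_comm, mul_inv_cancel, one_mul]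

/-- The abelianization of a wreath product with a symmetric group. -/
theorem IsInternalSemidirect.nonempty_abelianization_equiv {I G B : Type*} [Fintype I] [DecidableEq I]
    [Nonempty I] [Group G] [Group B] {A : I → Type*} [∀ i, Group (A i)]
    {ι : Equiv.Perm I →* G} {κ : (∀ i, A i) →* G} (h : IsInternalSemidirect ⊤ ι.range κ.range)
    (hι : Function.Injective ι) (hκ : Function.Injective κ) (θ : ∀ i, A i ≃* B)
    (hconj : ∀ s τ τ', ι s * κ τ * (ι s)⁻¹ = κ τ' → ∀ i, θ (s i) (τ' (s i)) = θ i (τ i)) :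
    Nonempty (Abelianization G ≃* Abelianization (Equiv.Perm I) × Abelianization B) := by
  obtain ⟨i₀⟩ := ‹Nonempty I›
  -- The product of the classes of all coordinates does not change when conjugation permutes the
  -- coordinates.
  let fB : (∀ i, A i) →* Abelianization B :=
    ∏ i, Abelianization.of.comp ((θ i).toMonoidHom.comp (Pi.evalMonoidHom A i))
  have hfB : ∀ τ, fB τ = ∏ i, Abelianization.of (θ i (τ i)) := fun τ => by
    simp [fB, MonoidHom.finsetProd_apply]
  obtain ⟨f', h1, h2⟩ := h.exists_lift_hom hι hκ
    (T := Abelianization (Equiv.Perm I) × Abelianization B)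
    ((MonoidHom.inl _ _).comp Abelianization.of) ((MonoidHom.inr _ _).comp fB) (by
      intro s τ τ' e
      rw [MonoidHom.comp_apply, MonoidHom.comp_apply, hfB, hfB, ← Equiv.prod_comp s]
      simp only [hconj s τ τ' e])
  let f : G →* Abelianization (Equiv.Perm I) × Abelianization B :=
    f'.comp Subgroup.topEquiv.symm.toMonoidHom
  have hf1 : ∀ s, f (ι s) = (Abelianization.of s, 1) := h1
  have hf2 : ∀ τ, f (κ τ) = (1, fB τ) := h2
  have hsingle : ∀ i (a : A i), fB (Pi.mulSingle i a) = Abelianization.of (θ i a) := by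
    intro i a
    rw [hfB, Finset.prod_eq_single i]
    · rw [Pi.mulSingle_eq_same]
    · intro j _ hj
      rw [Pi.mulSingle_eq_of_ne hj, map_one, map_one]
    · intro hi
      exact absurd (Finset.mem_univ i) hi
  -- The inverse map places `B` at a fixed coordinate; the choice is immaterial in the
  -- abelianization, since transpositions move the coordinates.
  let gB : B →* G := κ.comp ((MonoidHom.mulSingle A i₀).comp (θ i₀).symm.toMonoidHom)
  have hgB : ∀ b, gB b = κ (Pi.mulSingle i₀ ((θ i₀).symm b)) := fun b => rfl
  let g : Abelianization (Equiv.Perm I) × Abelianization B →* Abelianization G :=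
    MonoidHom.coprod (Abelianization.lift (Abelianization.of.comp ι))
      (Abelianization.lift (Abelianization.of.comp gB))
  have hg : ∀ s b, g (Abelianization.of s, Abelianization.of b) =
      Abelianization.of (ι s) * Abelianization.of (gB b) := fun s b => by
    simp only [g, MonoidHom.coprod_apply, Abelianization.lift_apply_of, MonoidHom.comp_apply]
  have hκsingle : ∀ i (a : A i), Abelianization.of (κ (Pi.mulSingle i a)) =
      Abelianization.of (gB (θ i a)) := by
    intro i a
    obtain ⟨τ', e⟩ := h.conj_mem _ ⟨Equiv.swap i i₀, rfl⟩ _ ⟨Pi.mulSingle i a, rfl⟩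
    have e1 := hconj _ _ _ e.symm
    have e2 : τ' = Pi.mulSingle i₀ ((θ i₀).symm (θ i a)) := by
      ext j
      apply (θ j).injective
      by_cases hj : j = i₀
      · subst hj
        have := e1 i
        rw [Equiv.swap_apply_left, Pi.mulSingle_eq_same] at this
        rw [this, Pi.mulSingle_eq_same, MulEquiv.apply_symm_apply]
      · have := e1 (Equiv.swap i i₀ j)
        rw [Equiv.swap_apply_self] at this
        rw [this, Pi.mulSingle_eq_of_ne hj, map_one, Pi.mulSingle_eq_of_ne, map_one]
        intro hj'
        apply hj
        rw [← Equiv.swap_apply_self i i₀ j, hj', Equiv.swap_apply_left]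
    rw [← Abelianization.of_conj (ι (Equiv.swap i i₀)), ← e, e2, hgB]
  have hgf : g.comp f = Abelianization.of := by
    have hle : ι.range ⊔ κ.range ≤ (g.comp f).eqLocus Abelianization.of := by
      refine sup_le ?_ ?_
      · rintro _ ⟨s, rfl⟩
        change g (f (ι s)) = Abelianization.of (ι s)
        rw [hf1, ← map_one (Abelianization.of : B →* _), hg, map_one, map_one, mul_one]
      · have : (g.comp f).comp κ = Abelianization.of.comp κ := by
          refine MonoidHom.pi_ext fun i a => ?_
          change g (f (κ (Pi.mulSingle i a))) = Abelianization.of (κ (Pi.mulSingle i a))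
          rw [hf2, hsingle, ← map_one (Abelianization.of : Equiv.Perm I →* _), hg, map_one, map_one,
            one_mul, hκsingle]
        rintro _ ⟨τ, rfl⟩
        exact DFunLike.congr_fun this τ
    rw [h.sup_eq] at hle
    ext x
    exact hle (Subgroup.mem_top x)
  refine ⟨MonoidHom.toMulEquiv (Abelianization.lift f) g ?_ ?_⟩
  · refine Abelianization.hom_ext _ _ ?_
    ext x
    simp only [MonoidHom.comp_apply, Abelianization.lift_apply_of, MonoidHom.id_apply]
    exact DFunLike.congr_fun hgf x
  · ext1 ⟨p, q⟩
    obtain ⟨s, rfl⟩ := Abelianization.of_surjective _ p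
    obtain ⟨b, rfl⟩ := Abelianization.of_surjective _ q
    rw [MonoidHom.comp_apply, hg, map_mul, Abelianization.lift_apply_of, Abelianization.lift_apply_of,
      hf1, hgB, hf2, hsingle, MulEquiv.apply_symm_apply, Prod.mk_mul_mk, mul_one, one_mul]
    rfl

/-- All transpositions are conjugate, so they have one common class of square $1$, and the class of
a permutation depends only on its sign. -/
theorem Equiv.Perm.nonempty_abelianization_equiv (I : Type*) [Fintype I] [DecidableEq I] [Nontrivial I] :
    Nonempty (Abelianization (Equiv.Perm I) ≃* Multiplicative (ZMod 2)) := by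
  obtain ⟨a, b, hab⟩ := exists_pair_ne I
  have hswap : ∀ x y : I, x ≠ y → Abelianization.of (Equiv.swap x y) = Abelianization.of (Equiv.swap a b) := by
    intro x y hxy
    obtain ⟨c, hc⟩ := isConj_iff.1 (Equiv.Perm.isConj_swap hxy hab)
    rw [← hc, Abelianization.of_conj]
  have key : ∀ σ : Equiv.Perm I, (sign σ = 1 ∧ Abelianization.of σ = 1) ∨
      (sign σ = -1 ∧ Abelianization.of σ = Abelianization.of (Equiv.swap a b)) := by
    intro σ
    induction σ using Equiv.Perm.swap_induction_on with
    | one => exact Or.inl ⟨map_one _, map_one _⟩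
    | swap_mul f x y hxy ih =>
      rw [map_mul, map_mul, sign_swap hxy, hswap x y hxy]
      rcases ih with ⟨h1, h2⟩ | ⟨h1, h2⟩
      · exact Or.inr ⟨by rw [h1, mul_one], by rw [h2, mul_one]⟩
      · refine Or.inl ⟨by rw [h1, neg_mul_neg, mul_one], ?_⟩
        rw [h2, ← map_mul, Equiv.swap_mul_self, map_one]
  have hker : (sign : Equiv.Perm I →* ℤˣ).ker = commutator (Equiv.Perm I) := by
    refine le_antisymm (fun σ hσ => ?_) (Abelianization.commutator_subset_ker _)
    rcases key σ with ⟨_, h2⟩ | ⟨h1, _⟩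
    · exact (QuotientGroup.eq_one_iff σ).1 h2
    · rw [MonoidHom.mem_ker, h1] at hσ
      exact absurd hσ (by decide)
  have e : ℤˣ ≃* Multiplicative (ZMod 2) :=
    mulEquivOfPrimeCardEq (p := 2) (by simp) (by simp)
  exact ⟨((QuotientGroup.quotientMulEquivOfEq hker.symm).trans
    (QuotientGroup.quotientKerEquivOfSurjective _ (sign_surjective I))).trans e⟩

/-- Triples of elements of an additive monoid, as functions on `Fin 3`. -/
def multiplicativeFinThree (Z : Type*) [AddMonoid Z] :
    Multiplicative Z × Multiplicative Z × Multiplicative Z ≃* Multiplicative (Fin 3 → Z) where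
  toFun p := Multiplicative.ofAdd ![p.1.toAdd, p.2.1.toAdd, p.2.2.toAdd]
  invFun v := (Multiplicative.ofAdd (v.toAdd 0), Multiplicative.ofAdd (v.toAdd 1),
    Multiplicative.ofAdd (v.toAdd 2))
  left_inv _ := rfl
  right_inv v := by
    apply Multiplicative.toAdd.injective
    ext i
    fin_cases i <;> rfl
  map_mul' p q := by
    apply Multiplicative.toAdd.injective
    ext i
    fin_cases i <;> rfl

/-- Quadruples of elements of an additive monoid, as functions on `Fin 4`. -/
def multiplicativeFinFour (Z : Type*) [AddMonoid Z] :
    Multiplicative Z × Multiplicative Z × Multiplicative Z × Multiplicative Z ≃*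
      Multiplicative (Fin 4 → Z) where
  toFun p := Multiplicative.ofAdd ![p.1.toAdd, p.2.1.toAdd, p.2.2.1.toAdd, p.2.2.2.toAdd]
  invFun v := (Multiplicative.ofAdd (v.toAdd 0), Multiplicative.ofAdd (v.toAdd 1),
    Multiplicative.ofAdd (v.toAdd 2), Multiplicative.ofAdd (v.toAdd 3))
  left_inv _ := rfl
  right_inv v := by
    apply Multiplicative.toAdd.injective
    ext i
    fin_cases i <;> rfl
  map_mul' p q := by
    apply Multiplicative.toAdd.injective
    ext i
    fin_cases i <;> rfl

end Groups

/-! ### Leading data over an algebraically closed field -/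

namespace LinLoc

variable {K : Type*} [Field K]

/-- The parity of the degree. -/
def parity (K : Type*) [Field K] : Kˣ × Multiplicative ℤ →* Multiplicative (ZMod 2) :=
  (AddMonoidHom.toMultiplicative (Int.castAddHom (ZMod 2))).comp (MonoidHom.snd _ _)

theorem parity_surjective : Function.Surjective (parity K) := fun t => by
  obtain ⟨k, hk⟩ := ZMod.intCast_surjective t.toAdd
  exact ⟨(1, Multiplicative.ofAdd k), congrArg Multiplicative.ofAdd hk⟩

/-- When every scalar is a square, $K^{*2}\langle -H^2\rangle$ consists of all elements of even
degree. -/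
theorem parity_ker [IsAlgClosed K] : (parity K).ker = leadGroup K := by
  apply le_antisymm
  · rintro ⟨c, d⟩ hd
    obtain ⟨k, hk⟩ := (ZMod.intCast_zmod_eq_zero_iff_dvd d.toAdd 2).1 hd
    -- The factor $(-1)^{-k}$ cancels the sign contributed by the $k$-th power of $-H^2$.
    obtain ⟨z, hz⟩ := IsAlgClosed.exists_pow_nat_eq ((c * (-1) ^ (-k) : Kˣ) : K) zero_lt_two
    have hz0 : z ≠ 0 := by
      rintro rfl
      rw [zero_pow two_ne_zero] at hz
      exact (Units.ne_zero _) hz.symm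
    have e : (c, d) = (c * (-1) ^ (-k), 1) * ((-1 : Kˣ), Multiplicative.ofAdd (2 : ℤ)) ^ k := by
      refine Prod.ext ?_ ?_
      · simp
      · apply Multiplicative.toAdd.injective
        change d.toAdd = 0 + k • (2 : ℤ)
        rw [hk, zero_add, smul_eq_mul, mul_comm]
        rfl
    rw [e]
    refine Subgroup.mul_mem_sup ⟨⟨Units.mk0 z hz0, ?_⟩, rfl⟩ ⟨k, rfl⟩
    ext
    exact hz
  · refine sup_le ?_ ?_
    · rintro ⟨c, d⟩ ⟨_, hd⟩
      have hd : d = 1 := hd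
      subst hd
      exact map_one (AddMonoidHom.toMultiplicative (Int.castAddHom (ZMod 2)))
    · rw [Subgroup.zpowers_le]
      exact (ZMod.intCast_zmod_eq_zero_iff_dvd 2 2).2 dvd_rfl

end LinLoc

/-! ### The abelianization of $\mathcal{G}_n$ -/

namespace Jacobian

noncomputable section

open LinLoc ShiftSystem

variable {K : Type*} [Field K] [CharZero K] {n : ℕ}

theorem exists_fac_equiv (i : Fin n) :
    ∃ φ : fac K i ≃ₐ[K] CA K 1, φ (facX K i) = cX K 0 ∧ φ (facH K i) = cH K 0 := by
  obtain ⟨φ, h1, h2⟩ := (facSys_isBasis (K := K) i).exists_equiv (cSys_isBasis (K := K) (n := 1))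
  exact ⟨φ, h1 0, h2 0⟩

theorem nonempty_abelianization_equiv (hn : 1 ≤ n) : Nonempty (Abelianization (CA K n ≃ₐ[K] CA K n) ≃*
    Abelianization (Equiv.Perm (Fin n)) × Abelianization (CA K 1 ≃ₐ[K] CA K 1)) := by
  choose φ hX hH using exists_fac_equiv (K := K) (n := n)
  have : Nonempty (Fin n) := ⟨⟨0, hn⟩⟩
  -- Permutations transport one factor to another through the identifications with $\mathcal{A}_1$,
  -- so conjugation permutes the coordinates of a tuple as in a wreath product.
  have hφ : ∀ (s : Equiv.Perm (Fin n)) i (a : fac K i),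
      permHom K n s a = ((φ (s i)).symm (φ i a) : fac K (s i)) := by
    intro s i a
    have : (permHom K n s : CA K n →ₐ[K] CA K n).comp (fac K i).val =
        (fac K (s i)).val.comp (((φ (s i)).symm : CA K 1 →ₐ[K] fac K (s i)).comp
          (φ i : fac K i →ₐ[K] CA K 1)) := by
      refine (facSys_isBasis i).hom_ext (fun _ => ?_) fun _ => ?_
      · refine (permHom_cX s i).trans ?_
        have e : (φ (s i)).symm (φ i (facX K i)) = facX K (s i) := by
          rw [hX, ← hX (s i), AlgEquiv.symm_apply_apply]
        exact (congrArg Subtype.val e).symm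
      · refine (permHom_cH s i).trans ?_
        have e : (φ (s i)).symm (φ i (facH K i)) = facH K (s i) := by
          rw [hH, ← hH (s i), AlgEquiv.symm_apply_apply]
        exact (congrArg Subtype.val e).symm
    exact DFunLike.congr_fun this a
  refine isInternalSemidirect_top.nonempty_abelianization_equiv permHom_injective facHom_injective
    (fun i => AlgEquiv.autCongr (φ i)) fun s τ τ' e i => ?_
  rw [mul_inv_eq_iff_eq_mul] at e
  ext b
  obtain ⟨a, rfl⟩ := (φ i).surjective b
  have e1 := DFunLike.congr_fun e (a : CA K n)
  rw [AlgEquiv.mul_apply, AlgEquiv.mul_apply, hφ, facHom_apply, facHom_apply, hφ] at e1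
  have e2 := congrArg (φ (s i)) (Subtype.ext e1)
  rw [AlgEquiv.apply_symm_apply] at e2
  simp only [AlgEquiv.autCongr_apply, AlgEquiv.trans_apply, AlgEquiv.symm_apply_apply]
  exact e2.symm

theorem nonempty_abelianization_equiv_three [IsAlgClosed K] :
    Nonempty (Abelianization (CA K 1 ≃ₐ[K] CA K 1) ≃* Multiplicative (Fin 3 → ZMod 2)) := by
  obtain ⟨e⟩ := (cSys_isBasis (K := K) (n := 1)).nonempty_abelianization_equiv parity_ker
    parity_surjective
  exact ⟨e.trans (multiplicativeFinThree (ZMod 2))⟩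

theorem nonempty_abelianization_equiv_four [IsAlgClosed K] (hn : 1 < n) :
    Nonempty (Abelianization (CA K n ≃ₐ[K] CA K n) ≃* Multiplicative (Fin 4 → ZMod 2)) := by
  have : Nontrivial (Fin n) := Fin.nontrivial_iff_two_le.2 hn
  obtain ⟨e⟩ := (cSys_isBasis (K := K) (n := 1)).nonempty_abelianization_equiv parity_ker
    parity_surjective
  obtain ⟨e1⟩ := Equiv.Perm.nonempty_abelianization_equiv (Fin n)
  obtain ⟨e2⟩ := nonempty_abelianization_equiv (K := K) hn.le
  exact ⟨(e2.trans (e1.prodCongr e)).trans (multiplicativeFinFour (ZMod 2))⟩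

end

end Jacobian

/-! ### Assembly of the description of $\mathcal{G}_1$ and of the theorem -/

namespace ShiftSystem.IsBasis

noncomputable section

open LinLoc

variable {K R : Type*} [Field K] [CharZero K] [Ring R] [Algebra K R] {S : ShiftSystem R (Fin 1)}

theorem exists_structure (h : S.IsBasis K) :
    (∃ (ζ : R ≃ₐ[K] R)
       (s : Multiplicative ℤ →* (R ≃ₐ[K] R))
       (ρ : calLUnits K (S.H 0) →* (R ≃ₐ[K] R))
       (e : Kˣ × Multiplicative (ℤ →₀ ℤ) ≃* calLUnits K (S.H 0)),
      (ζ ((S.X 0 : R)) = ((S.X 0)⁻¹ : Rˣ) ∧ ζ (S.H 0) = -S.H 0) ∧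
      (∀ j : ℤ, s (Multiplicative.ofAdd j) ((S.X 0 : R)) = (S.X 0 : R) ∧
        s (Multiplicative.ofAdd j) (S.H 0) = S.H 0 - (j : R)) ∧
      (∀ u, ρ u ((S.X 0 : R)) = ((u : Rˣ) : R) * (S.X 0 : R) ∧ ρ u (S.H 0) = S.H 0) ∧
      (∀ c : Kˣ, ((e (c, 1) : Rˣ) : R) = algebraMap K (R) c) ∧
      (∀ j : ℤ, ((e (1, Multiplicative.ofAdd (Finsupp.single j 1)) : Rˣ) : R) =
        S.H 0 + (j : R)) ∧
      orderOf ζ = 2 ∧ Function.Injective s ∧ Function.Injective ρ ∧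
      IsInternalSemidirect ⊤ (Subgroup.zpowers ζ) (s.range ⊔ ρ.range) ∧
      IsInternalSemidirect (s.range ⊔ ρ.range) s.range ρ.range ∧
      IsInternalSemidirect (commutator (R ≃ₐ[K] R))
        (Subgroup.zpowers (s (Multiplicative.ofAdd 2)))
        (((calLComm K (S.H 0)).subgroupOf (calLUnits K (S.H 0))).map ρ)) := by
  have hu : ∀ l, h.unitsEquiv.symm (h.unitsEquiv l) = l := h.unitsEquiv.symm_apply_apply
  have hrange : (h.rho.comp h.unitsEquiv.symm.toMonoidHom).range = h.rho.range := by
    rw [MonoidHom.range_comp, MonoidHom.range_eq_top.2 h.unitsEquiv.symm.surjective,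
      ← MonoidHom.range_eq_map]
  refine ⟨h.zeta, h.shiftAut, h.rho.comp h.unitsEquiv.symm.toMonoidHom,
    (paramEquiv K).trans h.unitsEquiv, ⟨h.zeta_X, h.zeta_H⟩, fun j => ⟨h.shiftAut_X j, h.shiftAut_H j⟩,
    fun u => ?_, fun c => ?_, fun j => ?_, h.orderOf_zeta, h.shiftAut_injective,
    h.rho_injective.comp h.unitsEquiv.symm.injective, ?_, ?_, ?_⟩
  · obtain ⟨l, rfl⟩ := h.unitsEquiv.surjective u
    rw [MonoidHom.comp_apply, MulEquiv.coe_toMonoidHom, hu]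
    exact ⟨h.rho_X l, h.rho_H l⟩
  · rw [MulEquiv.trans_apply, paramEquiv_scalar]
    exact congrArg Units.val (S.thetaU_scalarUnit c)
  · rw [MulEquiv.trans_apply, paramEquiv_single]
    exact (congrArg Units.val (S.thetaU_linUnit (K := K) 0 j)).trans (S.U_val 0 j)
  · rw [hrange]
    exact h.isInternalSemidirect_zeta
  · rw [hrange]
    exact h.isInternalSemidirect_shiftAut_rho
  · exact (congrArg _ h.map_rho_calLComm).mpr h.isInternalSemidirect_commutator

theorem nonempty_abelianization_equiv_quotient (h : S.IsBasis K) :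
    Nonempty (Abelianization (R ≃ₐ[K] R) ≃* Multiplicative (ZMod 2) × Multiplicative (ZMod 2) ×
      ((Kˣ × Multiplicative ℤ) ⧸ leadGroup K)) := by
  obtain ⟨Q, _, q, hq, hq'⟩ := exists_ker_eq (leadGroup K)
  obtain ⟨e⟩ := h.nonempty_abelianization_equiv hq hq'
  let e₁ : Q ≃* (Kˣ × Multiplicative ℤ) ⧸ leadGroup K :=
    (QuotientGroup.quotientKerEquivOfSurjective q hq').symm.trans (QuotientGroup.quotientMulEquivOfEq hq)
  exact ⟨e.trans
    { toEquiv := Equiv.prodCongr (Equiv.refl _) (Equiv.prodCongr (Equiv.refl _) e₁.toEquiv)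
      map_mul' := fun a b => Prod.ext rfl (Prod.ext rfl (map_mul e₁ a.2.2 b.2.2)) }⟩

end

end ShiftSystem.IsBasis

theorem mainTheorem6 (K : Type*) [Field K] [CharZero K] (n : ℕ) (hn : 1 ≤ n) :
    -- the decomposition of `Aut(𝒜_n)` and what follows from it
    (∃ (ι : Equiv.Perm (Fin n) →* (CA K n ≃ₐ[K] CA K n))
       (κ : (∀ i : Fin n, fac K i ≃ₐ[K] fac K i) →* (CA K n ≃ₐ[K] CA K n)),
      -- the action of `S_n` and of the product of the groups `Aut(𝒜_1(i))` on `𝒜_n`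
      (∀ s i, ι s (cX K i) = cX K (s i) ∧ ι s (cH K i) = cH K (s i)) ∧
      (∀ τ i (a : fac K i), κ τ (a : CA K n) = (τ i a : CA K n)) ∧
      Function.Injective ι ∧ Function.Injective κ ∧
      -- 1
      IsInternalSemidirect ⊤ ι.range κ.range ∧
      -- 3
      innAut K (CA K n) =
        (Subgroup.pi Set.univ fun i : Fin n => innAut K (fac K i)).map κ ∧
      -- 4
      (∃ κ' : (∀ i : Fin n, OutAut K (fac K i)) →* OutAut K (CA K n),
        (∀ τ : ∀ i : Fin n, fac K i ≃ₐ[K] fac K i,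
          κ' (fun i => QuotientGroup.mk' (innAut K (fac K i)) (τ i)) =
            QuotientGroup.mk' (innAut K (CA K n)) (κ τ)) ∧
        Function.Injective ((QuotientGroup.mk' (innAut K (CA K n))).comp ι) ∧
        Function.Injective κ' ∧
        IsInternalSemidirect ⊤ ((QuotientGroup.mk' (innAut K (CA K n))).comp ι).range κ'.range) ∧
      -- 5
      ⁅innAut K (CA K n), innAut K (CA K n)⁆ =
        (Subgroup.pi Set.univ fun i : Fin n =>
          ⁅innAut K (fac K i), innAut K (fac K i)⁆).map κ ∧
      (∀ i : Fin n, ((⁅innAut K (fac K i), innAut K (fac K i)⁆ :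
          Subgroup (fac K i ≃ₐ[K] fac K i)) : Set (fac K i ≃ₐ[K] fac K i)) =
        sigmaAut K (facX K i) (facH K i) (calL00 (facH K i))) ∧
      -- 6, the commutator subgroup
      (∃ N : Subgroup (CA K n ≃ₐ[K] CA K n),
        (∀ g, g ∈ N ↔ ∃ a ∈ ⁅ι.range, κ.range⁆,
          ∃ b ∈ (Subgroup.pi Set.univ fun i : Fin n =>
            commutator (fac K i ≃ₐ[K] fac K i)).map κ, g = a * b) ∧
        IsInternalSemidirect (commutator (CA K n ≃ₐ[K] CA K n))
          ((commutator (Equiv.Perm (Fin n))).map ι) N)) ∧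
    -- 2
    (∃ σ : CA K n ≃ₐ[K] CA K n, (∀ i, σ (cX K i) = -cX K i ∧ σ (cH K i) = cH K i) ∧
      (Subgroup.center (CA K n ≃ₐ[K] CA K n) : Set (CA K n ≃ₐ[K] CA K n)) = {1, σ}) ∧
    -- 6, the abelianization
    Nonempty (Abelianization (CA K n ≃ₐ[K] CA K n) ≃*
      Abelianization (Equiv.Perm (Fin n)) × Abelianization (CA K 1 ≃ₐ[K] CA K 1)) ∧
    (IsAlgClosed K → n = 1 →
      Nonempty (Abelianization (CA K n ≃ₐ[K] CA K n) ≃* Multiplicative (Fin 3 → ZMod 2))) ∧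
    (IsAlgClosed K → 1 < n →
      Nonempty (Abelianization (CA K n ≃ₐ[K] CA K n) ≃* Multiplicative (Fin 4 → ZMod 2))) ∧
    -- the algebras `𝒜_1(i)` are copies of `𝒜_1`
    (∀ i : Fin n, ∃ φ : fac K i ≃ₐ[K] CA K 1, φ (facX K i) = cX K 0 ∧ φ (facH K i) = cH K 0) ∧
    -- the group `Aut(𝒜_1)`
    (∃ (ζ : CA K 1 ≃ₐ[K] CA K 1)
       (s : Multiplicative ℤ →* (CA K 1 ≃ₐ[K] CA K 1))
       (ρ : calLUnits K (cH K (0 : Fin 1)) →* (CA K 1 ≃ₐ[K] CA K 1))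
       (e : Kˣ × Multiplicative (ℤ →₀ ℤ) ≃* calLUnits K (cH K (0 : Fin 1))),
      (ζ (cX K 0) = ((cXUnit K 0)⁻¹ : (CA K 1)ˣ) ∧ ζ (cH K 0) = -cH K 0) ∧
      (∀ j : ℤ, s (Multiplicative.ofAdd j) (cX K 0) = cX K 0 ∧
        s (Multiplicative.ofAdd j) (cH K 0) = cH K 0 - (j : CA K 1)) ∧
      (∀ u, ρ u (cX K 0) = ((u : (CA K 1)ˣ) : CA K 1) * cX K 0 ∧ ρ u (cH K 0) = cH K 0) ∧
      (∀ c : Kˣ, ((e (c, 1) : (CA K 1)ˣ) : CA K 1) = algebraMap K (CA K 1) c) ∧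
      (∀ j : ℤ, ((e (1, Multiplicative.ofAdd (Finsupp.single j 1)) : (CA K 1)ˣ) : CA K 1) =
        cH K 0 + (j : CA K 1)) ∧
      orderOf ζ = 2 ∧ Function.Injective s ∧ Function.Injective ρ ∧
      IsInternalSemidirect ⊤ (Subgroup.zpowers ζ) (s.range ⊔ ρ.range) ∧
      IsInternalSemidirect (s.range ⊔ ρ.range) s.range ρ.range ∧
      -- its commutator subgroup
      IsInternalSemidirect (commutator (CA K 1 ≃ₐ[K] CA K 1))
        (Subgroup.zpowers (s (Multiplicative.ofAdd 2)))
        (((calLComm K (cH K (0 : Fin 1))).subgroupOf (calLUnits K (cH K (0 : Fin 1)))).map ρ)) ∧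
    Nonempty (Abelianization (CA K 1 ≃ₐ[K] CA K 1) ≃*
      Multiplicative (ZMod 2) × Multiplicative (ZMod 2) ×
        ((Kˣ × Multiplicative ℤ) ⧸
          ((powMonoidHom 2 : Kˣ →* Kˣ).range.prod ⊥ ⊔
            Subgroup.zpowers ((-1 : Kˣ), Multiplicative.ofAdd (2 : ℤ))))) := by
  refine ⟨⟨permHom K n, facHom K n, fun s i => ⟨permHom_cX s i, permHom_cH s i⟩, facHom_apply,
    permHom_injective, facHom_injective, isInternalSemidirect_top, innAut_eq_map hn,
    exists_outAut_hom hn, commutator_innAut_eq_map hn,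
    fun i => (facSys_isBasis i).commutator_innAut_eq_sigmaAut, exists_commutator_eq⟩,
    ⟨signAut K n, fun i => ⟨signAut_cX i, signAut_cH i⟩, center_eq⟩,
    nonempty_abelianization_equiv hn, ?_, fun _ h => nonempty_abelianization_equiv_four h,
    exists_fac_equiv, cSys_isBasis.exists_structure,
    cSys_isBasis.nonempty_abelianization_equiv_quotient⟩
  rintro _ rfl
  exact nonempty_abelianization_equiv_three
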